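/- \textbf{Setting.} Consider evolution equations $$u_t=F(t,x,u,u_x,u_{xx},u_{xxx})\,u_{xxxx}+G(t,x,u,u_x,u_{xx},u_{xxx}),\qquad (*)$$ where $F,G$ are smooth and $F\neq 0$ on an open set $\Omega\subseteq\mathbb R^6$. A smooth vector field $V=\tau\partial_t+\xi\partial_x+\eta\partial_u$, with $\tau,\xi,\eta$ functions of $(t,x,u)$ on an open set $D\subseteq\mathbb R^3$, is \emph{admitted} by $(*)$ over $D$ (generates a local one-parameter invariance group) if Lie's criterion holds: with $\eta^t=D_t\eta-u_tD_t\tau-u_xD_t\xi$, $\eta^x=D_x\eta-u_tD_x\tau-u_xD_x\xi$, $\eta^{xx}=D_x\eta^x-u_{xt}D_x\tau-u_{xx}D_x\xi$, and so on, the prolonged field annihilates $u_t-Fu_{xxxx}-G$ at all jets over $D$ with $(t,x,u,u_x,u_{xx},u_{xxx})\in\Omega$ at which $(*)$ is satisfied. An \emph{equivalence transformation} is a smooth invertible local change of variables $\bar t=T(t)$, $\bar x=X(t,x,u)$, $\bar u=U(t,x,u)$ with $\dot T\ne0$ and $\partial(X,U)/\partial(x,u)\neq0$; it acts on vector fields,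 on jets and on equations. An \emph{open part} of an equation is its restriction to an open subset of $\Omega$. The span $\langle V_0\rangle$ is the \emph{maximal invariance algebra} of $(*)$ if $V_0$ is admitted and if, for every open part of the equation and every connected open set $D$ of points $(t,x,u)$ covered by this part, every smooth vector field on $D$ admitted by the part is a constant multiple of $V_0$. \textbf{Theorem 1.} \begin{enumerate} \item Let $V$ be admitted by $(*)$ over $D$. Let $R\subseteq D$ be the set of points $p$ with $V(p)\neq0$ such that either $\tau(p)\ne0$ or $\tau$ vanishes identically near $p$. Then $R$ is open and is dense in $\{p\in D: V(p)\neq 0\}$. Near every point of $\Omega$ lying over a point $p\in R$, some equivalence transformation defined near $p$ carries $V$ into $\partial_t$ and $(*)$ into an equation with $F,G$ independent of $t$ if $\tau(p)\neq0$, and carries $V$ into $\partial_x$ and $(*)$ into an equation with $F,G$ independent of $x$ if $\tau(p)=0$. \item If $F$ and $G$ are independent of $t$ (of $x$), then $(*)$ admits $\partial_t$ ($\partial_x$). The converse holds if all the lines parallel to the $t$-axis (to the $x$-axis) meet $\Omega$ in convex sets. \item The two cases are inequivalent. No equivalence transformation (with non-empty domain) carries $\partial_t$ into a constant multiple of $\partial_x$,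 or $\partial_x$ into a constant multiple of $\partial_t$. If $(*)$ has the maximal invariance algebra $\langle\partial_t\rangle$, then no non-empty open part of it is carried by an equivalence transformation into an equation with $F,G$ independent of $x$; if it has the maximal invariance algebra $\langle\partial_x\rangle$, then no non-empty open part of it is carried into one with $F,G$ independent of $t$. \item For generic $F,G$ independent of $t$ (of $x$) the maximal invariance algebra is $\langle\partial_t\rangle$ ($\langle\partial_x\rangle$). Precisely, for every equation $(*)$ with $F,G$ independent of $t$ (of $x$) there are functions $F_0,G_0$ such that, for every $\varepsilon\ge0$, the coefficients $F+\varepsilon F_0$, $G+\varepsilon G_0$ give an equation of the same kind on $\Omega$, and for all but countably many $\varepsilon\geq0$ its maximal invariance algebra is $\langle\partial_t\rangle$ ($\langle\partial_x\rangle$). \end{enumerate} -/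

import Mathlib

open scoped ContDiff Topology

/-- Points `(t, x, u)` of the space of independent and dependent variables. -/
abbrev Base := Fin 3 → ℝ

/-- Points `(t, x, u, u_x, u_xx, u_xxx)`: the arguments of the coefficients of an equation. -/
abbrev Jet3 := Fin 6 → ℝ

/-- The projection `(t, x, u, u_x, u_xx, u_xxx) ↦ (t, x, u)`. -/
def Jet3.base (z : Jet3) : Base := ![z 0, z 1, z 2]

noncomputable section

/-! ### Derivatives of functions of `(t, x)` -/

/-- Partial derivative with respect to `t`. -/
def Dt (f : ℝ × ℝ → ℝ) (q : ℝ × ℝ) : ℝ := fderiv ℝ f q (1, 0)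

/-- Partial derivative with respect to `x`. -/
def Dx (f : ℝ × ℝ → ℝ) (q : ℝ × ℝ) : ℝ := fderiv ℝ f q (0, 1)

/-- The point `(t, x, u(t, x))` of the graph of `u`. -/
def graphPt (u : ℝ × ℝ → ℝ) (q : ℝ × ℝ) : Base := ![q.1, q.2, u q]

/-- `(t, x, u, u_x, u_xx, u_xxx)` evaluated along `u`. -/
def jet3 (u : ℝ × ℝ → ℝ) (q : ℝ × ℝ) : Jet3 :=
  ![q.1, q.2, u q, Dx u q, Dx^[2] u q, Dx^[3] u q]

/-! ### The class of equations -/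

/-- An equation `u_t = F(t,x,u,u_x,u_xx,u_xxx) u_xxxx + G(t,x,u,u_x,u_xx,u_xxx)` with `F`, `G`
smooth and `F ≠ 0` on an open set `dom`. The values of `F` and `G` off `dom` are irrelevant. -/
structure EvolEq where
  dom : Set Jet3
  F : Jet3 → ℝ
  G : Jet3 → ℝ
  isOpen_dom : IsOpen dom
  smooth_F : ContDiffOn ℝ ∞ F dom
  smooth_G : ContDiffOn ℝ ∞ G dom
  F_ne_zero : ∀ z ∈ dom, F z ≠ 0

namespace EvolEq

/-- The same equation on the smaller domain `E.dom ∩ N`. -/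
def restrict (E : EvolEq) (N : Set Jet3) (hN : IsOpen N) : EvolEq where
  dom := E.dom ∩ N
  F := E.F
  G := E.G
  isOpen_dom := E.isOpen_dom.inter hN
  smooth_F := E.smooth_F.mono Set.inter_subset_left
  smooth_G := E.smooth_G.mono Set.inter_subset_left
  F_ne_zero := fun z hz => E.F_ne_zero z hz.1

/-- The function `u` satisfies the equation at the point `q = (t, x)`. -/
def HoldsAt (E : EvolEq) (u : ℝ × ℝ → ℝ) (q : ℝ × ℝ) : Prop :=
  Dt u q = E.F (jet3 u q) * Dx^[4] u q + E.G (jet3 u q)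

/-- `F` and `G` do not depend on the `i`-th argument (`i = 0` is `t` and `i = 1` is `x`). -/
def IndepOf (E : EvolEq) (i : Fin 6) : Prop :=
  ∀ z ∈ E.dom, ∀ z' ∈ E.dom, (∀ j, j ≠ i → z j = z' j) → E.F z = E.F z' ∧ E.G z = E.G z'

/-- The domain meets every line parallel to the `i`-th axis in a convex set. -/
def LineConvex (E : EvolEq) (i : Fin 6) : Prop :=
  ∀ z ∈ E.dom, ∀ z' ∈ E.dom, (∀ j, j ≠ i → z j = z' j) → segment ℝ z z' ⊆ E.dom

end EvolEq

/-! ### Vector fields, their prolongation, and Lie's invariance criterion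

A vector field `V = τ ∂_t + ξ ∂_x + η ∂_u` is the map `V : Base → Base` with components
`V p 0 = τ p`, `V p 1 = ξ p`, `V p 2 = η p`. The total derivatives `D_t`, `D_x` of an expression in
`t, x, u, u_t, u_x, …` are evaluated at the jet of a function `u` by substituting
`u` and then differentiating with respect to `t` or `x`; every jet is the jet of such a `u`. -/

/-- The vector field `∂_t`. -/
def fieldT : Base → Base := fun _ => ![1, 0, 0]

/-- The vector field `∂_x`. -/
def fieldX : Base → Base := fun _ => ![0, 1, 0]

/-- The `i`-th component of `V` along the graph of `u`. -/
def along (V : Base → Base) (i : Fin 3) (u : ℝ × ℝ → ℝ) (q : ℝ × ℝ) : ℝ := V (graphPt u q) i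

/-- `η^t = D_t η - u_t D_t τ - u_x D_t ξ`. -/
def etaT (V : Base → Base) (u : ℝ × ℝ → ℝ) (q : ℝ × ℝ) : ℝ :=
  Dt (along V 2 u) q - Dt u q * Dt (along V 0 u) q - Dx u q * Dt (along V 1 u) q

/-- `η`, `η^x`, `η^xx`, …, through
`η^(k+1) = D_x η^(k) - (∂_x^k u_t) D_x τ - (∂_x^(k+1) u) D_x ξ`. -/
def etaX (V : Base → Base) (u : ℝ × ℝ → ℝ) : ℕ → ℝ × ℝ → ℝ
  | 0 => along V 2 u
  | k + 1 => fun q =>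
      Dx (etaX V u k) q - Dx^[k] (Dt u) q * Dx (along V 0 u) q
        - Dx^[k + 1] u q * Dx (along V 1 u) q

/-- The components of the prolonged field in the directions `t, x, u, u_x, u_xx, u_xxx`. -/
def prol3 (V : Base → Base) (u : ℝ × ℝ → ℝ) (q : ℝ × ℝ) : Jet3 :=
  ![along V 0 u q, along V 1 u q, etaX V u 0 q, etaX V u 1 q, etaX V u 2 q, etaX V u 3 q]

/-- Lie's invariance criterion, for the part of the equation lying over `D`: the prolonged field
annihilates `u_t - F u_xxxx - G` at all jets at which the equation is satisfied. -/
def EvolEq.Admits (E : EvolEq) (V : Base → Base) (D : Set Base) : Prop :=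
  ∀ (u : ℝ × ℝ → ℝ) (q : ℝ × ℝ), ContDiffAt ℝ ∞ u q → graphPt u q ∈ D → jet3 u q ∈ E.dom →
    E.HoldsAt u q →
      etaT V u q - fderiv ℝ E.F (jet3 u q) (prol3 V u q) * Dx^[4] u q
        - etaX V u 4 q * E.F (jet3 u q) - fderiv ℝ E.G (jet3 u q) (prol3 V u q) = 0

/-- The one-dimensional algebra spanned by `V₀` is the maximal invariance algebra of `E`, also
locally: `V₀` is admitted, and every vector field admitted by an open part of the equation, over
a connected open set `D` of points `(t, x, u)` covered by this part, is a constant multiple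
of `V₀`. -/
def EvolEq.MaximalAlgebra (E : EvolEq) (V₀ : Base → Base) : Prop :=
  E.Admits V₀ Set.univ ∧
  ∀ (N : Set Jet3) (hN : IsOpen N) (D : Set Base), IsOpen D → IsPreconnected D →
    D ⊆ Jet3.base '' (E.restrict N hN).dom →
    ∀ V : Base → Base, ContDiffOn ℝ ∞ V D → (E.restrict N hN).Admits V D →
      ∃ c : ℝ, ∀ p ∈ D, V p = c • V₀ p

/-! ### Equivalence transformations -/

/-- A local change of variables `t' = T(t)`, `x' = X(t,x,u)`, `u' = U(t,x,u)`, invertible on the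
open set `source`, with `dT/dt ≠ 0` and `∂(X,U)/∂(x,u) ≠ 0`. -/
structure EquivTransf where
  source : Set Base
  T : ℝ → ℝ
  X : Base → ℝ
  U : Base → ℝ
  isOpen_source : IsOpen source
  smooth_T : ContDiffOn ℝ ∞ T ((fun p : Base => p 0) '' source)
  smooth_X : ContDiffOn ℝ ∞ X source
  smooth_U : ContDiffOn ℝ ∞ U source
  injOn : Set.InjOn (fun p : Base => (![T (p 0), X p, U p] : Base)) source
  deriv_T_ne_zero : ∀ p ∈ source, deriv T (p 0) ≠ 0
  jacobian_ne_zero : ∀ p ∈ source,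
    fderiv ℝ X p (Pi.single 1 1) * fderiv ℝ U p (Pi.single 2 1)
      - fderiv ℝ X p (Pi.single 2 1) * fderiv ℝ U p (Pi.single 1 1) ≠ 0

namespace EquivTransf

/-- The transformation as a map `(t, x, u) ↦ (t', x', u')`. -/
def toFun (Φ : EquivTransf) (p : Base) : Base := ![Φ.T (p 0), Φ.X p, Φ.U p]

/-- The transformation carries the vector field `V` into `V'`. -/
def Carries (Φ : EquivTransf) (V V' : Base → Base) : Prop :=
  ∀ p ∈ Φ.source, fderiv ℝ Φ.toFun p (V p) = V' (Φ.toFun p)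

/-- The point `(t', x')` corresponding to the point `q = (t, x)` along `u`. -/
def newPt (Φ : EquivTransf) (u : ℝ × ℝ → ℝ) (q : ℝ × ℝ) : ℝ × ℝ :=
  (Φ.T q.1, Φ.X (graphPt u q))

/-- Near the point `q`, the transformation carries the function `u` into the function `v`:
`v(T(t), X(t,x,u(t,x))) = U(t,x,u(t,x))`. -/
def CarriesFun (Φ : EquivTransf) (u v : ℝ × ℝ → ℝ) (q : ℝ × ℝ) : Prop :=
  ContDiffAt ℝ ∞ u q ∧ graphPt u q ∈ Φ.source ∧ ContDiffAt ℝ ∞ v (Φ.newPt u q) ∧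
    ∀ᶠ r in 𝓝 q, v (Φ.newPt u r) = Φ.U (graphPt u r)

/-- The prolonged transformation carries the jet `z` into the jet `z'`. -/
def CarriesJet (Φ : EquivTransf) (z z' : Jet3) : Prop :=
  ∃ (u v : ℝ × ℝ → ℝ) (q : ℝ × ℝ),
    Φ.CarriesFun u v q ∧ jet3 u q = z ∧ jet3 v (Φ.newPt u q) = z'

/-- The transformation carries the equation `E` into the equation `E'`: the domains correspond to
each other under the prolonged transformation, and, for corresponding functions, `E` holds at a
point if and only if `E'` holds at the corresponding point. -/
def CarriesEq (Φ : EquivTransf) (E E' : EvolEq) : Prop :=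
  (∀ z ∈ E.dom, ∃ z' ∈ E'.dom, Φ.CarriesJet z z') ∧
  (∀ z' ∈ E'.dom, ∃ z ∈ E.dom, Φ.CarriesJet z z') ∧
  ∀ (u v : ℝ × ℝ → ℝ) (q : ℝ × ℝ), Φ.CarriesFun u v q →
    jet3 u q ∈ E.dom → jet3 v (Φ.newPt u q) ∈ E'.dom →
      (E.HoldsAt u q ↔ E'.HoldsAt v (Φ.newPt u q))

end EquivTransf

/-- Near the jet `z`, an equivalence transformation defined near the base point of `z` carries `V`
into `V'` and the equation `E` into an equation whose coefficients do not depend on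
the `i`-th argument. -/
def ReducesNear (E : EvolEq) (V : Base → Base) (z : Jet3) (V' : Base → Base) (i : Fin 6) : Prop :=
  ∃ (Φ : EquivTransf) (N : Set Jet3) (hN : IsOpen N) (E' : EvolEq),
    z ∈ N ∧ z.base ∈ Φ.source ∧ Φ.Carries V V' ∧ Φ.CarriesEq (E.restrict N hN) E' ∧ E'.IndepOf i

/-- The points of `D` near which `V = τ ∂_t + ξ ∂_x + η ∂_u` does not vanish and `τ` is either
nowhere zero or identically zero. -/
def regularSet (V : Base → Base) (D : Set Base) : Set Base :=
  {p | p ∈ D ∧ V p ≠ 0 ∧ (V p 0 ≠ 0 ∨ ∀ᶠ p' in 𝓝 p, V p' 0 = 0)}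

/-- For generic coefficients not depending on the `i`-th argument, the algebra spanned by `V₀`
is the maximal invariance algebra: every equation of this kind lies on a ray
`F + ε F₀`, `G + ε G₀`, `ε ≥ 0`, of equations of this kind on the same domain, all but countably
many of which have `⟨V₀⟩` as their maximal invariance algebra. -/
def GenericallyMaximal (i : Fin 6) (V₀ : Base → Base) : Prop :=
  ∀ E : EvolEq, E.IndepOf i →
    ∃ (F₀ G₀ : Jet3 → ℝ) (Eε : ℝ → EvolEq),
      (∀ ε, 0 ≤ ε → (Eε ε).dom = E.dom ∧ (Eε ε).IndepOf i ∧
        ∀ z ∈ E.dom, (Eε ε).F z = E.F z + ε * F₀ z ∧ (Eε ε).G z = E.G z + ε * G₀ z) ∧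
      {ε : ℝ | 0 ≤ ε ∧ ¬ (Eε ε).MaximalAlgebra V₀}.Countable

end

/-! The argument exploits which jet coordinates the equation leaves free. Over a fixed jet (t, x, u,
u_x, u_xx, u_xxx) the equation ties u_t to u_xxxx at a single point only, so u_tx, u_txx, u_txxx
remain arbitrary there. In Lie's criterion u_txxx occurs with coefficient a multiple of F · D_x τ.
Hence D_x τ = 0, and varying u_x gives τ_x = τ_u = 0 (`totD_time_eq_zero`, `fderiv_time_eq_zero`).
What is left is affine in u_xxxx, and its two coefficients are the determining equations
(`determining_equations`).

Reduction to a translation. Since τ depends on t only, V can be straightened by a transformation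
whose time component depends on t only. Where τ ≠ 0, T is a primitive of 1/τ, and X, U are two
invariants of V. Where τ vanishes near the point, t is kept, and the parameter along the orbits of V
serves as X. Both cases use a flow box with prescribed derivative at the point (`exists_flow_box`),
because D_x X ≠ 0 is needed at the given jet for the transformation to be prolonged there.
Smoothness of the flow (`exists_local_flow`) comes from the inverse function theorem in a Banach
space of paths.

Equivariance of Lie's criterion. With the characteristic Q = η − τ u_t − ξ u_x, the components of
the prolonged field are derivatives at ε = 0 of the jets of the family u + εQ at the moving point (t
+ ετ, x + εξ). So the left hand side of the criterion is the derivative of the defect u_t − F u_xxxx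
− G along such a variation (`IsVariation.hasDerivAt_defect`). An equivalence transformation carries
variations into variations and multiplies the defect by a nonvanishing factor. At jets that satisfy
the equation the defect starts at zero, so Lie's expression is multiplied by the same factor
(`EquivTransf.Relates.lieExpr_eq`). The image equation exists because the prolonged transformation
has triangular, invertible derivative (`EquivTransf.exists_equiv_fderiv_prMap`). Once V has become a
translation, the criterion says that the corresponding partial derivatives of F and G vanish
(`lieExpr_translation`).

Inequivalence. An equivalence transformation multiplies the t-component of a field by T' ≠ 0, so it
never exchanges fields with and without t-component. If an open part of an equation with maximal
algebra ⟨V₀⟩ were carried into an equation with the other translation symmetry, the pullback of that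
translation would be admitted by equivariance, hence would be a multiple of V₀
(`EquivTransf.exists_pullConst_eq`), and the t-components would disagree.

Genericity. The first determining equation is linear in seven quantities that do not involve u_xxx:
4 D_x ξ − τ_t, one of τ and ξ, η, η^x, η^xx, and the two coefficients of η^xxx as an affine function
of u_xxx. Sampling at seven values of u_xxx gives a square system whose matrix is affine in ε. The
perturbation of F is the exponential of a polynomial, chosen so that the ε-part is invertible by a
Vandermonde argument (`fieldRow_perturb_injective`), so only finitely many ε are bad. Sampling once
in each member of a countable basis of open sets makes the exceptional set countable
(`exists_countable_forall_dense`). For every other ε ≥ 0 the unknowns vanish on a dense set of jets,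
hence everywhere, and only the translation survives. -/

noncomputable section

/-! ### Directional derivatives -/

section DirectionalDerivative

variable {𝓔 : Type*} [NormedAddCommGroup 𝓔] [NormedSpace ℝ 𝓔]

/-- The derivative of `f` in the constant direction `a`. -/
def pd (a : 𝓔) (f : 𝓔 → ℝ) (p : 𝓔) : ℝ := fderiv ℝ f p a

theorem contDiffAt_pd {a : 𝓔} {f : 𝓔 → ℝ} {p : 𝓔} (hf : ContDiffAt ℝ ∞ f p) :
    ContDiffAt ℝ ∞ (pd a f) p :=
  (hf.fderiv_right (m := ∞) (by simp)).clm_apply contDiffAt_const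

theorem contDiffAt_iterate_pd {a : 𝓔} {f : 𝓔 → ℝ} {p : 𝓔} (hf : ContDiffAt ℝ ∞ f p) (k : ℕ) :
    ContDiffAt ℝ ∞ ((pd a)^[k] f) p := by
  induction k with
  | zero => exact hf
  | succ k ih => rw [Function.iterate_succ_apply']; exact contDiffAt_pd ih

theorem eventually_contDiffAt {F : Type*} [NormedAddCommGroup F] [NormedSpace ℝ F] {f : 𝓔 → F}
    {p : 𝓔} (hf : ContDiffAt ℝ ∞ f p) (n : ℕ) :
    ∀ᶠ r in 𝓝 p, ContDiffAt ℝ n f r :=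
  (hf.of_le (by exact_mod_cast le_top) : ContDiffAt ℝ n f p).eventually (by simp)

theorem eventually_differentiableAt {F : Type*} [NormedAddCommGroup F] [NormedSpace ℝ F]
    {f : 𝓔 → F} {p : 𝓔} (hf : ContDiffAt ℝ ∞ f p) : ∀ᶠ r in 𝓝 p, DifferentiableAt ℝ f r :=
  (eventually_contDiffAt hf 1).mono fun _ h => h.differentiableAt (by simp)

theorem pd_congr {a : 𝓔} {f g : 𝓔 → ℝ} {p : 𝓔} (h : f =ᶠ[𝓝 p] g) : pd a f =ᶠ[𝓝 p] pd a g :=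
  (h.fderiv (𝕜 := ℝ)).mono fun r hr => by simp only [pd, hr]

theorem iterate_pd_congr {a : 𝓔} {f g : 𝓔 → ℝ} {p : 𝓔} (h : f =ᶠ[𝓝 p] g) (k : ℕ) :
    (pd a)^[k] f =ᶠ[𝓝 p] (pd a)^[k] g := by
  induction k with
  | zero => exact h
  | succ k ih => simp only [Function.iterate_succ_apply']; exact pd_congr ih

theorem pd_comm_of_contDiffAt {a b : 𝓔} {f : 𝓔 → ℝ} {p : 𝓔} (hf : ContDiffAt ℝ 2 f p) :
    pd a (pd b f) p = pd b (pd a f) p := by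
  have hd : DifferentiableAt ℝ (fderiv ℝ f) p :=
    (hf.fderiv_right (m := 1) (by norm_num)).differentiableAt (by simp)
  have h := hf.isSymmSndFDerivAt (by simp) a b
  have e : ∀ c d : 𝓔, pd c (pd d f) p = fderiv ℝ (fderiv ℝ f) p c d := fun c d => by
    unfold pd
    rw [fderiv_clm_apply hd (differentiableAt_const d)]
    simp
  rw [e, e, h]

theorem pd_comm {a b : 𝓔} {f : 𝓔 → ℝ} {p : 𝓔} (hf : ContDiffAt ℝ ∞ f p) :
    pd a (pd b f) =ᶠ[𝓝 p] pd b (pd a f) :=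
  (eventually_contDiffAt hf 2).mono fun _ h => pd_comm_of_contDiffAt (by exact_mod_cast h)

theorem pd_iterate_comm {a b : 𝓔} {f : 𝓔 → ℝ} {p : 𝓔} (hf : ContDiffAt ℝ ∞ f p) (k : ℕ) :
    pd a ((pd b)^[k] f) =ᶠ[𝓝 p] (pd b)^[k] (pd a f) := by
  induction k with
  | zero => rfl
  | succ k ih =>
    simp only [Function.iterate_succ_apply']
    exact (pd_comm (contDiffAt_iterate_pd hf k)).trans (pd_congr ih)

theorem pd_add {a : 𝓔} {f g : 𝓔 → ℝ} {p : 𝓔} (hf : DifferentiableAt ℝ f p)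
    (hg : DifferentiableAt ℝ g p) : pd a (fun r => f r + g r) p = pd a f p + pd a g p := by
  simp [pd, fderiv_fun_add hf hg]

theorem pd_sub {a : 𝓔} {f g : 𝓔 → ℝ} {p : 𝓔} (hf : DifferentiableAt ℝ f p)
    (hg : DifferentiableAt ℝ g p) : pd a (fun r => f r - g r) p = pd a f p - pd a g p := by
  simp [pd, fderiv_fun_sub hf hg]

theorem pd_mul {a : 𝓔} {f g : 𝓔 → ℝ} {p : 𝓔} (hf : DifferentiableAt ℝ f p)
    (hg : DifferentiableAt ℝ g p) :
    pd a (fun r => f r * g r) p = pd a f p * g p + f p * pd a g p := by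
  simp [pd, fderiv_fun_mul hf hg]; ring

theorem pd_div {a : 𝓔} {f g : 𝓔 → ℝ} {p : 𝓔} (hf : DifferentiableAt ℝ f p)
    (hg : DifferentiableAt ℝ g p) (h0 : g p ≠ 0) :
    pd a (fun r => f r / g r) p = (pd a f p * g p - f p * pd a g p) / g p ^ 2 := by
  have hd : DifferentiableAt ℝ (fun r => f r / g r) p := by
    simp only [div_eq_mul_inv]; exact hf.fun_mul (hg.fun_inv h0)
  -- The quotient rule is obtained from the product rule for (f/g) · g.
  have h : f =ᶠ[𝓝 p] fun r => (f r / g r) * g r := by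
    filter_upwards [hg.continuousAt.eventually_ne h0] with r hr
    field_simp
  have h1 := (pd_congr (a := a) h).self_of_nhds
  rw [pd_mul hd hg] at h1
  field_simp
  rw [h1]; field_simp; ring

theorem pd_const (a : 𝓔) (c : ℝ) : pd a (fun _ => c) = fun _ => 0 := by
  funext p; simp [pd]

/-- This lets identities for families with a parameter be read off for the single functions obtained
by freezing it. -/
theorem pd_slice {𝓨 : Type*} [NormedAddCommGroup 𝓨] [NormedSpace ℝ 𝓨] {w : 𝓨 × 𝓔 → ℝ}
    {p : 𝓨 × 𝓔} (a : 𝓔) (hw : DifferentiableAt ℝ w p) :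
    pd a (fun z => w (p.1, z)) p.2 = pd ((0 : 𝓨), a) w p := by
  have h1 : HasFDerivAt (fun z : 𝓔 => (p.1, z)) (ContinuousLinearMap.inr ℝ 𝓨 𝓔) p.2 :=
    hasFDerivAt_prodMk_right p.1 p.2
  have h2 : HasFDerivAt w (fderiv ℝ w p) ((fun z : 𝓔 => (p.1, z)) p.2) := hw.hasFDerivAt
  have := (h2.comp p.2 h1).fderiv
  simp only [pd]
  change fderiv ℝ (w ∘ fun z => (p.1, z)) p.2 a = _
  rw [this]; simp

/-- Iterated derivatives of the slices of `w` are the slices of the iterated derivatives. -/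
theorem iterate_pd_slice {𝓨 : Type*} [NormedAddCommGroup 𝓨] [NormedSpace ℝ 𝓨] {w : 𝓨 × 𝓔 → ℝ}
    {p₀ : 𝓨 × 𝓔} (a : 𝓔) (hw : ContDiffAt ℝ ∞ w p₀) (k : ℕ) :
    ∀ᶠ p in 𝓝 p₀, (pd a)^[k] (fun z => w (p.1, z)) p.2 = (pd ((0 : 𝓨), a))^[k] w p := by
  induction k with
  | zero => exact Filter.Eventually.of_forall fun _ => rfl
  | succ k ih =>
    have hd := eventually_differentiableAt (contDiffAt_iterate_pd (a := ((0 : 𝓨), a)) hw k)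
    filter_upwards [ih.eventually_nhds, hd] with p hp hdp
    simp only [Function.iterate_succ_apply']
    rw [← pd_slice a hdp]
    have hc : Filter.Tendsto (fun z : 𝓔 => (p.1, z)) (𝓝 p.2) (𝓝 p) :=
      (Continuous.prodMk_right p.1).continuousAt
    exact (pd_congr (hc.eventually hp)).self_of_nhds

end DirectionalDerivative

/-- The inverse function theorem, with an inverse that is smooth on its whole domain. -/
theorem exists_smooth_local_inverse {E F : Type*} [NormedAddCommGroup E] [NormedSpace ℝ E]
    [NormedAddCommGroup F] [NormedSpace ℝ F] [CompleteSpace E] {f : E → F} {S : Set E}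
    (hS : IsOpen S) (hf : ContDiffOn ℝ ∞ f S) {a : E} (ha : a ∈ S) {f' : E ≃L[ℝ] F}
    (hf' : fderiv ℝ f a = f') :
    ∃ Ψ : OpenPartialHomeomorph E F, a ∈ Ψ.source ∧ Ψ.source ⊆ S ∧ (∀ x, Ψ x = f x) ∧
      (∀ y ∈ Ψ.target, ContDiffAt ℝ ∞ Ψ.symm y) := by
  have hfa : ∀ x ∈ S, ContDiffAt ℝ ∞ f x := fun x hx => hf.contDiffAt (hS.mem_nhds hx)
  have hd : HasFDerivAt f (f' : E →L[ℝ] F) a :=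
    hf' ▸ ((hfa a ha).differentiableAt (by simp)).hasFDerivAt
  set Ψ := (hfa a ha).toOpenPartialHomeomorph f hd (by simp) with hΨ
  -- Invertibility of the derivative is an open condition. Restricting to the points where it holds
  -- makes the inverse smooth at every point of the target, not only at the image of `a`.
  set S' : Set E := S ∩ fderiv ℝ f ⁻¹' Set.range ((↑) : (E ≃L[ℝ] F) → E →L[ℝ] F)
  have hS' : IsOpen S' :=
    (hf.continuousOn_fderiv_of_isOpen hS (by simp)).isOpen_inter_preimage hS
      ContinuousLinearEquiv.isOpen
  have haS' : a ∈ S' := ⟨ha, f', hf'.symm⟩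
  refine ⟨Ψ.restr S', ?_, ?_, fun x => ?_, ?_⟩
  · rw [Ψ.restr_source' _ hS']
    exact ⟨(hfa a ha).mem_toOpenPartialHomeomorph_source hd (by simp), haS'⟩
  · rw [Ψ.restr_source' _ hS']
    exact fun x hx => hx.2.1
  · rfl
  · intro y hy
    have hx := (Ψ.restr S').map_target hy
    rw [Ψ.restr_source' _ hS'] at hx
    obtain ⟨g, hg⟩ := hx.2.2
    refine (Ψ.restr S').contDiffAt_symm (f₀' := g) hy ?_ (hfa _ hx.2.1)
    have := ((hfa _ hx.2.1).differentiableAt (by simp)).hasFDerivAt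
    rw [← hg] at this
    exact this

/-! ### Functions with prescribed derivatives at a point -/

/-- `∑_{k<n} c_k X^k / k!`. -/
def taylorSum (n : ℕ) (c : ℕ → ℝ) (X : ℝ) : ℝ :=
  ∑ k ∈ Finset.range n, c k * X ^ k / (k.factorial : ℝ)

theorem contDiff_taylorSum (n : ℕ) (c : ℕ → ℝ) : ContDiff ℝ ∞ (taylorSum n c) := by
  unfold taylorSum
  exact ContDiff.sum fun k _ => by fun_prop

theorem taylorSum_zero (n : ℕ) (c : ℕ → ℝ) : taylorSum (n + 1) c 0 = c 0 := by
  unfold taylorSum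
  rw [Finset.sum_range_succ']
  simp

theorem hasDerivAt_taylorSum (n : ℕ) (c : ℕ → ℝ) (X : ℝ) :
    HasDerivAt (taylorSum (n + 1) c) (taylorSum n (fun k => c (k + 1)) X) X := by
  unfold taylorSum
  have : ∀ k ∈ Finset.range (n + 1), HasDerivAt (fun X : ℝ => c k * X ^ k / (k.factorial : ℝ))
      (c k * (k * X ^ (k - 1)) / (k.factorial : ℝ)) X := fun k _ =>
    ((hasDerivAt_pow k X).const_mul (c k)).div_const _
  refine (HasDerivAt.fun_sum this).congr_deriv ?_
  rw [Finset.sum_range_succ']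
  simp only [Nat.cast_zero, zero_mul, mul_zero, zero_div, add_zero]
  refine Finset.sum_congr rfl fun k _ => ?_
  rw [Nat.factorial_succ]
  have : (k.factorial : ℝ) ≠ 0 := by positivity
  have : (k : ℝ) + 1 ≠ 0 := by positivity
  push_cast
  field_simp

/-- A function that is polynomial in `x` and affine in `t`. -/
def testFun (q : ℝ × ℝ) (n : ℕ) (c d : ℕ → ℝ) (r : ℝ × ℝ) : ℝ :=
  taylorSum n c (r.2 - q.2) + (r.1 - q.1) * taylorSum n d (r.2 - q.2)

theorem contDiff_testFun (q : ℝ × ℝ) (n : ℕ) (c d : ℕ → ℝ) : ContDiff ℝ ∞ (testFun q n c d) := by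
  unfold testFun
  have h := contDiff_taylorSum n c
  have h' := contDiff_taylorSum n d
  fun_prop

theorem hasFDerivAt_testFun (q : ℝ × ℝ) (n : ℕ) (c d : ℕ → ℝ) (r : ℝ × ℝ) :
    fderiv ℝ (testFun q (n + 1) c d) r (0, 1)
        = testFun q n (fun k => c (k + 1)) (fun k => d (k + 1)) r ∧
      fderiv ℝ (testFun q (n + 1) c d) r (1, 0) = taylorSum (n + 1) d (r.2 - q.2) := by
  have hX : HasFDerivAt (fun r : ℝ × ℝ => r.2 - q.2) (ContinuousLinearMap.snd ℝ ℝ ℝ) r :=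
    hasFDerivAt_snd.sub_const _
  have hT : HasFDerivAt (fun r : ℝ × ℝ => r.1 - q.1) (ContinuousLinearMap.fst ℝ ℝ ℝ) r :=
    hasFDerivAt_fst.sub_const _
  have h1 := (hasDerivAt_taylorSum n c (r.2 - q.2)).comp_hasFDerivAt r hX
  have h2 := (hasDerivAt_taylorSum n d (r.2 - q.2)).comp_hasFDerivAt r hX
  have h3 : HasFDerivAt (testFun q (n + 1) c d) _ r := h1.add (hT.mul h2)
  rw [h3.fderiv]
  constructor
  · simp [testFun]
  · simp

theorem Dx_testFun (q : ℝ × ℝ) (n : ℕ) (c d : ℕ → ℝ) :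
    Dx (testFun q (n + 1) c d) = testFun q n (fun k => c (k + 1)) (fun k => d (k + 1)) :=
  funext fun r => (hasFDerivAt_testFun q n c d r).1

/-- Since the dependence on t is affine, u_t is again a function of the same form, with coefficients
`d`. The formula for x-derivatives then prescribes all ∂_x^k u_t independently of the ∂_x^k u. -/
theorem Dt_testFun (q : ℝ × ℝ) (n : ℕ) (c d : ℕ → ℝ) :
    Dt (testFun q (n + 1) c d) = testFun q (n + 1) d 0 := by
  funext r
  refine (hasFDerivAt_testFun q n c d r).2.trans ?_
  simp [testFun, taylorSum]

theorem testFun_self (q : ℝ × ℝ) (n : ℕ) (c d : ℕ → ℝ) : testFun q (n + 1) c d q = c 0 := by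
  simp [testFun, taylorSum_zero]

theorem iterate_Dx_testFun (q : ℝ × ℝ) (k n : ℕ) (c d : ℕ → ℝ) :
    Dx^[k] (testFun q (n + k) c d) = testFun q n (fun j => c (j + k)) (fun j => d (j + k)) := by
  induction k generalizing c d with
  | zero => rfl
  | succ k ih =>
    rw [Function.iterate_succ_apply, ← add_assoc, Dx_testFun, ih]
    simp only [add_assoc]

/-- There are smooth functions whose derivatives `∂_x^k u` and `∂_x^k u_t`, `k < n`, at a point
have prescribed values. -/
theorem exists_testFun (q : ℝ × ℝ) (n : ℕ) (c d : ℕ → ℝ) :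
    ∃ u : ℝ × ℝ → ℝ, ContDiff ℝ ∞ u ∧ (∀ k < n, Dx^[k] u q = c k) ∧
      ∀ k < n, Dx^[k] (Dt u) q = d k := by
  refine ⟨testFun q (n + 1) c d, contDiff_testFun _ _ _ _, fun k hk => ?_, fun k hk => ?_⟩
  · obtain ⟨m, rfl⟩ : ∃ m, n = m + k := ⟨n - k, by omega⟩
    rw [add_right_comm, iterate_Dx_testFun, testFun_self, zero_add]
  · obtain ⟨m, rfl⟩ : ∃ m, n = m + k := ⟨n - k, by omega⟩
    rw [Dt_testFun, add_right_comm, iterate_Dx_testFun, testFun_self, zero_add]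

/-! ### Jets and total derivatives -/

section Jets

variable {𝓔 : Type*} [NormedAddCommGroup 𝓔] [NormedSpace ℝ 𝓔]

/-- The point `(t, x, w)` of the graph of `w`, where `t` and `x` are linear coordinates on the
domain of `w`. -/
def gbase (πt πx : 𝓔 →L[ℝ] ℝ) (w : 𝓔 → ℝ) (p : 𝓔) : Base := ![πt p, πx p, w p]

/-- The jet `(t, x, w, w_x, w_xx, w_xxx)`, where `∂_x` is the derivative in the direction `e`. -/
def gjet (πt πx : 𝓔 →L[ℝ] ℝ) (e : 𝓔) (w : 𝓔 → ℝ) (p : 𝓔) : Jet3 :=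
  ![πt p, πx p, w p, pd e w p, (pd e)^[2] w p, (pd e)^[3] w p]

/-- The derivative of a jet, where `a` is the fourth derivative. -/
def jetVec (z : Jet3) (a : ℝ) : Jet3 := ![0, 1, z 3, z 4, z 5, a]

theorem base_jet3 (u : ℝ × ℝ → ℝ) (q : ℝ × ℝ) : Jet3.base (jet3 u q) = graphPt u q := rfl

theorem contDiffAt_gbase (πt πx : 𝓔 →L[ℝ] ℝ) {w : 𝓔 → ℝ} {p : 𝓔} {n : WithTop ℕ∞}
    (hw : ContDiffAt ℝ n w p) : ContDiffAt ℝ n (gbase πt πx w) p := by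
  refine contDiffAt_pi.2 fun i => ?_
  fin_cases i
  · exact πt.contDiff.contDiffAt
  · exact πx.contDiff.contDiffAt
  · exact hw

theorem contDiffAt_gjet (πt πx : 𝓔 →L[ℝ] ℝ) (e : 𝓔) {w : 𝓔 → ℝ} {p : 𝓔}
    (hw : ContDiffAt ℝ ∞ w p) : ContDiffAt ℝ ∞ (gjet πt πx e w) p := by
  refine contDiffAt_pi.2 fun i => ?_
  fin_cases i
  · exact πt.contDiff.contDiffAt
  · exact πx.contDiff.contDiffAt
  · exact hw
  · exact contDiffAt_pd hw
  · exact contDiffAt_iterate_pd hw 2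
  · exact contDiffAt_iterate_pd hw 3

theorem fderiv_gbase (πt πx : 𝓔 →L[ℝ] ℝ) {w : 𝓔 → ℝ} {p : 𝓔} (hw : DifferentiableAt ℝ w p)
    (a : 𝓔) : fderiv ℝ (gbase πt πx w) p a = ![πt a, πx a, pd a w p] := by
  have : HasFDerivAt (gbase πt πx w)
      (ContinuousLinearMap.pi ![πt, πx, fderiv ℝ w p] : 𝓔 →L[ℝ] Base) p := by
    refine hasFDerivAt_pi.2 fun i => ?_
    fin_cases i
    · exact πt.hasFDerivAt
    · exact πx.hasFDerivAt
    · exact hw.hasFDerivAt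
  rw [this.fderiv]
  funext i
  fin_cases i <;> rfl

/-- The chain rule for a function on the graph of `w`. -/
theorem pd_comp_gbase (πt πx : 𝓔 →L[ℝ] ℝ) {w : 𝓔 → ℝ} {p : 𝓔} (hw : DifferentiableAt ℝ w p)
    {f : Base → ℝ} (hf : DifferentiableAt ℝ f (gbase πt πx w p)) (a : 𝓔) :
    pd a (fun r => f (gbase πt πx w r)) p
      = fderiv ℝ f (gbase πt πx w p) ![πt a, πx a, pd a w p] := by
  have hg : DifferentiableAt ℝ (gbase πt πx w) p := by
    refine differentiableAt_pi.2 fun i => ?_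
    fin_cases i
    · exact πt.differentiableAt
    · exact πx.differentiableAt
    · exact hw
  rw [← fderiv_gbase πt πx hw, pd, fderiv_fun_comp p hf hg]
  rfl

theorem fderiv_gjet (πt πx : 𝓔 →L[ℝ] ℝ) {e : 𝓔} (ht : πt e = 0) (hx : πx e = 1) {w : 𝓔 → ℝ}
    {p₀ : 𝓔} (hw : ContDiffAt ℝ ∞ w p₀) :
    ∀ᶠ p in 𝓝 p₀, DifferentiableAt ℝ (gjet πt πx e w) p ∧
      fderiv ℝ (gjet πt πx e w) p e = jetVec (gjet πt πx e w p) ((pd e)^[4] w p) := by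
  filter_upwards [eventually_differentiableAt hw,
    eventually_differentiableAt (contDiffAt_iterate_pd (a := e) hw 1),
    eventually_differentiableAt (contDiffAt_iterate_pd (a := e) hw 2),
    eventually_differentiableAt (contDiffAt_iterate_pd (a := e) hw 3)] with p h0 h1 h2 h3
  have : HasFDerivAt (gjet πt πx e w)
      (ContinuousLinearMap.pi ![πt, πx, fderiv ℝ w p, fderiv ℝ ((pd e)^[1] w) p,
        fderiv ℝ ((pd e)^[2] w) p, fderiv ℝ ((pd e)^[3] w) p] : 𝓔 →L[ℝ] Jet3) p := by
    refine hasFDerivAt_pi.2 fun i => ?_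
    fin_cases i
    · exact πt.hasFDerivAt
    · exact πx.hasFDerivAt
    · exact h0.hasFDerivAt
    · exact h1.hasFDerivAt
    · exact h2.hasFDerivAt
    · exact h3.hasFDerivAt
  refine ⟨this.differentiableAt, ?_⟩
  rw [this.fderiv]
  funext i
  fin_cases i
  · exact ht
  · exact hx
  all_goals rfl

/-- The total derivative of a function of jets, without the term that contains the fourth
derivative. -/
def totD (A : Jet3 → ℝ) (z : Jet3) : ℝ := fderiv ℝ A z (jetVec z 0)

theorem jetVec_eq (z : Jet3) (a : ℝ) : jetVec z a = jetVec z 0 + a • Pi.single 5 1 := by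
  funext i
  fin_cases i <;> simp [jetVec]

theorem fderiv_jetVec (A : Jet3 → ℝ) (z : Jet3) (a : ℝ) :
    fderiv ℝ A z (jetVec z a) = totD A z + a * pd (Pi.single 5 1) A z := by
  rw [jetVec_eq, map_add, map_smul]; rfl

/-- The derivative of a jet along x is the shifted jet with the fourth derivative in its last slot.
The contribution of that slot is kept apart because the fourth derivative varies independently of
the jet. -/
theorem pd_comp_gjet (πt πx : 𝓔 →L[ℝ] ℝ) {e : 𝓔} (ht : πt e = 0) (hx : πx e = 1) {w : 𝓔 → ℝ}
    {p₀ : 𝓔} (hw : ContDiffAt ℝ ∞ w p₀) {A : Jet3 → ℝ}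
    (hA : ∀ᶠ z in 𝓝 (gjet πt πx e w p₀), DifferentiableAt ℝ A z) :
    ∀ᶠ p in 𝓝 p₀, pd e (fun r => A (gjet πt πx e w r)) p
      = totD A (gjet πt πx e w p)
        + (pd e)^[4] w p * pd (Pi.single 5 1) A (gjet πt πx e w p) := by
  filter_upwards [fderiv_gjet πt πx ht hx hw,
    (contDiffAt_gjet πt πx e hw).continuousAt.eventually hA] with p hp hAp
  rw [← fderiv_jetVec, ← hp.2, pd, fderiv_fun_comp p hAp hp.1]
  rfl

end Jets

/-- The projection `Jet3.base` as a continuous linear map. -/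
def baseL : Jet3 →L[ℝ] Base :=
  ContinuousLinearMap.pi ![ContinuousLinearMap.proj 0, ContinuousLinearMap.proj 1,
    ContinuousLinearMap.proj 2]

theorem coe_baseL : ⇑baseL = Jet3.base := by
  funext z i
  fin_cases i <;> rfl

theorem hasFDerivAt_base (z : Jet3) : HasFDerivAt Jet3.base baseL z :=
  coe_baseL ▸ baseL.hasFDerivAt

theorem contDiff_base : ContDiff ℝ ∞ Jet3.base := coe_baseL ▸ baseL.contDiff

theorem continuous_base : Continuous Jet3.base := contDiff_base.continuous

/-- The linear part of `z ↦ jetVec z 0`. -/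
def jetShift : Jet3 →L[ℝ] Jet3 :=
  ContinuousLinearMap.pi ![0, 0, ContinuousLinearMap.proj 3, ContinuousLinearMap.proj 4,
    ContinuousLinearMap.proj 5, 0]

theorem hasFDerivAt_jetVec (z : Jet3) : HasFDerivAt (fun z => jetVec z 0) jetShift z := by
  have : (fun z => jetVec z 0) = fun z => Pi.single 1 1 + jetShift z := by
    funext z i
    fin_cases i <;> simp [jetVec, jetShift]
  rw [this]
  exact jetShift.hasFDerivAt.const_add _

/-- This encodes the commutator [∂_{u_k}, D_x] = ∂_{u_{k−1}} for k ≥ 1. The derivative of order k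
has index k + 2, so the threshold is 3. -/
theorem jetShift_single (j : Fin 6) :
    jetShift (Pi.single j 1) = if 3 ≤ j then Pi.single (j - 1) 1 else 0 := by
  funext i
  fin_cases j <;> fin_cases i <;> simp [jetShift]

theorem contDiffOn_totD {A : Jet3 → ℝ} {S : Set Jet3} (hS : IsOpen S) (hA : ContDiffOn ℝ ∞ A S) :
    ContDiffOn ℝ ∞ (totD A) S := by
  refine (hA.fderiv_of_isOpen hS (m := ∞) (by simp)).clm_apply (ContDiff.contDiffOn ?_)
  have : (fun z => jetVec z 0) = fun z => Pi.single 1 1 + jetShift z := by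
    funext z i
    fin_cases i <;> simp [jetVec, jetShift]
  rw [this]
  exact contDiff_const.add jetShift.contDiff

/-- Partial derivatives commute with the total derivative up to a shift. -/
theorem pd_totD {A : Jet3 → ℝ} {z : Jet3} (hA : ContDiffAt ℝ ∞ A z) (e : Jet3) :
    pd e (totD A) z = totD (pd e A) z + fderiv ℝ A z (jetShift e) := by
  have hd : DifferentiableAt ℝ (fderiv ℝ A) z :=
    (hA.fderiv_right (m := ∞) (by simp)).differentiableAt (by simp)
  have hs : IsSymmSndFDerivAt ℝ A z := hA.isSymmSndFDerivAt (by
    rw [minSmoothness_of_isRCLikeNormedField]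
    exact WithTop.coe_le_coe.2 (le_top : (2 : ℕ∞) ≤ ⊤))
  unfold pd totD
  rw [fderiv_clm_apply hd (hasFDerivAt_jetVec z).differentiableAt,
    fderiv_clm_apply hd (differentiableAt_const e), (hasFDerivAt_jetVec z).fderiv]
  simp [hs e (jetVec z 0), add_comm]

/-- `A` is smooth and depends on derivatives of order at most `k` only, on the set `S`. -/
def HasOrder (k : ℕ) (A : Jet3 → ℝ) (S : Set Jet3) : Prop :=
  ContDiffOn ℝ ∞ A S ∧ ∀ z ∈ S, ∀ j : Fin 6, k + 2 < j.val → pd (Pi.single j 1) A z = 0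

/-! ### Calculus of functions of jets of bounded order. -/

namespace HasOrder

variable {k l : ℕ} {A B : Jet3 → ℝ} {S S' : Set Jet3}

theorem contDiffAt (h : HasOrder k A S) (hS : IsOpen S) {z : Jet3} (hz : z ∈ S) :
    ContDiffAt ℝ ∞ A z :=
  h.1.contDiffAt (hS.mem_nhds hz)

theorem differentiableAt (h : HasOrder k A S) (hS : IsOpen S) {z : Jet3} (hz : z ∈ S) :
    DifferentiableAt ℝ A z :=
  (h.contDiffAt hS hz).differentiableAt (by simp)

theorem mono (h : HasOrder k A S) (hS : S' ⊆ S) : HasOrder k A S' :=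
  ⟨h.1.mono hS, fun z hz => h.2 z (hS hz)⟩

theorem of_le (h : HasOrder k A S) (hk : k ≤ l) : HasOrder l A S :=
  ⟨h.1, fun z hz j hj => h.2 z hz j (by omega)⟩

theorem sub (hA : HasOrder k A S) (hB : HasOrder k B S) (hS : IsOpen S) :
    HasOrder k (fun z => A z - B z) S :=
  ⟨hA.1.sub hB.1, fun z hz j hj => by
    rw [pd_sub (hA.differentiableAt hS hz) (hB.differentiableAt hS hz), hA.2 z hz j hj,
      hB.2 z hz j hj, sub_zero]⟩

theorem mul (hA : HasOrder k A S) (hB : HasOrder k B S) (hS : IsOpen S) :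
    HasOrder k (fun z => A z * B z) S :=
  ⟨hA.1.mul hB.1, fun z hz j hj => by
    rw [pd_mul (hA.differentiableAt hS hz) (hB.differentiableAt hS hz), hA.2 z hz j hj,
      hB.2 z hz j hj, zero_mul, mul_zero, add_zero]⟩

theorem div (hA : HasOrder k A S) (hB : HasOrder k B S) (hS : IsOpen S)
    (h0 : ∀ z ∈ S, B z ≠ 0) : HasOrder k (fun z => A z / B z) S :=
  ⟨hA.1.div hB.1 h0, fun z hz j hj => by
    rw [pd_div (hA.differentiableAt hS hz) (hB.differentiableAt hS hz) (h0 z hz), hA.2 z hz j hj,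
      hB.2 z hz j hj, zero_mul, mul_zero, sub_zero, zero_div]⟩

theorem coord (S : Set Jet3) {i : Fin 6} (hi : i.val ≤ k + 2) : HasOrder k (fun z => z i) S := by
  refine ⟨by fun_prop, fun z _ j hj => ?_⟩
  have hij : i ≠ j := by rintro rfl; omega
  have : HasFDerivAt (fun z : Jet3 => z i) (ContinuousLinearMap.proj i : Jet3 →L[ℝ] ℝ) z :=
    (ContinuousLinearMap.proj i : Jet3 →L[ℝ] ℝ).hasFDerivAt
  rw [pd, this.fderiv]
  simp [hij]

/-- By the commutator rule ∂_j D_x A = D_x ∂_j A + ∂_{j−1} A, and both terms vanish once j exceeds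
the index of the derivative of order k + 1. -/
theorem totD (hA : HasOrder k A S) (hS : IsOpen S) (hk : k ≤ 2) : HasOrder (k + 1) (totD A) S := by
  refine ⟨contDiffOn_totD hS hA.1, fun z hz j hj => ?_⟩
  have h0 : pd (Pi.single j 1) A =ᶠ[𝓝 z] fun _ => 0 := by
    filter_upwards [hS.mem_nhds hz] with y hy using hA.2 y hy j (by omega)
  have h3 : (3 : Fin 6) ≤ j := by rw [Fin.le_def]; simp; omega
  rw [pd_totD (hA.contDiffAt hS hz), jetShift_single, if_pos h3, _root_.totD, h0.fderiv_eq]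
  have : pd (Pi.single (j - 1) 1) A z = 0 := hA.2 z hz _ (by
    have : (1 : Fin 6) ≤ j := le_trans (by decide) h3
    rw [Fin.sub_val_of_le this]; simp; omega)
  rw [pd] at this
  rw [this]; simp

/-- The derivative with respect to the highest derivative is not changed by the total
derivative. -/
theorem pd_totD_top (hA : HasOrder k A S) (hS : IsOpen S) {z : Jet3} (hz : z ∈ S) {j : Fin 6}
    (hj : j.val = k + 3) :
    pd (Pi.single j 1) (_root_.totD A) z = pd (Pi.single (j - 1) 1) A z := by
  have h0 : pd (Pi.single j 1) A =ᶠ[𝓝 z] fun _ => 0 := by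
    filter_upwards [hS.mem_nhds hz] with y hy using hA.2 y hy j (by omega)
  have h3 : (3 : Fin 6) ≤ j := by rw [Fin.le_def]; simp; omega
  rw [pd_totD (hA.contDiffAt hS hz), jetShift_single, if_pos h3, _root_.totD, h0.fderiv_eq]
  simp [pd]

theorem comp_base {f : Base → ℝ} {D : Set Base} (hf : ContDiffOn ℝ ∞ f D) (hD : IsOpen D) :
    HasOrder 0 (fun z => f (Jet3.base z)) (Jet3.base ⁻¹' D) := by
  have hb : ∀ z, HasFDerivAt Jet3.base baseL z := hasFDerivAt_base
  have hc : ContDiff ℝ ∞ Jet3.base := contDiff_base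
  refine ⟨hf.comp hc.contDiffOn fun z hz => hz, fun z hz j hj => ?_⟩
  have hfd : DifferentiableAt ℝ f (Jet3.base z) :=
    (hf.contDiffAt (hD.mem_nhds hz)).differentiableAt (by simp)
  rw [pd, fderiv_fun_comp z hfd (hb z).differentiableAt, (hb z).fderiv]
  have : baseL (Pi.single j 1) = 0 := by
    funext i
    fin_cases j <;> simp at hj <;> fin_cases i <;> simp [baseL]
  simp [this]

/-- A function of order at most `2` does not depend on the last argument. -/
theorem eq_of_base_mem {D : Set Base} (hD : IsOpen D) (hA : HasOrder k A (Jet3.base ⁻¹' D))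
    (hk : k ≤ 2) {z : Jet3} (hz : Jet3.base z ∈ D) (s s' : ℝ) :
    A (Function.update z 5 s) = A (Function.update z 5 s') := by
  have hmem : ∀ s : ℝ, Function.update z 5 s ∈ Jet3.base ⁻¹' D := fun s => by
    have : Jet3.base (Function.update z 5 s) = Jet3.base z := by
      funext i; fin_cases i <;> simp [Jet3.base, Function.update]
    rwa [Set.mem_preimage, this]
  have hd : ∀ s : ℝ, HasDerivAt (fun s : ℝ => A (Function.update z 5 s)) 0 s := fun s => by
    have h1 : HasDerivAt (fun s : ℝ => Function.update z 5 s) (Pi.single 5 1) s :=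
      hasDerivAt_update z 5 s
    have h2 := (hA.differentiableAt (hD.preimage continuous_base) (hmem s)).hasFDerivAt.comp_hasDerivAt s h1
    have h3 := hA.2 _ (hmem s) 5 (by simp; omega)
    rw [pd] at h3
    rwa [h3] at h2
  exact is_const_of_deriv_eq_zero (fun s => (hd s).differentiableAt) (fun s => (hd s).deriv) _ _

end HasOrder

/-- The chain rule for a function of low order along a jet. -/
theorem pd_comp_gjet_of_hasOrder {𝓔 : Type*} [NormedAddCommGroup 𝓔] [NormedSpace ℝ 𝓔]
    (πt πx : 𝓔 →L[ℝ] ℝ) {e : 𝓔} (ht : πt e = 0) (hx : πx e = 1) {w : 𝓔 → ℝ}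
    {p₀ : 𝓔} (hw : ContDiffAt ℝ ∞ w p₀) {A : Jet3 → ℝ} {S : Set Jet3} (hS : IsOpen S) {k : ℕ}
    (hk : k ≤ 2) (hA : HasOrder k A S) (hp : gjet πt πx e w p₀ ∈ S) :
    ∀ᶠ p in 𝓝 p₀, pd e (fun r => A (gjet πt πx e w r)) p = totD A (gjet πt πx e w p) := by
  have hev : ∀ᶠ z in 𝓝 (gjet πt πx e w p₀), z ∈ S := hS.mem_nhds hp
  filter_upwards [pd_comp_gjet πt πx ht hx hw (hev.mono fun z hz => hA.differentiableAt hS hz),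
    (contDiffAt_gjet πt πx e hw).continuousAt.eventually hev] with p h1 h2
  rw [h1, hA.2 _ h2 5 (by simp; omega), mul_zero, add_zero]

section

/-! ### The determining equations -/

local notation "πt" => ContinuousLinearMap.fst ℝ ℝ ℝ
local notation "πx" => ContinuousLinearMap.snd ℝ ℝ ℝ

theorem Dx_eq_pd : Dx = pd (0, 1) := rfl

theorem Dt_eq_pd : Dt = pd (1, 0) := rfl

theorem isOpenMap_base : IsOpenMap Jet3.base := by
  rw [← coe_baseL]
  refine baseL.isOpenMap fun p => ⟨![p 0, p 1, p 2, 0, 0, 0], ?_⟩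
  funext i
  fin_cases i <;> rfl

theorem contDiffOn_component {V : Base → Base} {D : Set Base} (hV : ContDiffOn ℝ ∞ V D)
    (i : Fin 3) : ContDiffOn ℝ ∞ (fun p => V p i) D :=
  contDiffOn_pi.1 hV i

theorem contDiffAt_graphPt {u : ℝ × ℝ → ℝ} {q : ℝ × ℝ} {n : WithTop ℕ∞}
    (hu : ContDiffAt ℝ n u q) : ContDiffAt ℝ n (graphPt u) q :=
  contDiffAt_gbase πt πx hu

theorem contDiffAt_jet3 {u : ℝ × ℝ → ℝ} {q : ℝ × ℝ} (hu : ContDiffAt ℝ ∞ u q) :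
    ContDiffAt ℝ ∞ (jet3 u) q :=
  contDiffAt_gjet πt πx (0, 1) hu

theorem contDiffAt_along {V : Base → Base} {D : Set Base} (hD : IsOpen D)
    (hV : ContDiffOn ℝ ∞ V D) (i : Fin 3) {u : ℝ × ℝ → ℝ} {q : ℝ × ℝ} (hu : ContDiffAt ℝ ∞ u q)
    (hq : graphPt u q ∈ D) : ContDiffAt ℝ ∞ (along V i u) q :=
  ((contDiffOn_component hV i).contDiffAt (hD.mem_nhds hq)).comp q (contDiffAt_graphPt hu)

theorem Dt_along {V : Base → Base} {D : Set Base} (hD : IsOpen D)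
    (hV : ContDiffOn ℝ ∞ V D) (i : Fin 3) {u : ℝ × ℝ → ℝ} {q : ℝ × ℝ} (hu : ContDiffAt ℝ ∞ u q)
    (hq : graphPt u q ∈ D) :
    Dt (along V i u) q = fderiv ℝ (fun p => V p i) (graphPt u q) ![1, 0, Dt u q] :=
  pd_comp_gbase πt πx
    (hu.differentiableAt (by simp))
    (((contDiffOn_component hV i).contDiffAt (hD.mem_nhds hq)).differentiableAt (by simp)) (1, 0)

theorem Dx_comp_jet3 {u : ℝ × ℝ → ℝ} {q : ℝ × ℝ} (hu : ContDiffAt ℝ ∞ u q) {A : Jet3 → ℝ}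
    {S : Set Jet3} (hS : IsOpen S) {k : ℕ} (hA : HasOrder k A S) (hq : jet3 u q ∈ S) :
    ∀ᶠ r in 𝓝 q, Dx (fun r => A (jet3 u r)) r
      = totD A (jet3 u r) + Dx^[4] u r * pd (Pi.single 5 1) A (jet3 u r) :=
  pd_comp_gjet πt πx (e := ((0 : ℝ), (1 : ℝ))) rfl rfl hu <| by
    filter_upwards [hS.mem_nhds hq] with z hz using hA.differentiableAt hS hz

theorem Dx_comp_jet3_of_le {u : ℝ × ℝ → ℝ} {q : ℝ × ℝ} (hu : ContDiffAt ℝ ∞ u q) {A : Jet3 → ℝ}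
    {S : Set Jet3} (hS : IsOpen S) {k : ℕ} (hk : k ≤ 2) (hA : HasOrder k A S)
    (hq : jet3 u q ∈ S) :
    ∀ᶠ r in 𝓝 q, Dx (fun r => A (jet3 u r)) r = totD A (jet3 u r) :=
  pd_comp_gjet_of_hasOrder πt πx (e := ((0 : ℝ), (1 : ℝ))) rfl rfl hu hS hk hA hq

/-- The `i`-th component of a vector field, as a function of jets. -/
def compJet (V : Base → Base) (i : Fin 3) (z : Jet3) : ℝ := V z.base i

/-- The components of the prolonged field as functions of jets, when `D_x τ = 0`. -/
def etaJet (V : Base → Base) : ℕ → Jet3 → ℝ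
  | 0 => compJet V 2
  | k + 1 => fun z => totD (etaJet V k) z - z (Fin.ofNat 6 (k + 3)) * totD (compJet V 1) z

/-- The part of the components of the prolonged field that contains mixed derivatives. -/
def etaMixed (V : Base → Base) (u : ℝ × ℝ → ℝ) : ℕ → ℝ × ℝ → ℝ
  | 0 => fun _ => 0
  | k + 1 => fun r => Dx (etaMixed V u k) r + Dx^[k] (Dt u) r * Dx (along V 0 u) r

/-! ### The prolonged field in jet coordinates. -/

section Field

variable {V : Base → Base} {D : Set Base} (hD : IsOpen D) (hV : ContDiffOn ℝ ∞ V D)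
include hD hV

theorem hasOrder_compJet (i : Fin 3) : HasOrder 0 (compJet V i) (Jet3.base ⁻¹' D) :=
  HasOrder.comp_base (contDiffOn_component hV i) hD

theorem hasOrder_etaJet {k : ℕ} (hk : k ≤ 3) : HasOrder k (etaJet V k) (Jet3.base ⁻¹' D) := by
  have hS := hD.preimage continuous_base
  induction k with
  | zero => exact hasOrder_compJet hD hV 2
  | succ k ih =>
    refine ((ih (by omega)).totD hS (by omega)).sub (HasOrder.mul (HasOrder.coord _ ?_)
      (((hasOrder_compJet hD hV 1).totD hS (by omega)).of_le (by omega)) hS) hS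
    rw [Fin.val_ofNat, Nat.mod_eq_of_lt (by omega)]

theorem fderiv_compJet (i : Fin 3) {z : Jet3} (hz : z.base ∈ D) (v : Jet3) :
    fderiv ℝ (compJet V i) z v = fderiv ℝ (fun p => V p i) z.base v.base := by
  have h1 : DifferentiableAt ℝ (fun p => V p i) z.base :=
    ((contDiffOn_component hV i).contDiffAt (hD.mem_nhds hz)).differentiableAt (by simp)
  change fderiv ℝ (fun z : Jet3 => (fun p => V p i) z.base) z v = _
  rw [fderiv_fun_comp z h1 (hasFDerivAt_base z).differentiableAt, (hasFDerivAt_base z).fderiv]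
  simp [coe_baseL]

theorem totD_compJet (i : Fin 3) {z : Jet3} (hz : z.base ∈ D) :
    totD (compJet V i) z = fderiv ℝ (fun p => V p i) z.base (Pi.single 1 1)
      + z 3 * fderiv ℝ (fun p => V p i) z.base (Pi.single 2 1) := by
  rw [totD, fderiv_compJet hD hV i hz, ← smul_eq_mul, ← map_smul, ← map_add]
  congr 1
  funext j
  fin_cases j <;> simp [Jet3.base, jetVec]

theorem pd_totD_compJet (i : Fin 3) {z : Jet3} (hz : z.base ∈ D) :
    pd (Pi.single 3 1) (totD (compJet V i)) z
      = fderiv ℝ (fun p => V p i) z.base (Pi.single 2 1) := by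
  rw [(hasOrder_compJet hD hV i).pd_totD_top (hD.preimage continuous_base) hz rfl, pd,
    fderiv_compJet hD hV i hz]
  congr 1
  funext j
  fin_cases j <;> simp [Jet3.base, Pi.single, Function.update]

/-- The recursion is linear, so the terms with derivatives of u_t, which come from D_x τ, split off
from a part that depends on the jet alone. The equality is needed on a neighbourhood because the
recursion differentiates it. -/
theorem etaX_eventuallyEq {u : ℝ × ℝ → ℝ} {q : ℝ × ℝ} (hu : ContDiffAt ℝ ∞ u q)
    (hq : graphPt u q ∈ D) {k : ℕ} (hk : k ≤ 3) :
    ContDiffAt ℝ ∞ (etaMixed V u k) q ∧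
      ∀ᶠ r in 𝓝 q, etaX V u k r = etaJet V k (jet3 u r) - etaMixed V u k r := by
  have hS := hD.preimage continuous_base
  have hut : ContDiffAt ℝ ∞ (Dt u) q := contDiffAt_pd hu
  induction k with
  | zero =>
    exact ⟨contDiffAt_const, Filter.Eventually.of_forall fun r => by
      simp [etaX, etaJet, etaMixed, along, compJet, base_jet3]⟩
  | succ k ih =>
    obtain ⟨ihc, ih⟩ := ih (by omega)
    have hord := hasOrder_etaJet hD hV (k := k) (by omega)
    refine ⟨(contDiffAt_pd ihc).add ((contDiffAt_iterate_pd hut k).mul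
      (contDiffAt_pd (contDiffAt_along hD hV 0 hu hq))), ?_⟩
    have hA : ContDiffAt ℝ ∞ (fun r => etaJet V k (jet3 u r)) q :=
      (hord.contDiffAt hS hq).comp q (contDiffAt_jet3 hu)
    filter_upwards [pd_congr (a := ((0 : ℝ), (1 : ℝ))) ih, eventually_differentiableAt ihc,
      eventually_differentiableAt hA, Dx_comp_jet3_of_le hu hS (by omega) hord hq,
      Dx_comp_jet3_of_le hu hS (by omega) (hasOrder_compJet hD hV 1) hq] with r h1 h2 h3 h4 h5
    rw [pd_sub h3 h2] at h1
    simp only [etaX, etaJet, etaMixed]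
    rw [Dx_eq_pd] at *
    rw [h1, h4]
    have e1 : pd (0, 1) (along V 1 u) r = totD (compJet V 1) (jet3 u r) := h5
    -- As k ≤ 2, the index k + 3 does not wrap around modulo 6.
    have e2 : (pd (0, 1))^[k + 1] u r = jet3 u r (Fin.ofNat 6 (k + 3)) := by
      have : k = 0 ∨ k = 1 ∨ k = 2 := by omega
      rcases this with rfl | rfl | rfl <;> rfl
    rw [e1, e2]
    ring

/-- The last prolongation step leaves the space of third order jets: D_x η^xxx is affine in u_xxxx
with slope ∂η^xxx/∂u_xxx, and the recursion subtracts another D_x ξ from that slope. -/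
theorem etaX_four {u : ℝ × ℝ → ℝ} {q : ℝ × ℝ} (hu : ContDiffAt ℝ ∞ u q)
    (hq : graphPt u q ∈ D) :
    etaX V u 4 q = totD (etaJet V 3) (jet3 u q)
      + Dx^[4] u q * (pd (Pi.single 5 1) (etaJet V 3) (jet3 u q) - totD (compJet V 1) (jet3 u q))
      - etaMixed V u 4 q := by
  have hS := hD.preimage continuous_base
  obtain ⟨ihc, ih⟩ := etaX_eventuallyEq hD hV hu hq (k := 3) le_rfl
  have hord := hasOrder_etaJet hD hV (k := 3) le_rfl
  have hA : ContDiffAt ℝ ∞ (fun r => etaJet V 3 (jet3 u r)) q :=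
    (hord.contDiffAt hS hq).comp q (contDiffAt_jet3 hu)
  have h1 := (pd_congr (a := ((0 : ℝ), (1 : ℝ))) ih).self_of_nhds
  rw [pd_sub (hA.differentiableAt (by simp)) (ihc.differentiableAt (by simp))] at h1
  have h4 := (Dx_comp_jet3 hu hS hord hq).self_of_nhds
  have h5 : pd (0, 1) (along V 1 u) q = totD (compJet V 1) (jet3 u q) :=
    (Dx_comp_jet3_of_le hu hS (by omega) (hasOrder_compJet hD hV 1) hq).self_of_nhds
  have e : etaX V u 4 q = Dx (etaX V u 3) q - Dx^[3] (Dt u) q * Dx (along V 0 u) q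
        - Dx^[4] u q * Dx (along V 1 u) q := rfl
  have e' : etaMixed V u 4 q
    = Dx (etaMixed V u 3) q + Dx^[3] (Dt u) q * Dx (along V 0 u) q := rfl
  rw [e, e']
  rw [Dx_eq_pd] at *
  rw [h1, h4, h5]
  ring

/-- If `u_t`, `u_tx`, `u_txx` vanish at a point, only the term with `u_txxx` contributes to the
part with mixed derivatives. -/
theorem etaMixed_eq {u : ℝ × ℝ → ℝ} {q : ℝ × ℝ} (hu : ContDiffAt ℝ ∞ u q)
    (hq : graphPt u q ∈ D) (h0 : ∀ k < 3, Dx^[k] (Dt u) q = 0) :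
    etaMixed V u 1 q = 0 ∧ etaMixed V u 2 q = 0 ∧ etaMixed V u 3 q = 0 ∧
      etaMixed V u 4 q = 4 * Dx^[3] (Dt u) q * totD (compJet V 0) (jet3 u q) := by
  have hS := hD.preimage continuous_base
  have hut : ContDiffAt ℝ ∞ (Dt u) q := contDiffAt_pd hu
  have hτ := contDiffAt_along hD hV 0 hu hq
  have ht : totD (compJet V 0) (jet3 u q) = Dx (along V 0 u) q :=
    ((Dx_comp_jet3_of_le hu hS (by omega) (hasOrder_compJet hD hV 0) hq).self_of_nhds).symm
  rw [ht]
  rw [Dx_eq_pd] at *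
  have hm := fun k => eventually_differentiableAt (contDiffAt_iterate_pd (a := ((0 : ℝ), (1 : ℝ))) hut k)
  have hs := fun k => eventually_differentiableAt (contDiffAt_iterate_pd (a := ((0 : ℝ), (1 : ℝ))) hτ k)
  set m : ℕ → ℝ × ℝ → ℝ := fun k => (pd (0, 1))^[k] (Dt u)
  set s : ℕ → ℝ × ℝ → ℝ := fun k => (pd (0, 1))^[k] (along V 0 u)
  have hm1 : ∀ k, pd (0, 1) (m k) = m (k + 1) := fun k => (Function.iterate_succ_apply' _ k _).symm
  have hs1 : ∀ k, pd (0, 1) (s k) = s (k + 1) := fun k => (Function.iterate_succ_apply' _ k _).symm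
  have hms : ∀ k l, ∀ᶠ r in 𝓝 q, pd (0, 1) (fun r => m k r * s l r) r
      = m (k + 1) r * s l r + m k r * s (l + 1) r := fun k l => by
    filter_upwards [hm k, hs l] with r h1 h2
    rw [pd_mul h1 h2, hm1, hs1]
  have hmsd : ∀ k l, ∀ᶠ r in 𝓝 q, DifferentiableAt ℝ (fun r => m k r * s l r) r := fun k l => by
    filter_upwards [hm k, hs l] with r h1 h2 using h1.fun_mul h2
  -- The mixed part of order k is D_x^k(τ u_t) − τ ∂_x^k u_t, the Leibniz sum without the term in
  -- which τ is not differentiated. With `m` for the derivatives of u_t and `s` for those of τ, this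
  -- explains the coefficients 4, 6, 4, 1 in `f4`.
  have f1 : ∀ r, etaMixed V u 1 r = m 0 r * s 1 r := fun r => by
    simp only [etaMixed, Dx_eq_pd, pd_const, zero_add]
    rfl
  have f2 : ∀ᶠ r in 𝓝 q, etaMixed V u 2 r = m 1 r * s 1 r + m 0 r * s 2 r + m 1 r * s 1 r := by
    filter_upwards [hms 0 1] with r h1
    have : etaMixed V u 2 r = pd (0, 1) (etaMixed V u 1) r + m 1 r * s 1 r := rfl
    rw [this, funext f1, h1]
  have f3 : ∀ᶠ r in 𝓝 q, etaMixed V u 3 r = 2 * (m 2 r * s 1 r + m 1 r * s 2 r)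
      + (m 1 r * s 2 r + m 0 r * s 3 r) + m 2 r * s 1 r := by
    filter_upwards [hms 1 1, hms 0 2, hmsd 1 1, hmsd 0 2, pd_congr (a := ((0 : ℝ), (1 : ℝ))) f2]
      with r h1 h2 h3 h4 h5
    have : etaMixed V u 3 r = pd (0, 1) (etaMixed V u 2) r + m 2 r * s 1 r := rfl
    rw [this, h5, pd_add (h3.fun_add h4) h3, pd_add h3 h4, h1, h2]
    ring
  have f4 : etaMixed V u 4 q = 4 * m 3 q * s 1 q + 6 * m 2 q * s 2 q + 4 * m 1 q * s 3 q
      + m 0 q * s 4 q := by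
    have e : etaMixed V u 3 =ᶠ[𝓝 q] fun r => (m 2 r * s 1 r + m 2 r * s 1 r + m 2 r * s 1 r)
        + (m 1 r * s 2 r + m 1 r * s 2 r + m 1 r * s 2 r) + m 0 r * s 3 r :=
      f3.mono fun r hr => by rw [hr]; ring
    have : etaMixed V u 4 q = pd (0, 1) (etaMixed V u 3) q + m 3 q * s 1 q := rfl
    have d1 := (hmsd 2 1).self_of_nhds
    have d2 := (hmsd 1 2).self_of_nhds
    have d3 := (hmsd 0 3).self_of_nhds
    rw [this, (pd_congr (a := ((0 : ℝ), (1 : ℝ))) e).self_of_nhds,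
      pd_add (((d1.fun_add d1).fun_add d1).fun_add ((d2.fun_add d2).fun_add d2)) d3,
      pd_add ((d1.fun_add d1).fun_add d1) ((d2.fun_add d2).fun_add d2), pd_add (d1.fun_add d1) d1, pd_add d1 d1,
      pd_add (d2.fun_add d2) d2, pd_add d2 d2, (hms 2 1).self_of_nhds, (hms 1 2).self_of_nhds,
      (hms 0 3).self_of_nhds]
    ring
  have z0 : m 0 q = 0 := h0 0 (by omega)
  have z1 : m 1 q = 0 := h0 1 (by omega)
  have z2 : m 2 q = 0 := h0 2 (by omega)
  refine ⟨by rw [f1, z0, zero_mul], ?_, ?_, ?_⟩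
  · rw [f2.self_of_nhds, z0, z1]; ring
  · rw [f3.self_of_nhds, z0, z1, z2]; ring
  · rw [f4, z0, z1, z2]
    have : s 1 q = pd (0, 1) (along V 0 u) q := rfl
    rw [← this]
    change _ = 4 * m 3 q * s 1 q
    ring

end Field

/-- The components of the prolonged field at a jet, when `D_x τ = 0`. -/
def prolJet (V : Base → Base) (z : Jet3) : Jet3 :=
  ![compJet V 0 z, compJet V 1 z, compJet V 2 z, etaJet V 1 z, etaJet V 2 z, etaJet V 3 z]

/-- There are smooth functions with a prescribed jet. -/
theorem exists_jet (z : Jet3) (a : ℝ) (m : ℕ → ℝ) :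
    ∃ u : ℝ × ℝ → ℝ, ContDiff ℝ ∞ u ∧ jet3 u (z 0, z 1) = z ∧ Dx^[4] u (z 0, z 1) = a ∧
      ∀ k < 4, Dx^[k] (Dt u) (z 0, z 1) = m k := by
  obtain ⟨u, hu, h1, h2⟩ := exists_testFun (z 0, z 1) 5
    (fun k => if k = 0 then z 2 else if k = 1 then z 3 else if k = 2 then z 4 else
      if k = 3 then z 5 else a) m
  refine ⟨u, hu, ?_, ?_, fun k hk => h2 k (by omega)⟩
  · funext i
    fin_cases i
    · rfl
    · rfl
    · exact h1 0 (by omega)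
    · exact h1 1 (by omega)
    · exact h1 2 (by omega)
    · exact h1 3 (by omega)
  · exact h1 4 (by omega)

theorem etaT_eq {V : Base → Base} {D : Set Base} (hD : IsOpen D) (hV : ContDiffOn ℝ ∞ V D)
    {u : ℝ × ℝ → ℝ} {q : ℝ × ℝ} (hu : ContDiffAt ℝ ∞ u q) (hq : graphPt u q ∈ D) :
    etaT V u q = fderiv ℝ (fun p => V p 2) (graphPt u q) ![1, 0, Dt u q]
      - Dt u q * fderiv ℝ (fun p => V p 0) (graphPt u q) ![1, 0, Dt u q]
      - Dx u q * fderiv ℝ (fun p => V p 1) (graphPt u q) ![1, 0, Dt u q] := by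
  rw [etaT, Dt_along hD hV 2 hu hq, Dt_along hD hV 1 hu hq, Dt_along hD hV 0 hu hq]

theorem prol3_eq {V : Base → Base} {D : Set Base} (hD : IsOpen D) (hV : ContDiffOn ℝ ∞ V D)
    {u : ℝ × ℝ → ℝ} {q : ℝ × ℝ} (hu : ContDiffAt ℝ ∞ u q) (hq : graphPt u q ∈ D)
    (h1 : etaMixed V u 1 q = 0) (h2 : etaMixed V u 2 q = 0) (h3 : etaMixed V u 3 q = 0) :
    prol3 V u q = prolJet V (jet3 u q) := by
  have e : ∀ k, k ≤ 3 → etaX V u k q = etaJet V k (jet3 u q) - etaMixed V u k q :=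
    fun k hk => (etaX_eventuallyEq hD hV hu hq hk).2.self_of_nhds
  have e0 : etaX V u 0 q = compJet V 2 (jet3 u q) := rfl
  have e1 : etaX V u 1 q = etaJet V 1 (jet3 u q) := by rw [e 1 (by omega), h1, sub_zero]
  have e2 : etaX V u 2 q = etaJet V 2 (jet3 u q) := by rw [e 2 (by omega), h2, sub_zero]
  have e3 : etaX V u 3 q = etaJet V 3 (jet3 u q) := by rw [e 3 (by omega), h3, sub_zero]
  simp only [prol3, prolJet, e0, e1, e2, e3]
  rfl

/-- The equation holds at one point only, so it does not restrict u_txxx. Lie's criterion is affine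
in that quantity with slope 4 F D_x τ, and F ≠ 0. -/
theorem totD_time_eq_zero {E : EvolEq} {V : Base → Base} {D : Set Base} (hD : IsOpen D)
    (hV : ContDiffOn ℝ ∞ V D) (hadm : E.Admits V D) {z : Jet3} (hz : z ∈ E.dom)
    (hzD : z.base ∈ D) : totD (compJet V 0) z = 0 := by
  have hF := E.F_ne_zero z hz
  have key : ∀ b : ℝ, fderiv ℝ (fun p => V p 2) z.base ![1, 0, 0]
        - z 3 * fderiv ℝ (fun p => V p 1) z.base ![1, 0, 0]
        - fderiv ℝ E.F z (prolJet V z) * (-E.G z / E.F z)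
        - (totD (etaJet V 3) z + (-E.G z / E.F z) *
          (pd (Pi.single 5 1) (etaJet V 3) z - totD (compJet V 1) z)
            - 4 * b * totD (compJet V 0) z) * E.F z
        - fderiv ℝ E.G z (prolJet V z) = 0 := by
    intro b
    -- The value −G/F of u_xxxx makes the equation hold with u_t = 0. With u_tx = u_txx = 0 as well,
    -- `b` = u_txxx is the only mixed derivative left.
    obtain ⟨u, hu, hj, h4, hm⟩ := exists_jet z (-E.G z / E.F z) (fun k => if k = 3 then b else 0)
    set q : ℝ × ℝ := (z 0, z 1)
    have hub : graphPt u q = z.base := by rw [← base_jet3, hj]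
    have hq : graphPt u q ∈ D := hub ▸ hzD
    have huq : ContDiffAt ℝ ∞ u q := hu.contDiffAt
    have hm0 : Dt u q = 0 := hm 0 (by omega)
    have hx : Dx u q = z 3 := by rw [← hj]; rfl
    obtain ⟨m1, m2, m3, m4⟩ := etaMixed_eq hD hV huq hq fun k hk => by
      rw [hm k (by omega), if_neg (by omega)]
    have hL := hadm u q huq hq (hj.symm ▸ hz) (by
      rw [EvolEq.HoldsAt, hj, h4, hm0]; field_simp; ring)
    rw [etaT_eq hD hV huq hq, etaX_four hD hV huq hq, prol3_eq hD hV huq hq m1 m2 m3, h4, m4,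
      hm 3 (by omega), hm0, hx, hub, if_pos rfl, hj] at hL
    linear_combination hL
  have h1 := key 1
  have h0 := key 0
  have : 4 * totD (compJet V 0) z * E.F z = 0 := by linarith
  simpa [hF] using this

/-- For an admitted field, `τ` is locally a function of `t` at the points over which the equation
is defined. -/
theorem fderiv_time_eq_zero {E : EvolEq} {V : Base → Base} {D : Set Base} (hD : IsOpen D)
    (hV : ContDiffOn ℝ ∞ V D) (hadm : E.Admits V D) {p : Base} (hp : p ∈ D)
    (hpE : p ∈ Jet3.base '' E.dom) :
    fderiv ℝ (fun p => V p 0) p (Pi.single 1 1) = 0 ∧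
      fderiv ℝ (fun p => V p 0) p (Pi.single 2 1) = 0 := by
  obtain ⟨z, hz, rfl⟩ := hpE
  -- D_x τ = τ_x + u_x τ_u is affine in u_x. It vanishes at two values of u_x over the same base
  -- point, since the domain is open.
  have hc : ContinuousAt (fun s : ℝ => Function.update z 3 s) (z 3) := by fun_prop
  have hev : ∀ᶠ s in 𝓝 (z 3), Function.update z 3 s ∈ E.dom :=
    hc.eventually (E.isOpen_dom.mem_nhds (by
      change Function.update z 3 (z 3) ∈ E.dom
      rwa [Function.update_eq_self]))
  obtain ⟨s, hs, hne⟩ :=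
    ((hev.filter_mono nhdsWithin_le_nhds).and self_mem_nhdsWithin : ∀ᶠ s in 𝓝[≠] (z 3), _).exists
  have hb : Jet3.base (Function.update z 3 s) = z.base := by
    funext i; fin_cases i <;> simp [Jet3.base, Function.update]
  have h1 := totD_time_eq_zero hD hV hadm hz hp
  have h2 := totD_time_eq_zero hD hV hadm hs (hb ▸ hp)
  rw [totD_compJet hD hV 0 hp] at h1
  rw [totD_compJet hD hV 0 (hb ▸ hp), hb] at h2
  simp only [Function.update_self] at h2
  have h3 : (s - z 3) * fderiv ℝ (fun p => V p 0) z.base (Pi.single 2 1) = 0 := by linarith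
  rcases mul_eq_zero.1 h3 with h | h
  · exact absurd (sub_eq_zero.1 h) hne
  · exact ⟨by simpa [h] using h1, h⟩

section Determining

variable {V : Base → Base} {D : Set Base} (hD : IsOpen D) (hV : ContDiffOn ℝ ∞ V D)
include hD hV

/-- Following the highest derivative through the recursion, each of the three steps contributes −D_x
ξ. Only the first step also sees that D_x ξ itself depends on u_x, which gives the term with ξ_u. -/
theorem pd_etaJet_three {z : Jet3} (hz : z.base ∈ D) :
    pd (Pi.single 5 1) (etaJet V 3) z = fderiv ℝ (fun p => V p 2) z.base (Pi.single 2 1)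
      - z 3 * fderiv ℝ (fun p => V p 1) z.base (Pi.single 2 1)
      - 3 * totD (compJet V 1) z := by
  have hS := hD.preimage continuous_base
  have hξ := (hasOrder_compJet hD hV 1).totD hS (by omega)
  have hc : ∀ i : Fin 6, HasFDerivAt (fun z : Jet3 => z i)
      (ContinuousLinearMap.proj i : Jet3 →L[ℝ] ℝ) z :=
    fun i => (ContinuousLinearMap.proj i : Jet3 →L[ℝ] ℝ).hasFDerivAt
  have step : ∀ k ≤ 2, ∀ j : Fin 6, j.val = k + 3 →
      pd (Pi.single j 1) (etaJet V (k + 1)) z = pd (Pi.single (j - 1) 1) (etaJet V k) z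
        - (totD (compJet V 1) z + z j * pd (Pi.single j 1) (totD (compJet V 1)) z) := by
    intro k hk j hj
    have ho := hasOrder_etaJet hD hV (k := k) (by omega)
    have hd := (ho.totD hS hk).differentiableAt hS hz
    have hdξ := hξ.differentiableAt hS hz
    have hj' : (Fin.ofNat 6 (k + 3)) = j := by
      apply Fin.ext; rw [Fin.val_ofNat, Nat.mod_eq_of_lt (by omega), hj]
    have : etaJet V (k + 1) = fun z => totD (etaJet V k) z - z j * totD (compJet V 1) z := by
      rw [← hj']; rfl
    rw [this, pd_sub hd ((hc j).differentiableAt.fun_mul hdξ), pd_mul (hc j).differentiableAt hdξ,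
      ho.pd_totD_top hS hz hj]
    congr 2
    rw [pd, (hc j).fderiv]
    simp
  rw [step 2 le_rfl 5 rfl, show (5 : Fin 6) - 1 = 4 from rfl, step 1 (by omega) 4 rfl,
    show (4 : Fin 6) - 1 = 3 from rfl, step 0 (by omega) 3 rfl, hξ.2 z hz 5 (by decide),
    hξ.2 z hz 4 (by decide), pd_totD_compJet hD hV 1 hz]
  have : pd (Pi.single (3 - 1) 1) (etaJet V 0) z
      = fderiv ℝ (fun p => V p 2) z.base (Pi.single 2 1) := by
    rw [pd]
    change fderiv ℝ (compJet V 2) z _ = _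
    rw [fderiv_compJet hD hV 2 hz]
    congr 1
    funext j
    fin_cases j <;> simp [Jet3.base, Pi.single, Function.update]
  rw [this]
  ring

/-- Lie's determining equations, for a field with `τ` depending on `t` only. -/
theorem determining_equations {E : EvolEq} (hadm : E.Admits V D)
    (hτ : ∀ p ∈ D, fderiv ℝ (fun p => V p 0) p (Pi.single 1 1) = 0 ∧
      fderiv ℝ (fun p => V p 0) p (Pi.single 2 1) = 0)
    {z : Jet3} (hz : z ∈ E.dom) (hzD : z.base ∈ D) :
    fderiv ℝ E.F z (prolJet V z) = E.F z *
        (4 * totD (compJet V 1) z - fderiv ℝ (fun p => V p 0) z.base (Pi.single 0 1)) ∧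
      fderiv ℝ (fun p => V p 2) z.base (Pi.single 0 1)
          - z 3 * fderiv ℝ (fun p => V p 1) z.base (Pi.single 0 1)
          + (fderiv ℝ (fun p => V p 2) z.base (Pi.single 2 1)
            - fderiv ℝ (fun p => V p 0) z.base (Pi.single 0 1)
            - z 3 * fderiv ℝ (fun p => V p 1) z.base (Pi.single 2 1)) * E.G z
          - totD (etaJet V 3) z * E.F z - fderiv ℝ E.G z (prolJet V z) = 0 := by
  have hS := hD.preimage continuous_base
  have hvec : ∀ (i : Fin 3) (m : ℝ), fderiv ℝ (fun p => V p i) z.base ![1, 0, m]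
      = fderiv ℝ (fun p => V p i) z.base (Pi.single 0 1)
        + m * fderiv ℝ (fun p => V p i) z.base (Pi.single 2 1) := fun i m => by
    rw [← smul_eq_mul, ← map_smul, ← map_add]
    congr 1
    funext j
    fin_cases j <;> simp
  have key : ∀ a : ℝ, fderiv ℝ (fun p => V p 2) z.base (Pi.single 0 1)
      + (E.F z * a + E.G z) * fderiv ℝ (fun p => V p 2) z.base (Pi.single 2 1)
      - (E.F z * a + E.G z) * fderiv ℝ (fun p => V p 0) z.base (Pi.single 0 1)
      - z 3 * (fderiv ℝ (fun p => V p 1) z.base (Pi.single 0 1)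
        + (E.F z * a + E.G z) * fderiv ℝ (fun p => V p 1) z.base (Pi.single 2 1))
      - fderiv ℝ E.F z (prolJet V z) * a
      - (totD (etaJet V 3) z + a * (pd (Pi.single 5 1) (etaJet V 3) z
          - totD (compJet V 1) z)) * E.F z
      - fderiv ℝ E.G z (prolJet V z) = 0 := by
    intro a
    -- Only the value of u_t matters here. The other mixed derivatives may be anything, because D_x
    -- τ = 0 removes them from the criterion.
    obtain ⟨u, hu, hj, h4, hm⟩ := exists_jet z a (fun _ => E.F z * a + E.G z)
    set q : ℝ × ℝ := (z 0, z 1)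
    have hub : graphPt u q = z.base := by rw [← base_jet3, hj]
    have hq : graphPt u q ∈ D := hub ▸ hzD
    have huq : ContDiffAt ℝ ∞ u q := hu.contDiffAt
    have hm0 : Dt u q = E.F z * a + E.G z := hm 0 (by omega)
    have hx : Dx u q = z 3 := by rw [← hj]; rfl
    have hτ0 : Dx (along V 0 u) =ᶠ[𝓝 q] fun _ => 0 := by
      filter_upwards [Dx_comp_jet3_of_le huq hS (by omega) (hasOrder_compJet hD hV 0) hq,
        (contDiffAt_graphPt huq).continuousAt.eventually (hD.mem_nhds hq)] with r h1 h2
      refine h1.trans ?_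
      have h2' : (jet3 u r).base ∈ D := h2
      rw [totD_compJet hD hV 0 h2', (hτ _ h2').1, (hτ _ h2').2]
      ring
    have hmix : ∀ k, etaMixed V u k =ᶠ[𝓝 q] fun _ => 0 := by
      intro k
      induction k with
      | zero => rfl
      | succ k ih =>
        filter_upwards [pd_congr (a := ((0 : ℝ), (1 : ℝ))) ih, hτ0] with r h1 h2
        simp only [etaMixed]
        rw [Dx_eq_pd] at *
        rw [h1, h2, pd_const, mul_zero, add_zero]
    have hL := hadm u q huq hq (hj.symm ▸ hz) (by rw [EvolEq.HoldsAt, hj, h4, hm0])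
    rw [etaT_eq hD hV huq hq, etaX_four hD hV huq hq, prol3_eq hD hV huq hq
      (hmix 1).self_of_nhds (hmix 2).self_of_nhds (hmix 3).self_of_nhds, hj, h4,
      (hmix 4).self_of_nhds, hm0, hx, hub, hvec, hvec, hvec, (hτ _ hzD).2] at hL
    simp only [] at hL
    linarith
  -- The identity is affine in u_xxxx: the difference of its values at 0 and 1 is the equation for
  -- F, and its value at 0 is the equation for G.
  have k0 := key 0
  have k1 := key 1
  rw [pd_etaJet_three hD hV hzD] at k0 k1
  exact ⟨by linear_combination k0 - k1, by linear_combination k0⟩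

end Determining

end

/-! ### Translations in `t` and in `x` -/

/-- The left hand side of Lie's criterion. -/
def lieExpr (E : EvolEq) (V : Base → Base) (u : ℝ × ℝ → ℝ) (q : ℝ × ℝ) : ℝ :=
  etaT V u q - fderiv ℝ E.F (jet3 u q) (prol3 V u q) * Dx^[4] u q
    - etaX V u 4 q * E.F (jet3 u q) - fderiv ℝ E.G (jet3 u q) (prol3 V u q)

theorem fieldT_eq : fieldT = fun _ => Pi.single 0 1 := by
  funext p i; fin_cases i <;> simp [fieldT]

theorem fieldX_eq : fieldX = fun _ => Pi.single 1 1 := by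
  funext p i; fin_cases i <;> simp [fieldX]

/-- All total derivatives of constant components vanish, so a translation in t or x is its own
prolongation. This also shows that Lie's criterion for it is a condition on partial derivatives of F
and G. -/
theorem lieExpr_translation (E : EvolEq) {i : Fin 3} (hi : i ≠ 2) (u : ℝ × ℝ → ℝ) (q : ℝ × ℝ) :
    lieExpr E (fun _ => Pi.single i 1) u q
      = -(fderiv ℝ E.F (jet3 u q) (Pi.single (i.castLE (by omega)) 1) * Dx^[4] u q
        + fderiv ℝ E.G (jet3 u q) (Pi.single (i.castLE (by omega)) 1)) := by
  have hal : ∀ j, along (fun _ => Pi.single i 1) j u = fun _ => (Pi.single i 1 : Base) j :=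
    fun j => rfl
  have hX : ∀ k, etaX (fun _ => Pi.single i 1) u k = fun _ => 0 := by
    intro k
    induction k with
    | zero => rw [etaX, hal]; simp [hi.symm]
    | succ k ih => funext r; simp [etaX, ih, hal, Dx_eq_pd, pd_const]
  have hT : etaT (fun _ => Pi.single i 1) u q = 0 := by
    simp [etaT, hal, Dt_eq_pd, Dx_eq_pd, pd_const]
  have hp : prol3 (fun _ => Pi.single i 1) u q = Pi.single (i.castLE (by omega)) 1 := by
    unfold prol3
    simp only [hX, hal]
    funext j
    fin_cases i <;> first | exact absurd rfl hi | (fin_cases j <;> simp)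
  rw [lieExpr, hp, hT, hX]
  ring

namespace EvolEq

theorem IndepOf.fderiv_eq_zero {E : EvolEq} {i : Fin 6} (h : E.IndepOf i) {z : Jet3}
    (hz : z ∈ E.dom) :
    fderiv ℝ E.F z (Pi.single i 1) = 0 ∧ fderiv ℝ E.G z (Pi.single i 1) = 0 := by
  have h1 : HasDerivAt (fun s : ℝ => Function.update z i s) (Pi.single i 1) (z i) :=
    hasDerivAt_update z i (z i)
  have hev : ∀ᶠ s in 𝓝 (z i), Function.update z i s ∈ E.dom :=
    h1.continuousAt.eventually (E.isOpen_dom.mem_nhds (by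
      change Function.update z i (z i) ∈ E.dom
      rwa [Function.update_eq_self]))
  have main : ∀ A : Jet3 → ℝ, ContDiffOn ℝ ∞ A E.dom →
      (∀ s, Function.update z i s ∈ E.dom → A (Function.update z i s) = A z) →
      fderiv ℝ A z (Pi.single i 1) = 0 := by
    intro A hA hAz
    have hd : HasFDerivAt A (fderiv ℝ A z) (Function.update z i (z i)) := by
      rw [Function.update_eq_self]
      exact ((hA.contDiffAt (E.isOpen_dom.mem_nhds hz)).differentiableAt (by simp)).hasFDerivAt
    have h2 := hd.comp_hasDerivAt (z i) h1
    have h3 : (A ∘ fun s : ℝ => Function.update z i s) =ᶠ[𝓝 (z i)] fun _ => A z :=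
      hev.mono hAz
    exact h2.unique ((hasDerivAt_const _ _).congr_of_eventuallyEq h3)
  have hne : ∀ s, ∀ j, j ≠ i → Function.update z i s j = z j := fun s j hj =>
    Function.update_of_ne hj _ _
  exact ⟨main E.F E.smooth_F fun s hs => (h _ hs _ hz (hne s)).1,
    main E.G E.smooth_G fun s hs => (h _ hs _ hz (hne s)).2⟩

/-- A vanishing partial derivative gives constancy only along segments inside the domain, which is
what convexity of the lines provides. -/
theorem indepOf_of_fderiv_eq_zero {E : EvolEq} {i : Fin 6} (hc : E.LineConvex i)
    (h : ∀ z ∈ E.dom, fderiv ℝ E.F z (Pi.single i 1) = 0 ∧ fderiv ℝ E.G z (Pi.single i 1) = 0) :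
    E.IndepOf i := by
  intro z hz z' hz' hzz
  have hseg : ∀ s ∈ Set.Icc (0 : ℝ) 1, z + s • (z' - z) ∈ E.dom := fun s hs =>
    hc z hz z' hz' hzz (segment_eq_image' ℝ z z' ▸ ⟨s, hs, rfl⟩)
  have hdir : z' - z = (z' i - z i) • Pi.single i 1 := by
    funext j
    by_cases hj : j = i
    · subst hj; simp
    · simp [hj, hzz j hj]
  have main : ∀ A : Jet3 → ℝ, ContDiffOn ℝ ∞ A E.dom →
      (∀ z ∈ E.dom, fderiv ℝ A z (Pi.single i 1) = 0) → A z = A z' := by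
    intro A hA hA0
    have hd : ∀ s ∈ Set.Icc (0 : ℝ) 1, HasDerivAt (fun s : ℝ => A (z + s • (z' - z))) 0 s := by
      intro s hs
      have h1 : HasDerivAt (fun s : ℝ => z + s • (z' - z)) (z' - z) s := by
        simpa using ((hasDerivAt_id s).smul_const (z' - z)).const_add z
      have h2 := ((hA.contDiffAt (E.isOpen_dom.mem_nhds (hseg s hs))).differentiableAt
        (by simp)).hasFDerivAt.comp_hasDerivAt s h1
      have h3 : fderiv ℝ A (z + s • (z' - z)) (z' - z) = 0 := by
        rw [hdir, map_smul, ← hdir, hA0 _ (hseg s hs), smul_zero]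
      rwa [h3] at h2
    have := constant_of_has_deriv_right_zero
      (fun s hs => (hd s hs).continuousAt.continuousWithinAt)
      (fun s hs => (hd s ⟨hs.1, hs.2.le⟩).hasDerivWithinAt) 1 (by simp)
    simpa using this.symm
  exact ⟨main E.F E.smooth_F fun z hz => (h z hz).1, main E.G E.smooth_G fun z hz => (h z hz).2⟩

theorem IndepOf.admits {E : EvolEq} {i : Fin 3} (hi : i ≠ 2)
    (h : E.IndepOf (i.castLE (by omega))) (D : Set Base) :
    E.Admits (fun _ => Pi.single i 1) D := by
  intro u q _ _ hj _
  have := lieExpr_translation E hi u q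
  rw [(h.fderiv_eq_zero hj).1, (h.fderiv_eq_zero hj).2] at this
  simpa [lieExpr] using this

/-- With u_t adjusted to the equation, u_xxxx is free, and the criterion is affine in it. The
derivatives of F and of G therefore vanish separately. -/
theorem fderiv_eq_zero_of_admits {E : EvolEq} {i : Fin 3} (hi : i ≠ 2)
    (h : E.Admits (fun _ => Pi.single i 1) Set.univ) {z : Jet3} (hz : z ∈ E.dom) :
    fderiv ℝ E.F z (Pi.single (i.castLE (by omega)) 1) = 0 ∧
      fderiv ℝ E.G z (Pi.single (i.castLE (by omega)) 1) = 0 := by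
  have key : ∀ a : ℝ, fderiv ℝ E.F z (Pi.single (i.castLE (by omega)) 1) * a
      + fderiv ℝ E.G z (Pi.single (i.castLE (by omega)) 1) = 0 := fun a => by
    obtain ⟨u, hu, hj, h4, hm⟩ := exists_jet z a (fun _ => E.F z * a + E.G z)
    have hL := h u (z 0, z 1) hu.contDiffAt trivial (hj.symm ▸ hz)
      (by rw [HoldsAt, hj, h4]; exact hm 0 (by omega))
    have := lieExpr_translation E hi u (z 0, z 1)
    rw [lieExpr, hL, hj, h4] at this
    linarith
  have h0 := key 0
  have h1 := key 1
  constructor <;> linarith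

end EvolEq

/-! ### Generic coefficients -/

/-- Since Φ + εΨ = Ψ(Ψ⁻¹Φ + ε), a bad ε is the negative of an eigenvalue of Ψ⁻¹Φ. -/
theorem finite_setOf_not_injective_add_smul {n : ℕ} (Φ Ψ : Matrix (Fin n) (Fin n) ℝ)
    (hΨ : ∀ c, Ψ.mulVec c = 0 → c = 0) :
    {ε : ℝ | ¬ ∀ c, (Φ + ε • Ψ).mulVec c = 0 → c = 0}.Finite := by
  have hinj : Function.Injective Ψ.mulVecLin :=
    (injective_iff_map_eq_zero _).2 fun c hc => hΨ c hc
  set e := LinearEquiv.ofInjectiveEndo Ψ.mulVecLin hinj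
  set f : Module.End ℝ (Fin n → ℝ) := (e.symm : (Fin n → ℝ) →ₗ[ℝ] Fin n → ℝ) ∘ₗ Φ.mulVecLin
  refine ((Module.End.finite_hasEigenvalue f).preimage (f := fun ε : ℝ => -ε)
    neg_injective.injOn).subset fun ε hε => ?_
  simp only [Set.mem_ofPred_eq, not_forall] at hε
  obtain ⟨c, hc, hc0⟩ := hε
  refine Module.End.hasEigenvalue_of_hasEigenvector (x := c)
    ⟨Module.End.mem_eigenspace_iff.2 ?_, hc0⟩
  have h1 : Φ.mulVecLin c = -ε • e c := by
    have : Φ.mulVec c + ε • Ψ.mulVec c = 0 := by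
      rwa [Matrix.add_mulVec, Matrix.smul_mulVec] at hc
    rw [Matrix.mulVecLin_apply, neg_smul]
    exact eq_neg_of_add_eq_zero_left this
  change e.symm (Φ.mulVecLin c) = _
  rw [h1, map_smul, e.symm_apply_apply]

/-- The coefficients of the linear equation for `4 D_x ξ - τ_t`, the `j`-th component of a field,
`η`, `η^x`, `η^xx` and the two coefficients of `η^xxx` with respect to `u_xxx`. -/
def fieldRow (A : Jet3 → ℝ) (j : Fin 6) (z : Jet3) : Fin 7 → ℝ :=
  ![-A z, fderiv ℝ A z (Pi.single j 1), fderiv ℝ A z (Pi.single 2 1), fderiv ℝ A z (Pi.single 3 1),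
    fderiv ℝ A z (Pi.single 4 1), fderiv ℝ A z (Pi.single 5 1),
    z 5 * fderiv ℝ A z (Pi.single 5 1)]

/-- `s² + z_j s³ + u s⁴ + u_x s⁵ + u_xx s⁶` with `s = u_xxx`. -/
def perturbExp (j : Fin 6) (z : Jet3) : ℝ :=
  z 5 ^ 2 + z j * z 5 ^ 3 + z 2 * z 5 ^ 4 + z 3 * z 5 ^ 5 + z 4 * z 5 ^ 6

/-- The perturbation of `F`. -/
def perturb (j : Fin 6) (z : Jet3) : ℝ := Real.exp (perturbExp j z)

theorem contDiff_perturb (j : Fin 6) : ContDiff ℝ ∞ (perturb j) := by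
  unfold perturb perturbExp
  fun_prop

theorem fderiv_perturb (j : Fin 6) (z v : Jet3) :
    fderiv ℝ (perturb j) z v = perturb j z * (2 * z 5 * v 5 + (v j * z 5 ^ 3
      + z j * (3 * z 5 ^ 2 * v 5)) + (v 2 * z 5 ^ 4 + z 2 * (4 * z 5 ^ 3 * v 5))
      + (v 3 * z 5 ^ 5 + z 3 * (5 * z 5 ^ 4 * v 5))
      + (v 4 * z 5 ^ 6 + z 4 * (6 * z 5 ^ 5 * v 5))) := by
  have hc : ∀ i : Fin 6, HasFDerivAt (fun z : Jet3 => z i)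
      (ContinuousLinearMap.proj i : Jet3 →L[ℝ] ℝ) z :=
    fun i => (ContinuousLinearMap.proj i : Jet3 →L[ℝ] ℝ).hasFDerivAt
  have h : HasFDerivAt (perturbExp j) _ z := (((((hc 5).pow 2).add ((hc j).mul ((hc 5).pow 3))).add
    ((hc 2).mul ((hc 5).pow 4))).add ((hc 3).mul ((hc 5).pow 5))).add ((hc 4).mul ((hc 5).pow 6))
  have h' : HasFDerivAt (perturb j) _ z := h.exp
  rw [h'.fderiv]
  simp [perturb]
  ring

/-- After division by the exponential, each equation says that a polynomial of degree at most 6 in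
u_xxx vanishes at one sample value. Seven distinct values kill all its coefficients by the
Vandermonde determinant. -/
theorem fieldRow_perturb_injective {j : Fin 6} (hj : j < 2) (z : Jet3) {s : Fin 7 → ℝ}
    (hs : Function.Injective s) (c : Fin 7 → ℝ)
    (hc : ∀ k, fieldRow (perturb j) j (Function.update z 5 (s k)) ⬝ᵥ c = 0) : c = 0 := by
  have hj5 : j ≠ 5 := fun h => by subst h; exact absurd hj (by decide)
  -- The coefficients of that polynomial, by increasing power of u_xxx.
  set d : Fin 7 → ℝ := ![-c 0, 2 * c 5, 2 * c 6 + 3 * z j * c 5,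
    c 1 + 3 * z j * c 6 + 4 * z 2 * c 5, c 2 + 4 * z 2 * c 6 + 5 * z 3 * c 5,
    c 3 + 5 * z 3 * c 6 + 6 * z 4 * c 5, c 4 + 6 * z 4 * c 6] with hd
  have hd0 : d = 0 := by
    refine Matrix.eq_zero_of_forall_index_sum_pow_mul_eq_zero hs fun k => ?_
    have h := hc k
    have hp : perturb j (Function.update z 5 (s k)) ≠ 0 := (Real.exp_pos _).ne'
    have hj' : j = 0 ∨ j = 1 := by
      have := Fin.lt_def.1 hj
      rcases j with ⟨_ | _ | j, _⟩
      · exact Or.inl rfl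
      · exact Or.inr rfl
      · simp at this
    have h' : perturb j (Function.update z 5 (s k)) * ∑ i : Fin 7, s k ^ (i : ℕ) * d i = 0 := by
      rw [← h]
      simp only [dotProduct, Fin.sum_univ_succ, fieldRow, fderiv_perturb, hd]
      rcases hj' with rfl | rfl <;> simp [Function.update] <;> ring
    exact (mul_eq_zero.1 h').resolve_left hp
  -- The coefficients are triangular in the unknowns in the order 0, 5, 6, 1, 2, 3, 4. The square
  -- term of the exponent is what isolates the unknowns 5 and 6.
  have hdi : ∀ i, d i = 0 := fun i => congrFun hd0 i
  have c0 : c 0 = 0 := by simpa [hd] using hdi 0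
  have c5 : c 5 = 0 := by simpa [hd] using hdi 1
  have c6 : c 6 = 0 := by simpa [hd, c5] using hdi 2
  have c1 : c 1 = 0 := by simpa [hd, c5, c6] using hdi 3
  have c2 : c 2 = 0 := by simpa [hd, c5, c6] using hdi 4
  have c3 : c 3 = 0 := by simpa [hd, c5, c6] using hdi 5
  have c4 : c 4 = 0 := by simpa [hd, c5, c6] using hdi 6
  funext i
  fin_cases i <;> assumption

/-- A nonempty open set of jets contains jets that differ in `u_xxx` only. -/
theorem exists_injective_update_mem {O : Set Jet3} (hO : IsOpen O) {z : Jet3} (hz : z ∈ O) (n : ℕ)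
    (i : Fin 6) : ∃ s : Fin n → ℝ, Function.Injective s ∧ ∀ k, Function.update z i (s k) ∈ O := by
  have hc : ContinuousAt (fun s : ℝ => Function.update z i s) (z i) := by fun_prop
  have hev : (fun s : ℝ => Function.update z i s) ⁻¹' O ∈ 𝓝 (z i) :=
    hc.preimage_mem_nhds (hO.mem_nhds (by
      change Function.update z i (z i) ∈ O
      rwa [Function.update_eq_self]))
  have hinf := infinite_of_mem_nhds (z i) hev
  have := hinf.to_subtype
  let e := Infinite.natEmbedding ((fun s : ℝ => Function.update z i s) ⁻¹' O)
  exact ⟨fun k => e k, fun a b hab => Fin.ext (e.injective (Subtype.ext hab)), fun k => (e k).2⟩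

/-! ### The perturbed equations. -/

namespace EvolEq

theorem contDiffAt_F (E : EvolEq) {z : Jet3} (hz : z ∈ E.dom) : ContDiffAt ℝ ∞ E.F z :=
  E.smooth_F.contDiffAt (E.isOpen_dom.mem_nhds hz)

theorem contDiffAt_G (E : EvolEq) {z : Jet3} (hz : z ∈ E.dom) : ContDiffAt ℝ ∞ E.G z :=
  E.smooth_G.contDiffAt (E.isOpen_dom.mem_nhds hz)

/-- The equation with `F` replaced by `F ± |ε| g`, where `g` is the perturbation and the sign is
that of `F`. -/
def perturbed (E : EvolEq) (j : Fin 6) (ε : ℝ) : EvolEq where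
  dom := E.dom
  F := fun z => E.F z + |ε| * (E.F z / |E.F z| * perturb j z)
  G := E.G
  isOpen_dom := E.isOpen_dom
  smooth_F := E.smooth_F.add (contDiffOn_const.mul ((E.smooth_F.div
    (E.smooth_F.abs E.F_ne_zero) fun z hz => abs_ne_zero.2 (E.F_ne_zero z hz)).mul
      (contDiff_perturb j).contDiffOn))
  smooth_G := E.smooth_G
  F_ne_zero := fun z hz => by
    have h0 := E.F_ne_zero z hz
    have h1 : 0 < 1 + |ε| * (perturb j z / |E.F z|) := by
      have : 0 < perturb j z := Real.exp_pos _
      positivity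
    have h2 : E.F z + |ε| * (E.F z / |E.F z| * perturb j z)
        = E.F z * (1 + |ε| * (perturb j z / |E.F z|)) := by ring
    rw [h2]
    exact mul_ne_zero h0 h1.ne'

/-- The sign of F is locally constant, because F is continuous and does not vanish. Locally the
perturbation is thus a constant multiple of a fixed smooth function. -/
theorem perturbed_eventuallyEq (E : EvolEq) (j : Fin 6) (ε : ℝ) {z : Jet3} (hz : z ∈ E.dom) :
    (E.perturbed j ε).F =ᶠ[𝓝 z]
      fun y => E.F y + |ε| * (E.F z / |E.F z|) * perturb j y := by
  have hc : ContinuousAt (fun y => E.F y / E.F z) z :=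
    (E.contDiffAt_F hz).continuousAt.div_const _
  have h1 : ∀ᶠ y in 𝓝 z, 0 < E.F y / E.F z :=
    hc.eventually (lt_mem_nhds (by
      change 0 < E.F z / E.F z
      rw [div_self (E.F_ne_zero z hz)]; exact one_pos))
  filter_upwards [h1] with y hy
  have : E.F y / |E.F y| = E.F z / |E.F z| := by
    rcases (div_pos_iff.1 hy) with ⟨h, h'⟩ | ⟨h, h'⟩
    · rw [abs_of_pos h, abs_of_pos h', div_self h.ne', div_self h'.ne']
    · rw [abs_of_neg h, abs_of_neg h', div_neg, div_neg, div_self h.ne, div_self h'.ne]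
  simp only [perturbed, this]
  ring

/-- The row depends linearly on the coefficient and its first derivatives, and the sign of F is
locally constant. So the matrix of the sampled system is affine in |ε|. -/
theorem fieldRow_perturbed (E : EvolEq) (j : Fin 6) (ε : ℝ) {z : Jet3} (hz : z ∈ E.dom) :
    fieldRow (E.perturbed j ε).F j z
      = fieldRow E.F j z + |ε| • ((E.F z / |E.F z|) • fieldRow (perturb j) j z) := by
  have he := E.perturbed_eventuallyEq j ε hz
  have hF := (E.contDiffAt_F hz).differentiableAt (by simp)
  have hp : DifferentiableAt ℝ (perturb j) z := (contDiff_perturb j).differentiable (by simp) z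
  have hd : ∀ v, fderiv ℝ (E.perturbed j ε).F z v
      = fderiv ℝ E.F z v + |ε| * (E.F z / |E.F z| * fderiv ℝ (perturb j) z v) := fun v => by
    rw [he.fderiv_eq, fderiv_fun_add hF (hp.const_mul _), fderiv_const_mul hp]
    simp only [add_apply, smul_apply, smul_eq_mul]
    ring
  have hz' : (E.perturbed j ε).F z = E.F z + |ε| * (E.F z / |E.F z| * perturb j z) := rfl
  funext k
  fin_cases k <;> simp [fieldRow, hd, hz'] <;> ring

theorem IndepOf.perturbed {E : EvolEq} {i j : Fin 6} (hij : i ≠ j) (hi : i < 2)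
    (h : E.IndepOf i) (ε : ℝ) : (E.perturbed j ε).IndepOf i := by
  intro z hz z' hz' hzz
  obtain ⟨h1, h2⟩ := h z hz z' hz' hzz
  refine ⟨?_, h2⟩
  have hne : ∀ k : Fin 6, 2 ≤ k → k ≠ i := fun k hk hki => by
    subst hki; exact absurd hi (not_lt.2 hk)
  have : perturb j z = perturb j z' := by
    simp only [perturb, perturbExp, hzz j hij.symm, hzz 2 (hne 2 le_rfl),
      hzz 3 (hne 3 (by decide)), hzz 4 (hne 4 (by decide)), hzz 5 (hne 5 (by decide))]
  simp only [EvolEq.perturbed, h1, this]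

end EvolEq

/-- For all but countably many `ε`, the linear equations for the unknowns of the determining
equation of the perturbed equation have the zero solution only, at suitable jets in every nonempty
open set. -/
theorem exists_countable_forall_dense (E : EvolEq) {j : Fin 6} (hj : j < 2) :
    ∃ S : Set ℝ, S.Countable ∧ ∀ ε, 0 ≤ ε → ε ∉ S → ∀ O : Set Jet3, IsOpen O → O.Nonempty →
      O ⊆ E.dom → ∃ (z : Jet3) (s : Fin 7 → ℝ), z ∈ O ∧ (∀ k, Function.update z 5 (s k) ∈ O) ∧
        ∀ c : Fin 7 → ℝ,
          (∀ k, fieldRow (E.perturbed j ε).F j (Function.update z 5 (s k)) ⬝ᵥ c = 0) → c = 0 := by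
  -- The sample points are fixed for each open set before ε is considered. Each member of a
  -- countable basis then excludes finitely many ε only. The values in the other case are
  -- placeholders.
  have hpick : ∀ b : Set Jet3, ∃ (z : Jet3) (s : Fin 7 → ℝ), IsOpen b → b.Nonempty →
      z ∈ b ∧ Function.Injective s ∧ ∀ k, Function.update z 5 (s k) ∈ b := by
    intro b
    by_cases h : IsOpen b ∧ b.Nonempty
    · obtain ⟨z, hz⟩ := h.2
      obtain ⟨s, hs, hsb⟩ := exists_injective_update_mem h.1 hz 7 5
      exact ⟨z, s, fun _ _ => ⟨hz, hs, hsb⟩⟩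
    · exact ⟨0, 0, fun h1 h2 => absurd ⟨h1, h2⟩ h⟩
  choose z s hzs using hpick
  let Φ : Set Jet3 → Matrix (Fin 7) (Fin 7) ℝ := fun b k =>
    fieldRow E.F j (Function.update (z b) 5 (s b k))
  let Ψ : Set Jet3 → Matrix (Fin 7) (Fin 7) ℝ := fun b k =>
    (E.F (Function.update (z b) 5 (s b k)) / |E.F (Function.update (z b) 5 (s b k))|) •
      fieldRow (perturb j) j (Function.update (z b) 5 (s b k))
  let 𝓑 : Set (Set Jet3) := {b ∈ TopologicalSpace.countableBasis Jet3 | b ⊆ E.dom}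
  refine ⟨⋃ b ∈ 𝓑, {ε : ℝ | ¬ ∀ c, (Φ b + ε • Ψ b).mulVec c = 0 → c = 0}, ?_, ?_⟩
  · refine Set.Countable.biUnion
      ((TopologicalSpace.countable_countableBasis Jet3).mono (Set.sep_subset _ _)) fun b hb => ?_
    have hbo := TopologicalSpace.isOpen_of_mem_countableBasis hb.1
    have hbn := TopologicalSpace.nonempty_of_mem_countableBasis hb.1
    obtain ⟨-, hs, hsb⟩ := hzs b hbo hbn
    refine (finite_setOf_not_injective_add_smul (Φ b) (Ψ b) fun c hc => ?_).countable
    refine fieldRow_perturb_injective hj (z b) hs c fun k => ?_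
    have h1 : Ψ b k ⬝ᵥ c = 0 := congrFun hc k
    have hF := E.F_ne_zero _ (hb.2 (hsb k))
    simp only [Ψ, smul_dotProduct, smul_eq_mul] at h1
    exact (mul_eq_zero.1 h1).resolve_left (div_ne_zero hF (abs_ne_zero.2 hF))
  · intro ε hε hεS O hO hOn hOE
    obtain ⟨y, hy⟩ := hOn
    obtain ⟨b, hb, hyb, hbO⟩ :=
      (TopologicalSpace.isBasis_countableBasis Jet3).exists_subset_of_mem_open hy hO
    have hbo := TopologicalSpace.isOpen_of_mem_countableBasis hb
    obtain ⟨hz, -, hsb⟩ := hzs b hbo ⟨y, hyb⟩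
    refine ⟨z b, s b, hbO hz, fun k => hbO (hsb k), ?_⟩
    have hgood : ∀ c, (Φ b + ε • Ψ b).mulVec c = 0 → c = 0 := by
      by_contra hcon
      exact hεS (Set.mem_biUnion (⟨hb, hbO.trans hOE⟩ : b ∈ 𝓑) hcon)
    intro c hc
    refine hgood c (funext fun k => ?_)
    refine Eq.trans ?_ (hc k)
    rw [E.fieldRow_perturbed j ε (hOE (hbO (hsb k))), abs_of_nonneg hε]
    rfl

/-! ### Maximality of the algebras for generic coefficients -/

theorem fderiv_eq_sum {n : ℕ} (L : (Fin n → ℝ) →L[ℝ] ℝ) (v : Fin n → ℝ) :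
    L v = ∑ k, v k * L (Pi.single k 1) := by
  conv_lhs => rw [pi_eq_sum_univ' v]
  rw [map_sum]
  refine Finset.sum_congr rfl fun k _ => ?_
  rw [map_smul, smul_eq_mul]

/-- The derivative of η^xxx with respect to u_xxx involves only the base point and u_x. Its two
coefficients in u_xxx become the last two unknowns of the sampled system. -/
theorem etaJet_three_update {V : Base → Base} {D : Set Base} (hD : IsOpen D)
    (hV : ContDiffOn ℝ ∞ V D) {z : Jet3} (hz : z.base ∈ D) :
    ∃ α β : ℝ, ∀ s, etaJet V 3 (Function.update z 5 s) = α + s * β := by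
  have hS := hD.preimage continuous_base
  have hb : ∀ s : ℝ, Jet3.base (Function.update z 5 s) = z.base := fun s => by
    funext i; fin_cases i <;> simp [Jet3.base, Function.update]
  set β := pd (Pi.single 5 1) (etaJet V 3) z
  have hβ : ∀ s : ℝ, pd (Pi.single 5 1) (etaJet V 3) (Function.update z 5 s) = β := fun s => by
    have h1 := pd_etaJet_three hD hV (z := Function.update z 5 s) (by rwa [hb])
    rw [h1, hb, totD_compJet hD hV 1 (by rwa [hb]), hb]
    simp only [β]
    rw [pd_etaJet_three hD hV hz, totD_compJet hD hV 1 hz]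
    simp [Function.update]
  have hd : ∀ s : ℝ, HasDerivAt (fun s : ℝ => etaJet V 3 (Function.update z 5 s) - s * β) 0 s := by
    intro s
    have h1 : HasDerivAt (fun s : ℝ => Function.update z 5 s) (Pi.single 5 1) s :=
      hasDerivAt_update z 5 s
    have h2 := ((hasOrder_etaJet hD hV (k := 3) le_rfl).differentiableAt hS
      (show Function.update z 5 s ∈ Jet3.base ⁻¹' D by
        rwa [Set.mem_preimage, hb])).hasFDerivAt.comp_hasDerivAt s h1
    have h3 := h2.sub ((hasDerivAt_id s).mul_const β)
    have h4 : fderiv ℝ (etaJet V 3) (Function.update z 5 s) (Pi.single 5 1) = β := hβ s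
    rw [h4] at h3
    exact h3.congr_deriv (by simp)
  refine ⟨etaJet V 3 (Function.update z 5 0), β, fun s => ?_⟩
  have := is_const_of_deriv_eq_zero (fun s => (hd s).differentiableAt)
    (fun s => (hd s).deriv) s 0
  simp only [zero_mul, sub_zero] at this
  linarith

theorem fderiv_component_eq_zero {V : Base → Base} {D : Set Base} (hD : IsOpen D) {i : Fin 3} {p : Base} (hp : p ∈ D) (h : ∀ p ∈ D, V p i = 0) :
    fderiv ℝ (fun p => V p i) p = 0 := by
  have : (fun p => V p i) =ᶠ[𝓝 p] fun _ => 0 := by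
    filter_upwards [hD.mem_nhds hp] with p hp using h p hp
  rw [this.fderiv_eq]
  simp

section Vanishing

variable {V : Base → Base} {D : Set Base} (hD : IsOpen D) (hV : ContDiffOn ℝ ∞ V D)
include hD hV

/-- The total derivative of a function of (t, x, u) is affine in u_x, and an open set of jets
contains two values of u_x over the same point. -/
theorem fderiv_component_eq_zero_of_totD {W : Set Jet3} (hW : IsOpen W) (i : Fin 3)
    (h : ∀ z ∈ W, z.base ∈ D ∧ totD (compJet V i) z = 0) {z : Jet3} (hz : z ∈ W) :
    fderiv ℝ (fun p => V p i) z.base (Pi.single 1 1) = 0 ∧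
      fderiv ℝ (fun p => V p i) z.base (Pi.single 2 1) = 0 := by
  obtain ⟨s, hs, hsW⟩ := exists_injective_update_mem hW hz 2 3
  have hb : ∀ s : ℝ, Jet3.base (Function.update z 3 s) = z.base := fun s => by
    funext i; fin_cases i <;> simp [Jet3.base, Function.update]
  have hzD := (h z hz).1
  have key : ∀ k, fderiv ℝ (fun p => V p i) z.base (Pi.single 1 1)
      + s k * fderiv ℝ (fun p => V p i) z.base (Pi.single 2 1) = 0 := fun k => by
    have h1 := (h _ (hsW k)).2
    rw [totD_compJet hD hV i (by rwa [hb]), hb] at h1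
    simpa using h1
  have h0 := key 0
  have h1 := key 1
  have hne : s 0 - s 1 ≠ 0 := sub_ne_zero.2 (hs.ne (by decide))
  have h2 : (s 0 - s 1) * fderiv ℝ (fun p => V p i) z.base (Pi.single 2 1) = 0 := by linarith
  have h3 := (mul_eq_zero.1 h2).resolve_left hne
  exact ⟨by simpa [h3] using h0, h3⟩

/-- A component with vanishing derivative is constant on a connected domain. -/
theorem component_const (hc : IsPreconnected D) (i : Fin 3)
    (h : ∀ p ∈ D, ∀ k, fderiv ℝ (fun p => V p i) p (Pi.single k 1) = 0) :
    ∃ c, ∀ p ∈ D, V p i = c :=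
  hD.exists_is_const_of_fderiv_eq_zero (𝕜 := ℝ) hc
    ((contDiffOn_component hV i).differentiableOn (by simp)) fun p hp => by
      ext v
      rw [fderiv_eq_sum]
      simp [h p hp]

/-- Along a line in the direction of u_xxx the first determining equation is linear and homogeneous
in seven constants. The component in the direction of which F is constant drops out, and the sampled
system has only the zero solution. -/
theorem unknowns_eq_zero_of_equation {E : EvolEq} (hadm : E.Admits V D) {i j : Fin 3}
    (hi : i ≠ 2) (hj : j ≠ 2) (hij : i ≠ j) (hE : E.IndepOf (i.castLE (by omega)))
    (hτ : ∀ p ∈ D, fderiv ℝ (fun p => V p 0) p (Pi.single 1 1) = 0 ∧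
      fderiv ℝ (fun p => V p 0) p (Pi.single 2 1) = 0)
    {z : Jet3} (hzD : z.base ∈ D) {s : Fin 7 → ℝ}
    (hs : ∀ k, Function.update z 5 (s k) ∈ E.dom)
    (hgood : ∀ c : Fin 7 → ℝ, (∀ k, fieldRow E.F (j.castLE (by omega))
      (Function.update z 5 (s k)) ⬝ᵥ c = 0) → c = 0) :
    4 * totD (compJet V 1) z - fderiv ℝ (fun p => V p 0) z.base (Pi.single 0 1) = 0 ∧
      compJet V j z = 0 ∧ compJet V 2 z = 0 := by
  obtain ⟨α, β, hαβ⟩ := etaJet_three_update hD hV hzD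
  have hb : ∀ s : ℝ, Jet3.base (Function.update z 5 s) = z.base := fun s => by
    funext i; fin_cases i <;> simp [Jet3.base, Function.update]
  have hH : ∀ k ≤ 2, ∀ s, etaJet V k (Function.update z 5 s) = etaJet V k z := fun k hk s => by
    have := (hasOrder_etaJet hD hV (k := k) (by omega)).eq_of_base_mem hD hk hzD s (z 5)
    rwa [Function.update_eq_self] at this
  set c : Fin 7 → ℝ := ![4 * totD (compJet V 1) z
    - fderiv ℝ (fun p => V p 0) z.base (Pi.single 0 1), compJet V j z, compJet V 2 z,
    etaJet V 1 z, etaJet V 2 z, α, β] with hc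
  have hc0 : c = 0 := by
    refine hgood c fun k => ?_
    have h1 := (determining_equations hD hV hadm hτ (hs k) (by rwa [hb])).1
    have h2 := (hE.fderiv_eq_zero (hs k)).1
    rw [fderiv_eq_sum, totD_compJet hD hV 1 (by rwa [hb]), hb] at h1
    have hcomp : ∀ l, compJet V l (Function.update z 5 (s k)) = compJet V l z := fun l => by
      simp [compJet, hb]
    have h35 : Function.update z 5 (s k) 3 = z 3 := by simp [Function.update]
    simp only [prolJet, Fin.sum_univ_six, hcomp, hH 1 (by omega), hH 2 (by omega), hαβ, h35] at h1
    rw [← totD_compJet hD hV 1 hzD] at h1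
    simp only [fieldRow, dotProduct, hc, Fin.sum_univ_seven]
    fin_cases i <;> fin_cases j <;> first
      | exact absurd rfl hi
      | exact absurd rfl hj
      | exact absurd rfl hij
      | (simp at h1 h2 ⊢
         rw [h2] at h1
         linear_combination h1)
  refine ⟨?_, ?_, ?_⟩
  · simpa [hc] using congrFun hc0 0
  · simpa [hc] using congrFun hc0 1
  · simpa [hc] using congrFun hc0 2

end Vanishing

theorem isOpen_restrict_over {E : EvolEq} {D : Set Base} (hD : IsOpen D) :
    IsOpen {z | z ∈ E.dom ∧ z.base ∈ D} :=
  E.isOpen_dom.inter (hD.preimage continuous_base)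

/-- For good `ε`, the unknowns of the determining equation vanish identically for every field that
is admitted by an open part of the perturbed equation. -/
theorem unknowns_eq_zero {E : EvolEq} {i j : Fin 3} (hi : i ≠ 2) (hj : j ≠ 2) (hij : i ≠ j)
    (hE : E.IndepOf (i.castLE (by omega)))
    (hgood : ∀ O : Set Jet3, IsOpen O → O.Nonempty → O ⊆ E.dom →
      ∃ (z : Jet3) (s : Fin 7 → ℝ), z ∈ O ∧ (∀ k, Function.update z 5 (s k) ∈ O) ∧
        ∀ c : Fin 7 → ℝ, (∀ k, fieldRow E.F (j.castLE (by omega))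
          (Function.update z 5 (s k)) ⬝ᵥ c = 0) → c = 0)
    {N : Set Jet3} (hN : IsOpen N) {V : Base → Base} {D : Set Base} (hD : IsOpen D)
    (hV : ContDiffOn ℝ ∞ V D) (hadm : (E.restrict N hN).Admits V D)
    (hτ : ∀ p ∈ D, fderiv ℝ (fun p => V p 0) p (Pi.single 1 1) = 0 ∧
      fderiv ℝ (fun p => V p 0) p (Pi.single 2 1) = 0)
    {z : Jet3} (hz : z ∈ (E.restrict N hN).dom) (hzD : z.base ∈ D) :
    4 * totD (compJet V 1) z - fderiv ℝ (fun p => V p 0) z.base (Pi.single 0 1) = 0 ∧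
      compJet V j z = 0 ∧ compJet V 2 z = 0 := by
  have hS := hD.preimage continuous_base
  have hE' : (E.restrict N hN).IndepOf (i.castLE (by omega)) := fun z hz z' hz' h =>
    hE z hz.1 z' hz'.1 h
  -- Vanishing is known at suitable jets in every nonempty open set. Continuity extends it to all
  -- jets.
  have key : ∀ f : Jet3 → ℝ, ContinuousAt f z →
      (∀ y, y.base ∈ D → (4 * totD (compJet V 1) y
        - fderiv ℝ (fun p => V p 0) y.base (Pi.single 0 1) = 0 ∧
        compJet V j y = 0 ∧ compJet V 2 y = 0) → f y = 0) → f z = 0 := by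
    intro f hf hf0
    by_contra hne
    obtain ⟨O, hOsub, hO, hzO⟩ := mem_nhds_iff.1 (Filter.inter_mem (hf.eventually_ne hne)
      ((isOpen_restrict_over (E := E.restrict N hN) hD).mem_nhds ⟨hz, hzD⟩))
    obtain ⟨y, s, hy, hs, hc⟩ := hgood O hO ⟨z, hzO⟩ fun y hy => (hOsub hy).2.1.1
    have hyD : y.base ∈ D := (hOsub hy).2.2
    exact (hOsub hy).1 (hf0 y hyD (unknowns_eq_zero_of_equation hD hV hadm hi hj hij hE' hτ hyD
      (fun k => (hOsub (hs k)).2.1) hc))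
  have hcomp : ∀ l, ContinuousAt (compJet V l) z := fun l =>
    ((hasOrder_compJet hD hV l).contDiffAt hS hzD).continuousAt
  have hξ : ContinuousAt (totD (compJet V 1)) z :=
    (((hasOrder_compJet hD hV 1).totD hS (by omega)).contDiffAt hS hzD).continuousAt
  have hτt : ContinuousAt
      (fun z : Jet3 => fderiv ℝ (fun p => V p 0) z.base (Pi.single 0 1)) z := by
    have h1 : ContinuousAt (fun p => fderiv ℝ (fun p => V p 0) p (Pi.single 0 1)) z.base :=
      (((contDiffOn_component hV 0).contDiffAt (hD.mem_nhds hzD)).fderiv_right (m := ∞)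
        (by simp)).continuousAt.clm_apply continuousAt_const
    exact ContinuousAt.comp (f := Jet3.base) h1 continuous_base.continuousAt
  exact ⟨key _ ((hξ.const_mul 4).sub hτt) fun y _ h => h.1, key _ (hcomp j) fun y _ h => h.2.1,
    key _ (hcomp 2) fun y _ h => h.2.2⟩

/-- Once ξ = η = 0, the remaining unknown 4 D_x ξ − τ_t reduces to −τ_t. Together with τ_x = τ_u = 0
and connectedness this makes τ constant. -/
theorem maximalAlgebra_fieldT {E : EvolEq} (hE : E.IndepOf 0)
    (hgood : ∀ O : Set Jet3, IsOpen O → O.Nonempty → O ⊆ E.dom →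
      ∃ (z : Jet3) (s : Fin 7 → ℝ), z ∈ O ∧ (∀ k, Function.update z 5 (s k) ∈ O) ∧
        ∀ c : Fin 7 → ℝ, (∀ k, fieldRow E.F 1 (Function.update z 5 (s k)) ⬝ᵥ c = 0) → c = 0) :
    E.MaximalAlgebra fieldT := by
  refine ⟨fieldT_eq ▸ EvolEq.IndepOf.admits (i := 0) (by decide) hE _, ?_⟩
  intro N hN D hD hDc hDE V hV hadm
  have hτ : ∀ p ∈ D, _ := fun p hp => fderiv_time_eq_zero hD hV hadm hp (hDE hp)
  have hun : ∀ z ∈ (E.restrict N hN).dom, z.base ∈ D → _ := fun z hz hzD =>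
    unknowns_eq_zero (i := 0) (j := 1) (by decide) (by decide) (by decide) hE hgood hN hD hV hadm
      hτ hz hzD
  have hξ : ∀ p ∈ D, V p 1 = 0 := fun p hp => by
    obtain ⟨z, hz, rfl⟩ := hDE hp
    exact (hun z hz hp).2.1
  have hη : ∀ p ∈ D, V p 2 = 0 := fun p hp => by
    obtain ⟨z, hz, rfl⟩ := hDE hp
    exact (hun z hz hp).2.2
  obtain ⟨c, hc⟩ := component_const hD hV hDc 0 fun p hp k => by
    fin_cases k
    · obtain ⟨z, hz, rfl⟩ := hDE hp
      have h := (hun z hz hp).1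
      rw [totD_compJet hD hV 1 hp, fderiv_component_eq_zero hD hp hξ] at h
      simpa using h
    · exact (hτ p hp).1
    · exact (hτ p hp).2
  refine ⟨c, fun p hp => ?_⟩
  funext k
  fin_cases k
  · simpa [fieldT] using hc p hp
  · simpa [fieldT] using hξ p hp
  · simpa [fieldT] using hη p hp

/-- Once τ = η = 0, the first determining equation only yields D_x ξ = 0, so ξ may still depend on
t. The second one then reduces to u_x ξ_t = 0. -/
theorem maximalAlgebra_fieldX {E : EvolEq} (hE : E.IndepOf 1)
    (hgood : ∀ O : Set Jet3, IsOpen O → O.Nonempty → O ⊆ E.dom →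
      ∃ (z : Jet3) (s : Fin 7 → ℝ), z ∈ O ∧ (∀ k, Function.update z 5 (s k) ∈ O) ∧
        ∀ c : Fin 7 → ℝ, (∀ k, fieldRow E.F 0 (Function.update z 5 (s k)) ⬝ᵥ c = 0) → c = 0) :
    E.MaximalAlgebra fieldX := by
  refine ⟨fieldX_eq ▸ EvolEq.IndepOf.admits (i := 1) (by decide) hE _, ?_⟩
  intro N hN D hD hDc hDE V hV hadm
  have hτ : ∀ p ∈ D, _ := fun p hp => fderiv_time_eq_zero hD hV hadm hp (hDE hp)
  have hun : ∀ z ∈ (E.restrict N hN).dom, z.base ∈ D → _ := fun z hz hzD =>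
    unknowns_eq_zero (i := 1) (j := 0) (by decide) (by decide) (by decide) hE hgood hN hD hV hadm
      hτ hz hzD
  have hτ0 : ∀ p ∈ D, V p 0 = 0 := fun p hp => by
    obtain ⟨z, hz, rfl⟩ := hDE hp
    exact (hun z hz hp).2.1
  have hη : ∀ p ∈ D, V p 2 = 0 := fun p hp => by
    obtain ⟨z, hz, rfl⟩ := hDE hp
    exact (hun z hz hp).2.2
  set W : Set Jet3 := {z | z ∈ (E.restrict N hN).dom ∧ z.base ∈ D}
  have hW : IsOpen W := isOpen_restrict_over hD
  have hWξ : ∀ z ∈ W, z.base ∈ D ∧ totD (compJet V 1) z = 0 := fun z hz => by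
    have h := (hun z hz.1 hz.2).1
    rw [fderiv_component_eq_zero hD hz.2 hτ0] at h
    exact ⟨hz.2, by simpa using h⟩
  -- The functions vanish on an open set, so their total derivatives do as well and the recursion
  -- preserves zero.
  have hH : ∀ k, ∀ z ∈ W, etaJet V k z = 0 := by
    intro k
    induction k with
    | zero => exact fun z hz => hη _ hz.2
    | succ k ih =>
      intro z hz
      have h0 : etaJet V k =ᶠ[𝓝 z] fun _ => 0 := by
        filter_upwards [hW.mem_nhds hz] with y hy using ih y hy
      have h1 : totD (etaJet V k) z = 0 := by rw [totD, h0.fderiv_eq]; simp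
      simp only [etaJet, h1, (hWξ z hz).2, mul_zero, sub_zero]
  have hξt : ∀ z ∈ W, z 3 * fderiv ℝ (fun p => V p 1) z.base (Pi.single 0 1) = 0 := fun z hz => by
    have h := (determining_equations hD hV hadm hτ hz.1 hz.2).2
    have h0 : etaJet V 3 =ᶠ[𝓝 z] fun _ => 0 := by
      filter_upwards [hW.mem_nhds hz] with y hy using hH 3 y hy
    have h1 : totD (etaJet V 3) z = 0 := by rw [totD, h0.fderiv_eq]; simp
    have h2 : prolJet V z = V z.base 1 • Pi.single 1 1 := by
      funext k
      fin_cases k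
      · simpa [prolJet, compJet] using hτ0 _ hz.2
      · simp [prolJet, compJet]
      · simpa [prolJet, compJet] using hη _ hz.2
      · simpa [prolJet] using hH 1 z hz
      · simpa [prolJet] using hH 2 z hz
      · simpa [prolJet] using hH 3 z hz
    have h3 : fderiv ℝ (E.restrict N hN).G z (Pi.single 1 1) = 0 := (hE.fderiv_eq_zero hz.1.1).2
    rw [h1, h2, map_smul, h3, fderiv_component_eq_zero hD hz.2 hτ0,
      fderiv_component_eq_zero hD hz.2 hη,
      (fderiv_component_eq_zero_of_totD hD hV hW 1 hWξ hz).2] at h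
    simpa using h
  obtain ⟨c, hc⟩ := component_const hD hV hDc 1 fun p hp k => by
    obtain ⟨z, hz, rfl⟩ := hDE hp
    have hzW : z ∈ W := ⟨hz, hp⟩
    fin_cases k
    · obtain ⟨s, hs, hsW⟩ := exists_injective_update_mem hW hzW 2 3
      have hb : ∀ s : ℝ, Jet3.base (Function.update z 3 s) = z.base := fun s => by
        funext i; fin_cases i <;> simp [Jet3.base, Function.update]
      have h0 := hξt _ (hsW 0)
      have h1 := hξt _ (hsW 1)
      rw [hb] at h0 h1
      simp only [Function.update_self] at h0 h1
      have hne : s 0 - s 1 ≠ 0 := sub_ne_zero.2 (hs.ne (by decide))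
      have h2 : (s 0 - s 1) * fderiv ℝ (fun p => V p 1) z.base (Pi.single 0 1) = 0 := by linarith
      exact (mul_eq_zero.1 h2).resolve_left hne
    · exact (fderiv_component_eq_zero_of_totD hD hV hW 1 hWξ hzW).1
    · exact (fderiv_component_eq_zero_of_totD hD hV hW 1 hWξ hzW).2
  refine ⟨c, fun p hp => ?_⟩
  funext k
  fin_cases k
  · simpa [fieldX] using hτ0 p hp
  · simpa [fieldX] using hc p hp
  · simpa [fieldX] using hη p hp

theorem genericallyMaximal_of {i j : Fin 6} (hi : i < 2) (hj : j < 2) (hij : i ≠ j)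
    {V₀ : Base → Base}
    (h : ∀ E : EvolEq, E.IndepOf i → (∀ O : Set Jet3, IsOpen O → O.Nonempty → O ⊆ E.dom →
      ∃ (z : Jet3) (s : Fin 7 → ℝ), z ∈ O ∧ (∀ k, Function.update z 5 (s k) ∈ O) ∧
        ∀ c : Fin 7 → ℝ, (∀ k, fieldRow E.F j (Function.update z 5 (s k)) ⬝ᵥ c = 0) → c = 0) →
      E.MaximalAlgebra V₀) : GenericallyMaximal i V₀ := by
  intro E hE
  obtain ⟨S, hS, hgood⟩ := exists_countable_forall_dense E hj
  -- The added term has the sign of F, so the sum cannot vanish, and G is left unchanged. The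
  -- absolute value in the definition of the family only serves to define it for negative ε, where
  -- nothing is claimed.
  refine ⟨fun z => E.F z / |E.F z| * perturb j z, fun _ => 0, E.perturbed j, fun ε hε =>
    ⟨rfl, hE.perturbed hij hi ε, fun z _ => ⟨?_, ?_⟩⟩, hS.mono fun ε hε => ?_⟩
  · simp only [EvolEq.perturbed, abs_of_nonneg hε]
  · simp [EvolEq.perturbed]
  · by_contra hεS
    exact hε.2 (h _ (hE.perturbed hij hi ε) (hgood ε hε.1 hεS))

theorem genericallyMaximal_fieldT : GenericallyMaximal 0 fieldT :=
  genericallyMaximal_of (j := 1) (by decide) (by decide) (by decide)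
    fun _ hE hgood => maximalAlgebra_fieldT hE hgood

theorem genericallyMaximal_fieldX : GenericallyMaximal 1 fieldX :=
  genericallyMaximal_of (j := 0) (by decide) (by decide) (by decide)
    fun _ hE hgood => maximalAlgebra_fieldX hE hgood

/-! ### Families of functions

A family `w` of functions of `(t, x)` that depends on a parameter `ε` is a function
on `ℝ × (ℝ × ℝ)`. -/

/-- The coordinate `t`. -/
def famT : ℝ × (ℝ × ℝ) →L[ℝ] ℝ :=
  (ContinuousLinearMap.fst ℝ ℝ ℝ).comp (ContinuousLinearMap.snd ℝ ℝ (ℝ × ℝ))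

/-- The coordinate `x`. -/
def famX : ℝ × (ℝ × ℝ) →L[ℝ] ℝ :=
  (ContinuousLinearMap.snd ℝ ℝ ℝ).comp (ContinuousLinearMap.snd ℝ ℝ (ℝ × ℝ))

/-- The direction of `x`. -/
def dirX : ℝ × (ℝ × ℝ) := (0, (0, 1))

/-- The direction of `t`. -/
def dirT : ℝ × (ℝ × ℝ) := (0, (1, 0))

/-- The direction of the parameter. -/
def dirE : ℝ × (ℝ × ℝ) := (1, (0, 0))

/-- The graph of a family. -/
def famPt (w : ℝ × (ℝ × ℝ) → ℝ) (p : ℝ × (ℝ × ℝ)) : Base := gbase famT famX w p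

/-- The jets of a family. -/
def famJet (w : ℝ × (ℝ × ℝ) → ℝ) (p : ℝ × (ℝ × ℝ)) : Jet3 := gjet famT famX dirX w p

theorem base_famJet (w : ℝ × (ℝ × ℝ) → ℝ) (p : ℝ × (ℝ × ℝ)) : (famJet w p).base = famPt w p := rfl

theorem famPt_eq_graphPt (w : ℝ × (ℝ × ℝ) → ℝ) (p : ℝ × (ℝ × ℝ)) :
    famPt w p = graphPt (fun r => w (p.1, r)) p.2 := rfl

theorem contDiffAt_famPt {w : ℝ × (ℝ × ℝ) → ℝ} {p : ℝ × (ℝ × ℝ)} (hw : ContDiffAt ℝ ∞ w p) :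
    ContDiffAt ℝ ∞ (famPt w) p :=
  contDiffAt_gbase famT famX hw

theorem contDiffAt_famJet {w : ℝ × (ℝ × ℝ) → ℝ} {p : ℝ × (ℝ × ℝ)} (hw : ContDiffAt ℝ ∞ w p) :
    ContDiffAt ℝ ∞ (famJet w) p :=
  contDiffAt_gjet famT famX dirX hw

theorem contDiffAt_slice {w : ℝ × (ℝ × ℝ) → ℝ} {p : ℝ × (ℝ × ℝ)} {n : WithTop ℕ∞}
    (hw : ContDiffAt ℝ n w p) : ContDiffAt ℝ n (fun r => w (p.1, r)) p.2 :=
  ContDiffAt.comp (f := fun r : ℝ × ℝ => (p.1, r)) p.2 hw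
    (contDiffAt_const.prodMk contDiffAt_id)

theorem iterate_Dx_slice {w : ℝ × (ℝ × ℝ) → ℝ} {p₀ : ℝ × (ℝ × ℝ)} (hw : ContDiffAt ℝ ∞ w p₀)
    (k : ℕ) : ∀ᶠ p in 𝓝 p₀, Dx^[k] (fun r => w (p.1, r)) p.2 = (pd dirX)^[k] w p :=
  iterate_pd_slice _ hw k

theorem Dt_slice {w : ℝ × (ℝ × ℝ) → ℝ} {p₀ : ℝ × (ℝ × ℝ)} (hw : ContDiffAt ℝ ∞ w p₀) :
    ∀ᶠ p in 𝓝 p₀, Dt (fun r => w (p.1, r)) p.2 = pd dirT w p :=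
  iterate_pd_slice ((1 : ℝ), (0 : ℝ)) hw 1

theorem jet3_slice {w : ℝ × (ℝ × ℝ) → ℝ} {p₀ : ℝ × (ℝ × ℝ)} (hw : ContDiffAt ℝ ∞ w p₀) :
    ∀ᶠ p in 𝓝 p₀, jet3 (fun r => w (p.1, r)) p.2 = famJet w p := by
  filter_upwards [iterate_Dx_slice hw 1, iterate_Dx_slice hw 2, iterate_Dx_slice hw 3]
    with p h1 h2 h3
  have h1' : Dx (fun r => w (p.1, r)) p.2 = pd dirX w p := h1
  simp only [jet3, famJet, gjet, h1', h2, h3]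
  rfl

/-! ### Prolonged fields as derivatives along families -/

/-- The characteristic `η - τ u_t - ξ u_x` of a vector field. -/
def characteristic (V : Base → Base) (u : ℝ × ℝ → ℝ) (r : ℝ × ℝ) : ℝ :=
  along V 2 u r - along V 0 u r * Dt u r - along V 1 u r * Dx u r

theorem contDiffAt_along' {V : Base → Base} (i : Fin 3) {u : ℝ × ℝ → ℝ} {q : ℝ × ℝ}
    (hu : ContDiffAt ℝ ∞ u q) (hV : ContDiffAt ℝ ∞ V (graphPt u q)) :
    ContDiffAt ℝ ∞ (along V i u) q :=
  (contDiffAt_pi.1 hV i).comp q (contDiffAt_graphPt hu)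

theorem contDiffAt_characteristic {V : Base → Base} {u : ℝ × ℝ → ℝ} {q : ℝ × ℝ}
    (hu : ContDiffAt ℝ ∞ u q) (hV : ContDiffAt ℝ ∞ V (graphPt u q)) :
    ContDiffAt ℝ ∞ (characteristic V u) q :=
  ((contDiffAt_along' 2 hu hV).sub ((contDiffAt_along' 0 hu hV).mul (contDiffAt_pd hu))).sub
    ((contDiffAt_along' 1 hu hV).mul (contDiffAt_pd hu))

/-- When the right hand side is differentiated, the terms with D_x τ and D_x ξ are exactly those
that the recursion subtracts. The non-recursive form is what the chain rule along a family produces.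
-/
theorem etaX_eq_characteristic {V : Base → Base} {u : ℝ × ℝ → ℝ} {q : ℝ × ℝ}
    (hu : ContDiffAt ℝ ∞ u q) (hV : ContDiffAt ℝ ∞ V (graphPt u q)) (k : ℕ) :
    ∀ᶠ r in 𝓝 q, etaX V u k r = Dx^[k] (characteristic V u) r
      + along V 0 u r * Dx^[k] (Dt u) r + along V 1 u r * Dx^[k + 1] u r := by
  have h0 := contDiffAt_along' 0 hu hV
  have h1 := contDiffAt_along' 1 hu hV
  have hut : ContDiffAt ℝ ∞ (Dt u) q := contDiffAt_pd hu
  have hQ := contDiffAt_characteristic hu hV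
  induction k with
  | zero =>
    refine Filter.Eventually.of_forall fun r => ?_
    simp only [etaX, characteristic, Function.iterate_zero, id, zero_add, Function.iterate_one]
    ring
  | succ k ih =>
    rw [Dx_eq_pd] at *
    filter_upwards [pd_congr (a := ((0 : ℝ), (1 : ℝ))) ih, eventually_differentiableAt h0,
      eventually_differentiableAt h1,
      eventually_differentiableAt (contDiffAt_iterate_pd (a := ((0 : ℝ), (1 : ℝ))) hut k),
      eventually_differentiableAt (contDiffAt_iterate_pd (a := ((0 : ℝ), (1 : ℝ))) hu (k + 1)),
      eventually_differentiableAt (contDiffAt_iterate_pd (a := ((0 : ℝ), (1 : ℝ))) hQ k)]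
      with r e d0 d1 dt du dQ
    have e' : etaX V u (k + 1) r = pd (0, 1) (etaX V u k) r
        - (pd (0, 1))^[k] (Dt u) r * pd (0, 1) (along V 0 u) r
        - (pd (0, 1))^[k + 1] u r * pd (0, 1) (along V 1 u) r := rfl
    rw [e', e, pd_add (dQ.fun_add (d0.fun_mul dt)) (d1.fun_mul du), pd_add dQ (d0.fun_mul dt),
      pd_mul d0 dt, pd_mul d1 du]
    simp only [Function.iterate_succ_apply']
    ring

theorem etaT_eq_characteristic {V : Base → Base} {u : ℝ × ℝ → ℝ} {q : ℝ × ℝ}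
    (hu : ContDiffAt ℝ ∞ u q) (hV : ContDiffAt ℝ ∞ V (graphPt u q)) :
    etaT V u q = Dt (characteristic V u) q + along V 0 u q * Dt (Dt u) q
      + along V 1 u q * Dx (Dt u) q := by
  have d0 := (contDiffAt_along' 0 hu hV).differentiableAt (by simp)
  have d1 := (contDiffAt_along' 1 hu hV).differentiableAt (by simp)
  have d2 := (contDiffAt_along' 2 hu hV).differentiableAt (by simp)
  have dt : DifferentiableAt ℝ (pd (1, 0) u) q := (contDiffAt_pd hu).differentiableAt (by simp)
  have dx : DifferentiableAt ℝ (pd (0, 1) u) q := (contDiffAt_pd hu).differentiableAt (by simp)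
  have hcomm : pd (1, 0) (pd (0, 1) u) q = pd (0, 1) (pd (1, 0) u) q := (pd_comm hu).self_of_nhds
  unfold etaT
  rw [Dt_eq_pd, Dx_eq_pd]
  have e : pd (1, 0) (characteristic V u) q = pd (1, 0) (along V 2 u) q
      - (pd (1, 0) (along V 0 u) q * pd (1, 0) u q + along V 0 u q * pd (1, 0) (pd (1, 0) u) q)
      - (pd (1, 0) (along V 1 u) q * pd (0, 1) u q
        + along V 1 u q * pd (1, 0) (pd (0, 1) u) q) := by
    rw [← pd_mul d0 dt, ← pd_mul d1 dx, ← pd_sub d2 (d0.fun_mul dt),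
      ← pd_sub (d2.fun_sub (d0.fun_mul dt)) (d1.fun_mul dx)]
    rfl
  rw [e, hcomm]
  ring

/-- The family `w` starts at `u` with velocity the characteristic of `V`. -/
structure IsVariation (V : Base → Base) (u : ℝ × ℝ → ℝ) (q : ℝ × ℝ)
    (w : ℝ × (ℝ × ℝ) → ℝ) : Prop where
  contDiffAt : ContDiffAt ℝ ∞ w (0, q)
  field : ContDiffAt ℝ ∞ V (graphPt u q)
  slice : ∀ r, w (0, r) = u r
  velocity : ∀ᶠ r in 𝓝 q, pd dirE w (0, r) = characteristic V u r

namespace IsVariation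

variable {V : Base → Base} {u : ℝ × ℝ → ℝ} {q : ℝ × ℝ} {w : ℝ × (ℝ × ℝ) → ℝ}

theorem contDiffAt_slice (h : IsVariation V u q w) : ContDiffAt ℝ ∞ u q := by
  have := _root_.contDiffAt_slice h.contDiffAt
  simpa [h.slice] using this

theorem eventually_slice {P : ℝ × (ℝ × ℝ) → Prop} (h : ∀ᶠ p in 𝓝 ((0 : ℝ), q), P p) :
    ∀ᶠ r in 𝓝 q, P (0, r) :=
  (Continuous.prodMk_right (0 : ℝ)).continuousAt.eventually h

theorem fderiv_apply (g : ℝ × (ℝ × ℝ) → ℝ) (p : ℝ × (ℝ × ℝ)) (a b : ℝ) :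
    fderiv ℝ g p (1, (a, b)) = pd dirE g p + a * pd dirT g p + b * pd dirX g p := by
  simp only [pd, dirE, dirT, dirX, ← smul_eq_mul, ← map_smul, ← map_add]
  simp

/-- The chain rule along a curve with velocity (τ, ξ) gives D_x^k Q + τ ∂_x^k u_t + ξ ∂_x^{k+1} u,
after the derivative in the parameter has been moved past the x-derivatives. No flow of the field is
needed. -/
theorem hasDerivAt_etaX (h : IsVariation V u q w) {c : ℝ → ℝ × ℝ} (hc0 : c 0 = q)
    (hc : HasDerivAt c (along V 0 u q, along V 1 u q) 0) (k : ℕ) :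
    HasDerivAt (fun ε => (pd dirX)^[k] w (ε, c ε)) (etaX V u k q) 0 := by
  have hu := h.contDiffAt_slice
  have hwk := contDiffAt_iterate_pd (a := dirX) h.contDiffAt k
  have hd : HasFDerivAt ((pd dirX)^[k] w) (fderiv ℝ ((pd dirX)^[k] w) (0, q)) (0, c 0) := by
    rw [hc0]; exact (hwk.differentiableAt (by simp)).hasFDerivAt
  have h1 := hd.comp_hasDerivAt (0 : ℝ) ((hasDerivAt_id (0 : ℝ)).prodMk hc)
  refine h1.congr_deriv ?_
  have hsl : ∀ (g : ℝ × (ℝ × ℝ) → ℝ) (k : ℕ), ContDiffAt ℝ ∞ g (0, q) →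
      (pd dirX)^[k] g (0, q) = Dx^[k] (fun r => g (0, r)) q := fun g k hg =>
    (iterate_Dx_slice hg k).self_of_nhds.symm
  have hu' : (fun r => w (0, r)) = u := funext h.slice
  have hut : (fun r => pd dirT w (0, r)) =ᶠ[𝓝 q] Dt u := by
    filter_upwards [eventually_slice (Dt_slice h.contDiffAt)] with r hr
    rw [← hr]
    simp only [h.slice]
  rw [fderiv_apply, (pd_iterate_comm h.contDiffAt k).self_of_nhds,
    (pd_iterate_comm h.contDiffAt k).self_of_nhds, ← Function.iterate_succ_apply' (pd dirX),
    hsl _ _ (contDiffAt_pd h.contDiffAt), hsl _ _ (contDiffAt_pd h.contDiffAt),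
    hsl _ _ h.contDiffAt, hu', (etaX_eq_characteristic hu h.field k).self_of_nhds]
  have e1 := (iterate_pd_congr (a := ((0 : ℝ), (1 : ℝ))) h.velocity k).self_of_nhds
  have e2 := (iterate_pd_congr (a := ((0 : ℝ), (1 : ℝ))) hut k).self_of_nhds
  rw [Dx_eq_pd, e1, e2]

theorem hasDerivAt_etaT (h : IsVariation V u q w) {c : ℝ → ℝ × ℝ} (hc0 : c 0 = q)
    (hc : HasDerivAt c (along V 0 u q, along V 1 u q) 0) :
    HasDerivAt (fun ε => pd dirT w (ε, c ε)) (etaT V u q) 0 := by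
  have hu := h.contDiffAt_slice
  have hwt : ContDiffAt ℝ ∞ (pd dirT w) (0, q) := contDiffAt_pd h.contDiffAt
  have hd : HasFDerivAt (pd dirT w) (fderiv ℝ (pd dirT w) (0, q)) (0, c 0) := by
    rw [hc0]; exact (hwt.differentiableAt (by simp)).hasFDerivAt
  have h1 := hd.comp_hasDerivAt (0 : ℝ) ((hasDerivAt_id (0 : ℝ)).prodMk hc)
  refine h1.congr_deriv ?_
  have hu' : (fun r => w (0, r)) = u := funext h.slice
  have hut : (fun r => pd dirT w (0, r)) =ᶠ[𝓝 q] Dt u := by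
    filter_upwards [eventually_slice (Dt_slice h.contDiffAt)] with r hr
    rw [← hr]
    simp only [h.slice]
  have s1 : pd dirT (pd dirE w) (0, q) = Dt (fun r => pd dirE w (0, r)) q :=
    (Dt_slice (contDiffAt_pd h.contDiffAt)).self_of_nhds.symm
  have s2 : pd dirT (pd dirT w) (0, q) = Dt (fun r => pd dirT w (0, r)) q :=
    (Dt_slice hwt).self_of_nhds.symm
  have s3 : pd dirX (pd dirT w) (0, q) = Dx (fun r => pd dirT w (0, r)) q :=
    (iterate_Dx_slice hwt 1).self_of_nhds.symm
  rw [fderiv_apply, (pd_comm (a := dirE) (b := dirT) h.contDiffAt).self_of_nhds, s1, s2, s3,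
    etaT_eq_characteristic hu h.field]
  have e1 := (pd_congr (a := ((1 : ℝ), (0 : ℝ))) h.velocity).self_of_nhds
  have e2 := (pd_congr (a := ((1 : ℝ), (0 : ℝ))) hut).self_of_nhds
  have e3 := (pd_congr (a := ((0 : ℝ), (1 : ℝ))) hut).self_of_nhds
  rw [Dt_eq_pd, Dx_eq_pd] at *
  rw [e1, e2, e3]

theorem famJet_zero (h : IsVariation V u q w) : famJet w (0, q) = jet3 u q := by
  rw [← (jet3_slice h.contDiffAt).self_of_nhds]
  simp only [h.slice]

theorem hasDerivAt_famJet (h : IsVariation V u q w) {c : ℝ → ℝ × ℝ} (hc0 : c 0 = q)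
    (hc : HasDerivAt c (along V 0 u q, along V 1 u q) 0) :
    HasDerivAt (fun ε => famJet w (ε, c ε)) (prol3 V u q) 0 := by
  have hc1 : HasDerivAt (fun ε => (c ε).1) (along V 0 u q) 0 := hc.fst
  have hc2 : HasDerivAt (fun ε => (c ε).2) (along V 1 u q) 0 := hc.snd
  refine hasDerivAt_pi.2 fun i => ?_
  fin_cases i
  · exact hc1
  · exact hc2
  · exact h.hasDerivAt_etaX hc0 hc 0
  · exact h.hasDerivAt_etaX hc0 hc 1
  · exact h.hasDerivAt_etaX hc0 hc 2
  · exact h.hasDerivAt_etaX hc0 hc 3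

/-- The left hand side of Lie's criterion is the derivative of the left hand side of the equation
along a variation. -/
theorem hasDerivAt_defect (h : IsVariation V u q w) {c : ℝ → ℝ × ℝ} (hc0 : c 0 = q)
    (hc : HasDerivAt c (along V 0 u q, along V 1 u q) 0) {E : EvolEq} (hE : jet3 u q ∈ E.dom) :
    HasDerivAt (fun ε => pd dirT w (ε, c ε) - E.F (famJet w (ε, c ε)) * (pd dirX)^[4] w (ε, c ε)
      - E.G (famJet w (ε, c ε))) (lieExpr E V u q) 0 := by
  have hJ := h.hasDerivAt_famJet hc0 hc
  have hJ0 : famJet w (0, c 0) = jet3 u q := by rw [hc0, h.famJet_zero]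
  have hF : HasFDerivAt E.F (fderiv ℝ E.F (jet3 u q)) (famJet w (0, c 0)) := by
    rw [hJ0]; exact ((E.contDiffAt_F hE).differentiableAt (by simp)).hasFDerivAt
  have hG : HasFDerivAt E.G (fderiv ℝ E.G (jet3 u q)) (famJet w (0, c 0)) := by
    rw [hJ0]; exact ((E.contDiffAt_G hE).differentiableAt (by simp)).hasFDerivAt
  have h4 : (pd dirX)^[4] w (0, c 0) = Dx^[4] u q := by
    rw [hc0, ← (iterate_Dx_slice h.contDiffAt 4).self_of_nhds]
    simp only [h.slice]
  refine (((h.hasDerivAt_etaT hc0 hc).sub ((hF.comp_hasDerivAt (0 : ℝ) hJ).mul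
    (h.hasDerivAt_etaX hc0 hc 4))).sub (hG.comp_hasDerivAt (0 : ℝ) hJ)).congr_deriv ?_
  simp only [hJ0, h4, lieExpr]
  ring

end IsVariation

/-! ### Prolongation of equivalence transformations -/

theorem exists_equiv_of_injective {E : Type*} [NormedAddCommGroup E] [NormedSpace ℝ E]
    [FiniteDimensional ℝ E] (L : E →L[ℝ] E) (hL : ∀ v, L v = 0 → v = 0) :
    ∃ e : E ≃L[ℝ] E, (e : E →L[ℝ] E) = L := by
  refine ⟨(LinearEquiv.ofInjectiveEndo (L : E →ₗ[ℝ] E)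
    ((injective_iff_map_eq_zero _).2 hL)).toContinuousLinearEquiv, ?_⟩
  ext v
  rfl

theorem fderiv_fam_apply (g : ℝ × (ℝ × ℝ) → ℝ) (p a : ℝ × (ℝ × ℝ)) :
    fderiv ℝ g p a = a.1 * pd dirE g p + a.2.1 * pd dirT g p + a.2.2 * pd dirX g p := by
  simp only [pd, dirE, dirT, dirX, ← smul_eq_mul, ← map_smul, ← map_add]
  simp

theorem fderiv_triangular {T : ℝ → ℝ} {X U : Base → ℝ} {b : Base} {T' : ℝ}
    (hT : HasDerivAt T T' (b 0)) (hX : DifferentiableAt ℝ X b) (hU : DifferentiableAt ℝ U b)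
    (v : Base) : fderiv ℝ (fun b : Base => (![T (b 0), X b, U b] : Base)) b v
      = ![T' * v 0, fderiv ℝ X b v, fderiv ℝ U b v] := by
  have hT : HasFDerivAt (fun b : Base => T (b 0))
      (T' • (ContinuousLinearMap.proj 0 : Base →L[ℝ] ℝ)) b :=
    hT.comp_hasFDerivAt b (ContinuousLinearMap.proj 0 : Base →L[ℝ] ℝ).hasFDerivAt
  have : HasFDerivAt (fun b : Base => (![T (b 0), X b, U b] : Base)) (ContinuousLinearMap.pi
      ![T' • (ContinuousLinearMap.proj 0 : Base →L[ℝ] ℝ), fderiv ℝ X b,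
        fderiv ℝ U b] : Base →L[ℝ] Base) b := by
    refine hasFDerivAt_pi.2 fun i => ?_
    fin_cases i
    · exact hT
    · exact hX.hasFDerivAt
    · exact hU.hasFDerivAt
  rw [this.fderiv]
  funext i
  fin_cases i <;> rfl

theorem eq_zero_of_triangular {c : ℝ} {A B : Base →L[ℝ] ℝ} (hc : c ≠ 0)
    (hJ : A (Pi.single 1 1) * B (Pi.single 2 1) - A (Pi.single 2 1) * B (Pi.single 1 1) ≠ 0)
    {v : Base} (hv : (![c * v 0, A v, B v] : Base) = 0) : v = 0 := by
  have h0 : c * v 0 = 0 := congrFun hv 0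
  have h1 : A v = 0 := congrFun hv 1
  have h2 : B v = 0 := congrFun hv 2
  have hv0 : v 0 = 0 := (mul_eq_zero.1 h0).resolve_left hc
  rw [fderiv_eq_sum, Fin.sum_univ_three, hv0] at h1 h2
  have hv1 : v 1 = 0 := by
    refine (mul_eq_zero.1 (?_ : v 1 * _ = 0)).resolve_right hJ
    linear_combination B (Pi.single 2 1) * h1 - A (Pi.single 2 1) * h2
  have hv2 : v 2 = 0 := by
    refine (mul_eq_zero.1 (?_ : v 2 * _ = 0)).resolve_right hJ
    linear_combination A (Pi.single 1 1) * h2 - B (Pi.single 1 1) * h1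
  funext i
  fin_cases i
  · exact hv0
  · exact hv1
  · exact hv2

namespace EquivTransf

variable (Φ : EquivTransf)

theorem contDiffAt_X {b : Base} (hb : b ∈ Φ.source) : ContDiffAt ℝ ∞ Φ.X b :=
  Φ.smooth_X.contDiffAt (Φ.isOpen_source.mem_nhds hb)

theorem contDiffAt_U {b : Base} (hb : b ∈ Φ.source) : ContDiffAt ℝ ∞ Φ.U b :=
  Φ.smooth_U.contDiffAt (Φ.isOpen_source.mem_nhds hb)

theorem contDiffAt_T {b : Base} (hb : b ∈ Φ.source) : ContDiffAt ℝ ∞ Φ.T (b 0) :=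
  Φ.smooth_T.contDiffAt ((isOpenMap_eval (0 : Fin 3) _ Φ.isOpen_source).mem_nhds ⟨b, hb, rfl⟩)

theorem hasDerivAt_T {b : Base} (hb : b ∈ Φ.source) : HasDerivAt Φ.T (deriv Φ.T (b 0)) (b 0) :=
  ((Φ.contDiffAt_T hb).differentiableAt (by simp)).hasDerivAt

theorem fderiv_toFun {b : Base} (hb : b ∈ Φ.source) (v : Base) :
    fderiv ℝ Φ.toFun b v = ![deriv Φ.T (b 0) * v 0, fderiv ℝ Φ.X b v, fderiv ℝ Φ.U b v] :=
  fderiv_triangular (Φ.hasDerivAt_T hb) ((Φ.contDiffAt_X hb).differentiableAt (by simp))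
    ((Φ.contDiffAt_U hb).differentiableAt (by simp)) v

/-- `X` as a function of jets. -/
def XJet (z : Jet3) : ℝ := Φ.X z.base

/-- The derivatives `∂_x'^k u'` as functions of jets. -/
def prJet : ℕ → Jet3 → ℝ
  | 0 => fun z => Φ.U z.base
  | k + 1 => fun z => totD (prJet k) z / totD Φ.XJet z

/-- The jets at which the transformation can be prolonged. -/
def prDom : Set Jet3 := {z | z.base ∈ Φ.source ∧ totD Φ.XJet z ≠ 0}

/-- The prolonged transformation. -/
def prMap (z : Jet3) : Jet3 :=
  ![Φ.T (z 0), Φ.X z.base, Φ.U z.base, Φ.prJet 1 z, Φ.prJet 2 z, Φ.prJet 3 z]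

/-- The derivative `∂_x'^4 u'` as a function of a jet and of `u_xxxx`. -/
def prFour (z : Jet3) (a : ℝ) : ℝ :=
  (totD (Φ.prJet 3) z + a * pd (Pi.single 5 1) (Φ.prJet 3) z) / totD Φ.XJet z

/-- The factor `∂u'/∂u` at constant `t'`, `x'` along a function with a given jet. -/
def prVert (z : Jet3) : ℝ :=
  fderiv ℝ Φ.U z.base (Pi.single 2 1) - Φ.prJet 1 z * fderiv ℝ Φ.X z.base (Pi.single 2 1)

/-- The derivative `∂u'/∂t'` as a function of a jet and of `u_t`. -/
def prTime (z : Jet3) (m : ℝ) : ℝ :=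
  (fderiv ℝ Φ.U z.base (Pi.single 0 1) - Φ.prJet 1 z * fderiv ℝ Φ.X z.base (Pi.single 0 1)
    + Φ.prVert z * m) / deriv Φ.T (z 0)

theorem hasOrder_XJet : HasOrder 0 Φ.XJet (Jet3.base ⁻¹' Φ.source) :=
  HasOrder.comp_base Φ.smooth_X Φ.isOpen_source

theorem isOpen_over : IsOpen (Jet3.base ⁻¹' Φ.source) := Φ.isOpen_source.preimage continuous_base

theorem prDom_subset : Φ.prDom ⊆ Jet3.base ⁻¹' Φ.source := fun _ hz => hz.1

theorem hasOrder_totD_XJet : HasOrder 1 (totD Φ.XJet) (Jet3.base ⁻¹' Φ.source) :=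
  Φ.hasOrder_XJet.totD Φ.isOpen_over (by omega)

theorem isOpen_prDom : IsOpen Φ.prDom :=
  Φ.hasOrder_totD_XJet.1.continuousOn.isOpen_inter_preimage Φ.isOpen_over isOpen_ne

theorem hasOrder_prJet {k : ℕ} (hk : k ≤ 3) : HasOrder k (Φ.prJet k) Φ.prDom := by
  induction k with
  | zero => exact (HasOrder.comp_base Φ.smooth_U Φ.isOpen_source).mono Φ.prDom_subset
  | succ k ih =>
    exact ((ih (by omega)).totD Φ.isOpen_prDom (by omega)).div
      ((Φ.hasOrder_totD_XJet.mono Φ.prDom_subset).of_le (by omega)) Φ.isOpen_prDom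
      fun z hz => hz.2

theorem totD_comp_base {f : Base → ℝ} {z : Jet3} (hf : DifferentiableAt ℝ f z.base) :
    totD (fun z => f z.base) z = fderiv ℝ f z.base (Pi.single 1 1)
      + z 3 * fderiv ℝ f z.base (Pi.single 2 1) := by
  rw [totD, fderiv_fun_comp z hf (hasFDerivAt_base z).differentiableAt, (hasFDerivAt_base z).fderiv,
    ← smul_eq_mul, ← map_smul, ← map_add, ContinuousLinearMap.comp_apply, coe_baseL]
  congr 1
  funext j
  fin_cases j <;> simp [Jet3.base, jetVec]

theorem totD_XJet {z : Jet3} (hz : z.base ∈ Φ.source) :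
    totD Φ.XJet z = fderiv ℝ Φ.X z.base (Pi.single 1 1)
      + z 3 * fderiv ℝ Φ.X z.base (Pi.single 2 1) :=
  totD_comp_base ((Φ.contDiffAt_X hz).differentiableAt (by simp))

theorem totD_prJet_zero {z : Jet3} (hz : z.base ∈ Φ.source) :
    totD (Φ.prJet 0) z = fderiv ℝ Φ.U z.base (Pi.single 1 1)
      + z 3 * fderiv ℝ Φ.U z.base (Pi.single 2 1) :=
  totD_comp_base ((Φ.contDiffAt_U hz).differentiableAt (by simp))

theorem prJet_one {z : Jet3} (hz : z ∈ Φ.prDom) :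
    Φ.prJet 1 z * (fderiv ℝ Φ.X z.base (Pi.single 1 1)
      + z 3 * fderiv ℝ Φ.X z.base (Pi.single 2 1)) = fderiv ℝ Φ.U z.base (Pi.single 1 1)
      + z 3 * fderiv ℝ Φ.U z.base (Pi.single 2 1) := by
  rw [← Φ.totD_XJet hz.1, ← Φ.totD_prJet_zero hz.1]
  exact div_mul_cancel₀ _ hz.2

/-- Eliminating the new first derivative turns the product into the Jacobian ∂(X, U)/∂(x, u). This
is why the vertical factor cannot vanish. -/
theorem prVert_mul {z : Jet3} (hz : z ∈ Φ.prDom) :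
    Φ.prVert z * totD Φ.XJet z = fderiv ℝ Φ.X z.base (Pi.single 1 1)
        * fderiv ℝ Φ.U z.base (Pi.single 2 1)
      - fderiv ℝ Φ.X z.base (Pi.single 2 1) * fderiv ℝ Φ.U z.base (Pi.single 1 1) := by
  have h := Φ.prJet_one hz
  rw [prVert, Φ.totD_XJet hz.1]
  linear_combination -fderiv ℝ Φ.X z.base (Pi.single 2 1) * h

theorem prVert_ne_zero {z : Jet3} (hz : z ∈ Φ.prDom) : Φ.prVert z ≠ 0 := by
  have h := Φ.jacobian_ne_zero _ hz.1
  rw [← Φ.prVert_mul hz] at h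
  exact left_ne_zero_of_mul h

/-- The action on the independent variables along a family. -/
def newFam (w : ℝ × (ℝ × ℝ) → ℝ) (p : ℝ × (ℝ × ℝ)) : ℝ × (ℝ × ℝ) :=
  (p.1, (Φ.T p.2.1, Φ.X (famPt w p)))

variable {Φ}

theorem newFam_eq_newPt (w : ℝ × (ℝ × ℝ) → ℝ) (p : ℝ × (ℝ × ℝ)) :
    Φ.newFam w p = (p.1, Φ.newPt (fun r => w (p.1, r)) p.2) := rfl

theorem contDiffAt_newFam {w : ℝ × (ℝ × ℝ) → ℝ} {p : ℝ × (ℝ × ℝ)} (hw : ContDiffAt ℝ ∞ w p)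
    (hp : famPt w p ∈ Φ.source) : ContDiffAt ℝ ∞ (Φ.newFam w) p :=
  contDiffAt_fst.prodMk (((Φ.contDiffAt_T hp).comp (f := fun p : ℝ × (ℝ × ℝ) => p.2.1) p
    (contDiffAt_fst.comp p contDiffAt_snd)).prodMk
      ((Φ.contDiffAt_X hp).comp p (contDiffAt_famPt hw)))

theorem fderiv_newFam {w : ℝ × (ℝ × ℝ) → ℝ} {p : ℝ × (ℝ × ℝ)} (hw : DifferentiableAt ℝ w p)
    (hp : famPt w p ∈ Φ.source) (a : ℝ × (ℝ × ℝ)) :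
    DifferentiableAt ℝ (Φ.newFam w) p ∧ fderiv ℝ (Φ.newFam w) p a
      = (a.1, (deriv Φ.T p.2.1 * a.2.1, pd a (fun p => Φ.X (famPt w p)) p)) := by
  have hT : HasFDerivAt (fun p : ℝ × (ℝ × ℝ) => Φ.T p.2.1) (deriv Φ.T p.2.1 • famT) p :=
    (Φ.hasDerivAt_T hp).comp_hasFDerivAt p famT.hasFDerivAt
  have hg : DifferentiableAt ℝ (famPt w) p := by
    refine differentiableAt_pi.2 fun i => ?_
    fin_cases i
    · exact famT.differentiableAt
    · exact famX.differentiableAt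
    · exact hw
  have hX : DifferentiableAt ℝ (fun p => Φ.X (famPt w p)) p :=
    ((Φ.contDiffAt_X hp).differentiableAt (by simp)).comp p hg
  have h : HasFDerivAt (Φ.newFam w) _ p := hasFDerivAt_fst.prodMk (hT.prodMk hX.hasFDerivAt)
  refine ⟨h.differentiableAt, ?_⟩
  rw [h.fderiv]
  rfl

theorem pd_comp_newFam {w : ℝ × (ℝ × ℝ) → ℝ} {p : ℝ × (ℝ × ℝ)} (hw : DifferentiableAt ℝ w p)
    (hp : famPt w p ∈ Φ.source) {f : ℝ × (ℝ × ℝ) → ℝ}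
    (hf : DifferentiableAt ℝ f (Φ.newFam w p)) (a : ℝ × (ℝ × ℝ)) :
    pd a (fun p => f (Φ.newFam w p)) p = a.1 * pd dirE f (Φ.newFam w p)
      + deriv Φ.T p.2.1 * a.2.1 * pd dirT f (Φ.newFam w p)
      + pd a (fun p => Φ.X (famPt w p)) p * pd dirX f (Φ.newFam w p) := by
  obtain ⟨h1, h2⟩ := fderiv_newFam hw hp a
  rw [pd, fderiv_fun_comp p hf h1, ContinuousLinearMap.comp_apply, h2, fderiv_fam_apply]

theorem pd_comp_famPt {w : ℝ × (ℝ × ℝ) → ℝ} {p : ℝ × (ℝ × ℝ)} (hw : DifferentiableAt ℝ w p)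
    {f : Base → ℝ} (hf : DifferentiableAt ℝ f (famPt w p)) (a : ℝ × (ℝ × ℝ)) :
    pd a (fun p => f (famPt w p)) p = a.2.1 * fderiv ℝ f (famPt w p) (Pi.single 0 1)
      + a.2.2 * fderiv ℝ f (famPt w p) (Pi.single 1 1)
      + pd a w p * fderiv ℝ f (famPt w p) (Pi.single 2 1) := by
  refine (pd_comp_gbase famT famX hw hf a).trans ?_
  simp only [← smul_eq_mul, ← map_smul, ← map_add]
  congr 1
  funext j
  fin_cases j <;> simp [famT, famX]

/-- The transformation carries the family `w` into the family `v`, near `p₀`. -/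
structure IsImage (Φ : EquivTransf) (w v : ℝ × (ℝ × ℝ) → ℝ) (p₀ : ℝ × (ℝ × ℝ)) : Prop where
  left : ContDiffAt ℝ ∞ w p₀
  mem : famPt w p₀ ∈ Φ.source
  right : ContDiffAt ℝ ∞ v (Φ.newFam w p₀)
  eq : ∀ᶠ p in 𝓝 p₀, v (Φ.newFam w p) = Φ.U (famPt w p)

theorem eventually_mem_source {w : ℝ × (ℝ × ℝ) → ℝ} {p₀ : ℝ × (ℝ × ℝ)}
    (hw : ContDiffAt ℝ ∞ w p₀) (hp : famPt w p₀ ∈ Φ.source) :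
    ∀ᶠ p in 𝓝 p₀, famPt w p ∈ Φ.source :=
  (contDiffAt_famPt hw).continuousAt.eventually (Φ.isOpen_source.mem_nhds hp)

theorem eventually_pd_X {w : ℝ × (ℝ × ℝ) → ℝ} {p₀ : ℝ × (ℝ × ℝ)}
    (hw : ContDiffAt ℝ ∞ w p₀) (hp : famPt w p₀ ∈ Φ.source) :
    ∀ᶠ p in 𝓝 p₀, pd dirX (fun p => Φ.X (famPt w p)) p = totD Φ.XJet (famJet w p) :=
  pd_comp_gjet_of_hasOrder famT famX (e := dirX) rfl rfl hw Φ.isOpen_over (by omega)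
    Φ.hasOrder_XJet hp

/-! ### Prolongation formulas along families. -/

namespace IsImage

variable {w v : ℝ × (ℝ × ℝ) → ℝ} {p₀ : ℝ × (ℝ × ℝ)}

theorem eventually_newFam (h : IsImage Φ w v p₀) {P : ℝ × (ℝ × ℝ) → Prop}
    (hP : ∀ᶠ p in 𝓝 (Φ.newFam w p₀), P p) : ∀ᶠ p in 𝓝 p₀, P (Φ.newFam w p) :=
  (contDiffAt_newFam h.left h.mem).continuousAt.eventually hP

/-- If D_x X = 0, differentiating the defining relation of the image in x gives D_x U = 0 too. Then
(1, u_x) lies in the kernel of ∂(X, U)/∂(x, u), which is invertible. -/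
theorem mem_prDom (h : IsImage Φ w v p₀) : famJet w p₀ ∈ Φ.prDom := by
  refine ⟨h.mem, fun h0 => ?_⟩
  have hw := h.left.differentiableAt (by simp)
  have h1 := (pd_congr (a := dirX) h.eq).self_of_nhds
  have hb : (famJet w p₀).base = famPt w p₀ := rfl
  have hm : (famJet w p₀).base ∈ Φ.source := h.mem
  rw [pd_comp_newFam hw h.mem (h.right.differentiableAt (by simp)),
    (eventually_pd_X h.left h.mem).self_of_nhds, h0,
    pd_comp_famPt hw ((Φ.contDiffAt_U h.mem).differentiableAt (by simp))] at h1
  have h2 : pd dirX w p₀ = famJet w p₀ 3 := rfl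
  rw [Φ.totD_XJet hm, hb] at h0
  simp only [dirX] at h1
  refine Φ.jacobian_ne_zero _ h.mem ?_
  rw [← h2] at h0
  simp only [dirX] at h0 h1 h2
  rw [h2] at h0 h1
  linear_combination fderiv ℝ Φ.U (famPt w p₀) (Pi.single 2 1) * h0
    + fderiv ℝ Φ.X (famPt w p₀) (Pi.single 2 1) * h1

theorem eventually_mem_prDom (h : IsImage Φ w v p₀) : ∀ᶠ p in 𝓝 p₀, famJet w p ∈ Φ.prDom :=
  (contDiffAt_famJet h.left).continuousAt.eventually (Φ.isOpen_prDom.mem_nhds h.mem_prDom)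

/-- Differentiating the previous relation in x gives ∂_{x'}^{k+1} u' · D_x X on one side and a total
derivative on the other; division by D_x X is the recursion of the prolongation. -/
theorem iterate_pd (h : IsImage Φ w v p₀) {k : ℕ} (hk : k ≤ 3) :
    ∀ᶠ p in 𝓝 p₀, (pd dirX)^[k] v (Φ.newFam w p) = Φ.prJet k (famJet w p) := by
  induction k with
  | zero => exact h.eq
  | succ k ih =>
    have hv := h.eventually_newFam
      (eventually_differentiableAt (contDiffAt_iterate_pd (a := dirX) h.right k))
    filter_upwards [pd_congr (a := dirX) (ih (by omega)), hv, eventually_differentiableAt h.left,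
      eventually_mem_source h.left h.mem, eventually_pd_X h.left h.mem,
      pd_comp_gjet_of_hasOrder famT famX (e := dirX) rfl rfl h.left Φ.isOpen_prDom (by omega)
        (Φ.hasOrder_prJet (k := k) (by omega)) h.mem_prDom, h.eventually_mem_prDom]
      with p h1 h2 h3 h4 h5 h6 h7
    rw [pd_comp_newFam h3 h4 h2, h5] at h1
    have h8 : pd dirX (fun p => Φ.prJet k (famJet w p)) p = totD (Φ.prJet k) (famJet w p) := h6
    rw [h8] at h1
    rw [Function.iterate_succ_apply', prJet, eq_div_iff h7.2]
    simp only [dirX] at h1 ⊢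
    linear_combination h1

theorem iterate_pd_four (h : IsImage Φ w v p₀) :
    ∀ᶠ p in 𝓝 p₀, (pd dirX)^[4] v (Φ.newFam w p)
      = Φ.prFour (famJet w p) ((pd dirX)^[4] w p) := by
  have hv := h.eventually_newFam
    (eventually_differentiableAt (contDiffAt_iterate_pd (a := dirX) h.right 3))
  have hev : ∀ᶠ z in 𝓝 (famJet w p₀), z ∈ Φ.prDom := Φ.isOpen_prDom.mem_nhds h.mem_prDom
  have hd : ∀ᶠ z in 𝓝 (famJet w p₀), DifferentiableAt ℝ (Φ.prJet 3) z := hev.mono fun z hz =>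
    (Φ.hasOrder_prJet le_rfl).differentiableAt Φ.isOpen_prDom hz
  filter_upwards [pd_congr (a := dirX) (h.iterate_pd le_rfl), hv,
    eventually_differentiableAt h.left, eventually_mem_source h.left h.mem,
    eventually_pd_X h.left h.mem, pd_comp_gjet famT famX (e := dirX) rfl rfl h.left hd,
    h.eventually_mem_prDom] with p h1 h2 h3 h4 h5 h6 h7
  rw [pd_comp_newFam h3 h4 h2, h5] at h1
  have h8 : pd dirX (fun p => Φ.prJet 3 (famJet w p)) p = totD (Φ.prJet 3) (famJet w p)
    + (pd dirX)^[4] w p * pd (Pi.single 5 1) (Φ.prJet 3) (famJet w p) := h6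
  rw [h8] at h1
  rw [Function.iterate_succ_apply', prFour, eq_div_iff h7.2]
  simp only [dirX] at h1 ⊢
  linear_combination h1

theorem famJet_eq (h : IsImage Φ w v p₀) :
    ∀ᶠ p in 𝓝 p₀, famJet v (Φ.newFam w p) = Φ.prMap (famJet w p) := by
  filter_upwards [h.iterate_pd (k := 0) (by omega), h.iterate_pd (k := 1) (by omega),
    h.iterate_pd (k := 2) (by omega), h.iterate_pd (k := 3) (by omega)] with p h0 h1 h2 h3
  have h0' : v (Φ.newFam w p) = Φ.U (famJet w p).base := h0
  have h1' : pd dirX v (Φ.newFam w p) = Φ.prJet 1 (famJet w p) := h1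
  have ht : famT (Φ.newFam w p) = Φ.T (famJet w p 0) := rfl
  have hx : famX (Φ.newFam w p) = Φ.X (famJet w p).base := rfl
  rw [famJet, gjet, prMap, h0', h1', h2, h3, ht, hx]

theorem pd_dirT (h : IsImage Φ w v p₀) :
    ∀ᶠ p in 𝓝 p₀, pd dirT v (Φ.newFam w p) = Φ.prTime (famJet w p) (pd dirT w p) := by
  filter_upwards [pd_congr (a := dirT) h.eq,
    h.eventually_newFam (eventually_differentiableAt h.right), eventually_differentiableAt h.left,
    eventually_mem_source h.left h.mem, h.iterate_pd (k := 1) (by omega)] with p h1 h2 h3 h4 h5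
  have hT := Φ.deriv_T_ne_zero _ h4
  rw [pd_comp_newFam h3 h4 h2, pd_comp_famPt h3 ((Φ.contDiffAt_X h4).differentiableAt (by simp)),
    pd_comp_famPt h3 ((Φ.contDiffAt_U h4).differentiableAt (by simp))] at h1
  have h5' : pd dirX v (Φ.newFam w p) = Φ.prJet 1 (famJet w p) := h5
  rw [h5'] at h1
  have ht : famJet w p 0 = p.2.1 := rfl
  have hT' : deriv Φ.T p.2.1 ≠ 0 := hT
  rw [prTime, prVert, base_famJet, ht, eq_div_iff hT']
  simp only [dirT] at h1 ⊢
  linear_combination h1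

/-- A change of the parameter also moves the new point x' by X_u w_ε. Correcting for this with the
slope of the image is what turns U_u into the vertical factor. -/
theorem pd_dirE (h : IsImage Φ w v p₀) :
    ∀ᶠ p in 𝓝 p₀, pd dirE v (Φ.newFam w p) = Φ.prVert (famJet w p) * pd dirE w p := by
  filter_upwards [pd_congr (a := dirE) h.eq,
    h.eventually_newFam (eventually_differentiableAt h.right), eventually_differentiableAt h.left,
    eventually_mem_source h.left h.mem, h.iterate_pd (k := 1) (by omega)] with p h1 h2 h3 h4 h5
  rw [pd_comp_newFam h3 h4 h2, pd_comp_famPt h3 ((Φ.contDiffAt_X h4).differentiableAt (by simp)),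
    pd_comp_famPt h3 ((Φ.contDiffAt_U h4).differentiableAt (by simp))] at h1
  have h5' : pd dirX v (Φ.newFam w p) = Φ.prJet 1 (famJet w p) := h5
  rw [h5'] at h1
  rw [prVert, base_famJet]
  simp only [dirE] at h1 ⊢
  linear_combination h1

end IsImage

/-- The change of the independent variables along a family is a local diffeomorphism. -/
theorem exists_hasStrictFDerivAt_newFam {w : ℝ × (ℝ × ℝ) → ℝ} {p₀ : ℝ × (ℝ × ℝ)}
    (hw : ContDiffAt ℝ ∞ w p₀) (hp : famJet w p₀ ∈ Φ.prDom) :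
    ∃ e : (ℝ × (ℝ × ℝ)) ≃L[ℝ] (ℝ × (ℝ × ℝ)),
      HasFDerivAt (Φ.newFam w) (e : (ℝ × (ℝ × ℝ)) →L[ℝ] (ℝ × (ℝ × ℝ))) p₀ := by
  have hm : famPt w p₀ ∈ Φ.source := hp.1
  obtain ⟨e, he⟩ := exists_equiv_of_injective (fderiv ℝ (Φ.newFam w) p₀) fun a ha => by
    rw [(fderiv_newFam (hw.differentiableAt (by simp)) hm a).2] at ha
    simp only [Prod.mk_eq_zero] at ha
    obtain ⟨h1, h2, h3⟩ := ha
    have h2' : a.2.1 = 0 := (mul_eq_zero.1 h2).resolve_left (Φ.deriv_T_ne_zero _ hm)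
    have ha' : a = a.2.2 • dirX := by
      ext <;> simp [h1, h2', dirX]
    have h4 : a.2.2 * totD Φ.XJet (famJet w p₀) = 0 := by
      rw [← (eventually_pd_X hw hm).self_of_nhds, ← h3, pd, pd]
      conv_rhs => rw [ha']
      rw [map_smul, smul_eq_mul]
    have h5 := (mul_eq_zero.1 h4).resolve_right hp.2
    rw [ha', h5, zero_smul]
  exact ⟨e, he ▸ (fderiv_newFam (hw.differentiableAt (by simp)) hm 0).1.hasFDerivAt⟩

/-- This transports statements that hold near a point between the old and the new independent
variables. -/
theorem map_newFam_nhds {w : ℝ × (ℝ × ℝ) → ℝ} {p₀ : ℝ × (ℝ × ℝ)}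
    (hw : ContDiffAt ℝ ∞ w p₀) (hp : famJet w p₀ ∈ Φ.prDom) :
    Filter.map (Φ.newFam w) (𝓝 p₀) = 𝓝 (Φ.newFam w p₀) := by
  obtain ⟨e, he⟩ := exists_hasStrictFDerivAt_newFam hw hp
  exact ((contDiffAt_newFam hw hp.1).hasStrictFDerivAt' he (by simp)).map_nhds_eq_of_equiv

/-- Every family with jets in the domain of the prolongation has an image. -/
theorem exists_isImage {w : ℝ × (ℝ × ℝ) → ℝ} {p₀ : ℝ × (ℝ × ℝ)}
    (hw : ContDiffAt ℝ ∞ w p₀) (hp : famJet w p₀ ∈ Φ.prDom) : ∃ v, IsImage Φ w v p₀ := by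
  obtain ⟨e, he⟩ := exists_hasStrictFDerivAt_newFam hw hp
  have hM := contDiffAt_newFam hw (show famPt w p₀ ∈ Φ.source from hp.1)
  set g := hM.localInverse he (by simp)
  have hg : ContDiffAt ℝ ∞ g (Φ.newFam w p₀) := hM.to_localInverse he (by simp)
  have hg0 : g (Φ.newFam w p₀) = p₀ := hM.localInverse_apply_image he (by simp)
  have hinv : ∀ᶠ p in 𝓝 p₀, g (Φ.newFam w p) = p :=
    (hM.hasStrictFDerivAt' he (by simp)).eventually_left_inverse
  refine ⟨fun p => Φ.U (famPt w (g p)), hw, hp.1, ?_, hinv.mono fun p h => by rw [h]⟩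
  have h1 : ContDiffAt ℝ ∞ (fun p => Φ.U (famPt w p)) p₀ :=
    (Φ.contDiffAt_U hp.1).comp p₀ (contDiffAt_famPt hw)
  exact ContDiffAt.comp (g := fun p => Φ.U (famPt w p)) _ (hg0.symm ▸ h1) hg

end EquivTransf

/-! ### Equivalence transformations of functions, equations and symmetries -/

namespace EquivTransf

variable {Φ : EquivTransf}

theorem contDiffAt_comp_snd {u : ℝ × ℝ → ℝ} {q : ℝ × ℝ} (hu : ContDiffAt ℝ ∞ u q) (a : ℝ) :
    ContDiffAt ℝ ∞ (fun p : ℝ × (ℝ × ℝ) => u p.2) (a, q) :=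
  ContDiffAt.comp (g := u) (a, q) hu contDiffAt_snd

namespace CarriesFun

variable {u v : ℝ × ℝ → ℝ} {q : ℝ × ℝ}

/-- A single function is treated as a family that does not depend on the parameter, so the formulas
for families apply to it. -/
theorem isImage (h : Φ.CarriesFun u v q) :
    IsImage Φ (fun p => u p.2) (fun p => v p.2) (0, q) where
  left := contDiffAt_comp_snd h.1 0
  mem := h.2.1
  right := contDiffAt_comp_snd h.2.2.1 0
  eq := by
    have : Filter.Tendsto (Prod.snd : ℝ × (ℝ × ℝ) → ℝ × ℝ) (𝓝 ((0 : ℝ), q)) (𝓝 q) :=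
      continuous_snd.continuousAt
    exact this.eventually h.2.2.2

theorem mem_prDom (h : Φ.CarriesFun u v q) : jet3 u q ∈ Φ.prDom := by
  have := h.isImage.mem_prDom
  rwa [← (jet3_slice h.isImage.left).self_of_nhds] at this

theorem jet3_eq (h : Φ.CarriesFun u v q) : jet3 v (Φ.newPt u q) = Φ.prMap (jet3 u q) := by
  have h1 := (jet3_slice h.isImage.left).self_of_nhds
  have h2 := (jet3_slice h.isImage.right).self_of_nhds
  have h3 := h.isImage.famJet_eq.self_of_nhds
  rw [← h1, ← h2] at h3
  exact h3

theorem Dx_four_eq (h : Φ.CarriesFun u v q) :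
    Dx^[4] v (Φ.newPt u q) = Φ.prFour (jet3 u q) (Dx^[4] u q) := by
  have h1 := (jet3_slice h.isImage.left).self_of_nhds
  have h2 := (iterate_Dx_slice h.isImage.left 4).self_of_nhds
  have h3 := (iterate_Dx_slice h.isImage.right 4).self_of_nhds
  have h4 := h.isImage.iterate_pd_four.self_of_nhds
  rw [← h1, ← h2, ← h3] at h4
  exact h4

theorem Dt_eq (h : Φ.CarriesFun u v q) :
    Dt v (Φ.newPt u q) = Φ.prTime (jet3 u q) (Dt u q) := by
  have h1 := (jet3_slice h.isImage.left).self_of_nhds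
  have h2 := (Dt_slice h.isImage.left).self_of_nhds
  have h3 := (Dt_slice h.isImage.right).self_of_nhds
  have h4 := h.isImage.pd_dirT.self_of_nhds
  rw [← h1, ← h2, ← h3] at h4
  exact h4

end CarriesFun

theorem IsImage.carriesFun_slice {w v : ℝ × (ℝ × ℝ) → ℝ} {q : ℝ × ℝ}
    (h : IsImage Φ w v (0, q)) : Φ.CarriesFun (fun r => w (0, r)) (fun r => v (0, r)) q :=
  ⟨contDiffAt_slice h.left, h.mem, contDiffAt_slice h.right, IsVariation.eventually_slice h.eq⟩

/-- Every function with jet in the domain of the prolongation has an image. -/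
theorem exists_carriesFun {u : ℝ × ℝ → ℝ} {q : ℝ × ℝ} (hu : ContDiffAt ℝ ∞ u q)
    (hq : jet3 u q ∈ Φ.prDom) : ∃ v, Φ.CarriesFun u v q := by
  have hw := contDiffAt_comp_snd hu 0
  obtain ⟨v, hv⟩ := exists_isImage (Φ := Φ) hw (by
    rw [← (jet3_slice hw).self_of_nhds]; exact hq)
  exact ⟨_, hv.carriesFun_slice⟩

/-- The equations correspond to each other on the level of jets. -/
def Relates (Φ : EquivTransf) (E E' : EvolEq) : Prop :=
  ∀ z ∈ E.dom, z ∈ Φ.prDom ∧ Φ.prMap z ∈ E'.dom ∧ ∀ m a, Φ.prTime z m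
    - E'.F (Φ.prMap z) * Φ.prFour z a - E'.G (Φ.prMap z)
      = Φ.prVert z / deriv Φ.T (z 0) * (m - E.F z * a - E.G z)

/-- The hypothesis speaks only of functions satisfying the equations. For every u_xxxx it makes the
new defect vanish at u_t = F u_xxxx + G, and the new defect is affine in u_t with slope the vertical
factor over T', so it is that multiple of the old defect. -/
theorem CarriesEq.relates {E E' : EvolEq} (h : Φ.CarriesEq E E') : Φ.Relates E E' := by
  intro z hz
  have hmem : z ∈ Φ.prDom ∧ Φ.prMap z ∈ E'.dom := by
    obtain ⟨z', hz', u, v, q, huv, rfl, rfl⟩ := h.1 z hz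
    exact ⟨huv.mem_prDom, huv.jet3_eq ▸ hz'⟩
  refine ⟨hmem.1, hmem.2, fun m a => ?_⟩
  obtain ⟨u, hu, hj, h4, hm⟩ := exists_jet z a (fun _ => E.F z * a + E.G z)
  obtain ⟨v, huv⟩ := exists_carriesFun (Φ := Φ) hu.contDiffAt (hj.symm ▸ hmem.1)
  have hjv := huv.jet3_eq
  have h0 := (h.2.2 u v _ huv (hj.symm ▸ hz) (by rw [hjv, hj]; exact hmem.2)).1
    (by rw [EvolEq.HoldsAt, hj, h4]; exact hm 0 (by omega))
  have hm0 : Dt u (z 0, z 1) = E.F z * a + E.G z := hm 0 (by omega)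
  rw [EvolEq.HoldsAt, hjv, huv.Dx_four_eq, huv.Dt_eq, hj, h4, hm0] at h0
  have hT := Φ.deriv_T_ne_zero _ hmem.1.1
  have hT' : deriv Φ.T (z 0) ≠ 0 := hT
  have h1 : Φ.prTime z m = Φ.prTime z (E.F z * a + E.G z)
      + Φ.prVert z / deriv Φ.T (z 0) * (m - E.F z * a - E.G z) := by
    simp only [prTime]
    field_simp
    ring
  rw [h1, h0]
  ring

theorem toFun_graphPt {u v : ℝ × ℝ → ℝ} {r : ℝ × ℝ}
    (h : v (Φ.newPt u r) = Φ.U (graphPt u r)) :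
    graphPt v (Φ.newPt u r) = Φ.toFun (graphPt u r) := by
  simp only [graphPt, toFun, newPt] at h ⊢
  rw [h]
  rfl

/-- The image of a variation is a variation. -/
theorem IsImage.isVariation {V V' : Base → Base} {u : ℝ × ℝ → ℝ} {q : ℝ × ℝ}
    {w v : ℝ × (ℝ × ℝ) → ℝ} (h : IsImage Φ w v (0, q)) (hw : IsVariation V u q w)
    (hV' : ContDiffAt ℝ ∞ V' (Φ.toFun (graphPt u q)))
    (hc : ∀ᶠ b in 𝓝 (graphPt u q), fderiv ℝ Φ.toFun b (V b) = V' (Φ.toFun b)) :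
    IsVariation V' (fun r => v (0, r)) (Φ.newPt u q) v := by
  have hwu : (fun r => w (0, r)) = u := funext hw.slice
  have hnew : ∀ r, Φ.newFam w (0, r) = (0, Φ.newPt u r) := fun r => by
    rw [newFam_eq_newPt]; simp only [hwu]
  have hpt : ∀ r, famPt w (0, r) = graphPt u r := fun r => by
    rw [famPt_eq_graphPt]; simp only [hwu]
  have hu := hw.contDiffAt_slice
  have hmem : graphPt u q ∈ Φ.source := hpt q ▸ h.mem
  have hright := h.right
  rw [hnew] at hright
  refine ⟨hright, ?_, fun r => rfl, ?_⟩
  · have h0 := h.eq.self_of_nhds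
    rw [hnew, hpt] at h0
    rw [toFun_graphPt (v := fun r => v (0, r)) h0]
    exact hV'
  · suffices hs : ∀ᶠ p in 𝓝 ((0 : ℝ), q), (Φ.newFam w p).1 = 0 → pd dirE v (Φ.newFam w p)
        = characteristic V' (fun r => v (0, r)) (Φ.newFam w p).2 by
      have h1 : ∀ᶠ p in 𝓝 (Φ.newFam w (0, q)), p.1 = 0 →
          pd dirE v p = characteristic V' (fun r => v (0, r)) p.2 := by
        rw [← map_newFam_nhds h.left h.mem_prDom]
        exact hs
      rw [hnew] at h1
      exact (IsVariation.eventually_slice h1).mono fun r hr => hr rfl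
    filter_upwards [h.pd_dirE, h.pd_dirT, h.iterate_pd (k := 1) (by omega),
      h.eventually_newFam (Dt_slice h.right), h.eventually_newFam (iterate_Dx_slice h.right 1),
      continuous_snd.continuousAt.eventually hw.velocity, h.eventually_mem_prDom, h.eq,
      Dt_slice h.left, jet3_slice h.left,
      continuous_snd.continuousAt.eventually
        ((contDiffAt_graphPt hu).continuousAt.eventually hc)]
      with p e1 e2 e3 e4 e5 e6 e7 e8 e9 e10 e11 hp0
    obtain ⟨ε, r⟩ := p
    have hε : ε = 0 := hp0
    subst hε
    rw [hnew] at e1 e2 e3 e4 e5 e8 ⊢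
    rw [hpt] at e8
    simp only [hwu] at e9 e10
    have hgr := toFun_graphPt (v := fun r => v (0, r)) e8
    rw [← e10] at e1 e2 e3 e7
    have e5' : Dx (fun r => v (0, r)) (Φ.newPt u r) = Φ.prJet 1 (jet3 u r) := e5.trans e3
    have e6' : pd dirE w (0, r) = characteristic V u r := e6
    have e4' : Dt (fun r => v (0, r)) (Φ.newPt u r) = Φ.prTime (jet3 u r) (Dt u r) := by
      rw [e9, ← e2]; exact e4
    have hsrc : graphPt u r ∈ Φ.source := e7.1
    have e11' : V' (Φ.toFun (graphPt u r)) = _ := (e11.symm).trans (Φ.fderiv_toFun hsrc _)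
    have hT : deriv Φ.T (jet3 u r 0) ≠ 0 := Φ.deriv_T_ne_zero _ hsrc
    have hpr := Φ.prJet_one e7
    have hsum : ∀ f : Base → ℝ, fderiv ℝ f (graphPt u r) (V (graphPt u r))
        = V (graphPt u r) 0 * fderiv ℝ f (graphPt u r) (Pi.single 0 1)
          + V (graphPt u r) 1 * fderiv ℝ f (graphPt u r) (Pi.single 1 1)
          + V (graphPt u r) 2 * fderiv ℝ f (graphPt u r) (Pi.single 2 1) := fun f => by
      rw [fderiv_eq_sum, Fin.sum_univ_three]
    have c0 : V' (Φ.toFun (graphPt u r)) 0 = deriv Φ.T (jet3 u r 0) * V (graphPt u r) 0 := by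
      rw [e11']; rfl
    have c1 : V' (Φ.toFun (graphPt u r)) 1
        = V (graphPt u r) 0 * fderiv ℝ Φ.X (graphPt u r) (Pi.single 0 1)
          + V (graphPt u r) 1 * fderiv ℝ Φ.X (graphPt u r) (Pi.single 1 1)
          + V (graphPt u r) 2 * fderiv ℝ Φ.X (graphPt u r) (Pi.single 2 1) := by
      rw [e11']; exact hsum Φ.X
    have c2 : V' (Φ.toFun (graphPt u r)) 2
        = V (graphPt u r) 0 * fderiv ℝ Φ.U (graphPt u r) (Pi.single 0 1)
          + V (graphPt u r) 1 * fderiv ℝ Φ.U (graphPt u r) (Pi.single 1 1)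
          + V (graphPt u r) 2 * fderiv ℝ Φ.U (graphPt u r) (Pi.single 2 1) := by
      rw [e11']; exact hsum Φ.U
    have hx : Dx u r = jet3 u r 3 := rfl
    simp only [characteristic, along] at e6' ⊢
    rw [e1, e6', hgr, c0, c1, c2, e5', e4', hx]
    have hT2 : deriv Φ.T (jet3 u r 0) * V (graphPt u r) 0 * Φ.prTime (jet3 u r) (Dt u r)
        = V (graphPt u r) 0 * (fderiv ℝ Φ.U (graphPt u r) (Pi.single 0 1)
          - Φ.prJet 1 (jet3 u r) * fderiv ℝ Φ.X (graphPt u r) (Pi.single 0 1)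
          + Φ.prVert (jet3 u r) * Dt u r) := by
      rw [prTime, base_jet3]
      field_simp
    rw [hT2, prVert, base_jet3]
    rw [base_jet3] at hpr
    -- The terms with τ and η match directly. The terms with ξ match by the relation u'_{x'} D_x X =
    -- D_x U.
    linear_combination V (graphPt u r) 1 * hpr

/-- At a zero of `g` the product rule needs only continuity of the other factor, so the conversion
factor of the defect need not be differentiated. -/
theorem hasDerivAt_mul_of_continuousAt {A g : ℝ → ℝ} {g' : ℝ} (hA : ContinuousAt A 0)
    (hg : HasDerivAt g g' 0) (h0 : g 0 = 0) : HasDerivAt (fun ε => A ε * g ε) (A 0 * g') 0 := by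
  rw [hasDerivAt_iff_tendsto_slope] at hg ⊢
  have h1 := (hA.tendsto.mono_left nhdsWithin_le_nhds : Filter.Tendsto A (𝓝[≠] 0) _).mul hg
  refine h1.congr fun ε => ?_
  simp only [slope_def_field, h0, mul_zero, sub_zero]
  ring

theorem continuousAt_prVert_div {z : Jet3} (hz : z ∈ Φ.prDom) :
    ContinuousAt (fun z => Φ.prVert z / deriv Φ.T (z 0)) z := by
  have h1 : ∀ f : Base → ℝ, ContDiffAt ℝ ∞ f z.base →
      ContinuousAt (fun z : Jet3 => fderiv ℝ f z.base (Pi.single 2 1)) z := fun f hf => by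
    have : ContinuousAt (fun p => fderiv ℝ f p (Pi.single 2 1)) z.base :=
      (hf.fderiv_right (m := ∞) (by simp)).continuousAt.clm_apply continuousAt_const
    exact ContinuousAt.comp (f := Jet3.base) this continuous_base.continuousAt
  have h2 : ContinuousAt (Φ.prJet 1) z :=
    ((Φ.hasOrder_prJet (k := 1) (by omega)).contDiffAt Φ.isOpen_prDom hz).continuousAt
  have h3 : ContinuousAt (deriv Φ.T) (z 0) := by
    have := ((Φ.contDiffAt_T hz.1).fderiv_right (m := ∞) (by simp)).continuousAt.clm_apply
      (continuousAt_const (y := (1 : ℝ)))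
    exact this
  have h4 : ContinuousAt (fun z : Jet3 => deriv Φ.T (z 0)) z :=
    ContinuousAt.comp (f := fun z : Jet3 => z 0) h3 (continuous_apply 0).continuousAt
  exact ((h1 _ (Φ.contDiffAt_U hz.1)).sub (h2.mul (h1 _ (Φ.contDiffAt_X hz.1)))).div h4
    (Φ.deriv_T_ne_zero _ hz.1)

/-- Lie's criterion is equivariant under equivalence transformations. -/
theorem Relates.lieExpr_eq {E E' : EvolEq} (hE : Φ.Relates E E') {V V' : Base → Base}
    {u : ℝ × ℝ → ℝ} {q : ℝ × ℝ} (hu : ContDiffAt ℝ ∞ u q) (hq : jet3 u q ∈ E.dom)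
    (hV : ContDiffAt ℝ ∞ V (graphPt u q)) (hV' : ContDiffAt ℝ ∞ V' (Φ.toFun (graphPt u q)))
    (hc : ∀ᶠ b in 𝓝 (graphPt u q), fderiv ℝ Φ.toFun b (V b) = V' (Φ.toFun b))
    (hhold : E.HoldsAt u q) :
    ∃ v, Φ.CarriesFun u v q ∧ lieExpr E' V' v (Φ.newPt u q)
      = Φ.prVert (jet3 u q) / deriv Φ.T (jet3 u q 0) * lieExpr E V u q := by
  -- The simplest variation with the required velocity: affine in the parameter.
  set w : ℝ × (ℝ × ℝ) → ℝ := fun p => u p.2 + p.1 * characteristic V u p.2 with hw_def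
  have hQ := contDiffAt_characteristic hu hV
  have hw : ContDiffAt ℝ ∞ w (0, q) :=
    (contDiffAt_comp_snd hu 0).add (contDiffAt_fst.mul (contDiffAt_comp_snd hQ 0))
  have hvar : IsVariation V u q w := by
    refine ⟨hw, hV, fun r => by simp [hw_def], ?_⟩
    filter_upwards [eventually_differentiableAt hu, eventually_differentiableAt hQ] with r h1 h2
    have d1 : HasFDerivAt (fun p : ℝ × (ℝ × ℝ) => u p.2) _ (0, r) :=
      HasFDerivAt.comp (g := u) ((0 : ℝ), r) h1.hasFDerivAt hasFDerivAt_snd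
    have d2 : HasFDerivAt (fun p : ℝ × (ℝ × ℝ) => characteristic V u p.2) _ (0, r) :=
      HasFDerivAt.comp (g := characteristic V u) ((0 : ℝ), r) h2.hasFDerivAt hasFDerivAt_snd
    have d3 : HasFDerivAt w _ (0, r) := d1.add (hasFDerivAt_fst.mul d2)
    rw [pd, d3.fderiv]
    simp [dirE]
    exact map_zero _
  have hj := hvar.famJet_zero
  obtain ⟨v, hv⟩ := exists_isImage (Φ := Φ) hw (by rw [hj]; exact (hE _ hq).1)
  have hwu : (fun r => w (0, r)) = u := funext hvar.slice
  have hcf := hv.carriesFun_slice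
  rw [hwu] at hcf
  refine ⟨_, hcf, ?_⟩
  have hvar' := hv.isVariation hvar hV' hc
  set τ := along V 0 u q
  set ξ := along V 1 u q
  set c : ℝ → ℝ × ℝ := fun ε => q + ε • (τ, ξ) with hc_def
  have hc0 : c 0 = q := by simp [hc_def]
  have hcd : HasDerivAt c (τ, ξ) 0 := by
    exact (((hasDerivAt_id (0 : ℝ)).smul_const (τ, ξ)).const_add q).congr_deriv (by simp)
  -- The image of the straight line `c`. Its velocity consists of the first two components of the
  -- transformed field, so both defects are differentiated along corresponding points.
  set c' : ℝ → ℝ × ℝ := fun ε => (Φ.newFam w (ε, c ε)).2 with hc'_def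
  have hnew : ∀ ε, Φ.newFam w (ε, c ε) = (ε, c' ε) := fun ε => rfl
  have hc'0 : c' 0 = Φ.newPt u q := by
    simp only [hc'_def, hc0, newFam_eq_newPt, hwu]
  have hmem := hcf.2.1
  have hpt0 : famPt w (0, c 0) = graphPt u q := by
    rw [hc0, famPt_eq_graphPt]; simp only [hwu]
  have hptd : HasDerivAt (fun ε => famPt w (ε, c ε)) (V (graphPt u q)) 0 := by
    have hcd1 : HasDerivAt (fun ε => (c ε).1) τ 0 := hcd.fst
    have hcd2 : HasDerivAt (fun ε => (c ε).2) ξ 0 := hcd.snd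
    have hcd3 := hvar.hasDerivAt_etaX hc0 hcd 0
    refine hasDerivAt_pi.2 fun i => ?_
    fin_cases i
    · exact hcd1
    · exact hcd2
    · exact hcd3
  have hchar := hc.self_of_nhds
  rw [Φ.fderiv_toFun hmem] at hchar
  have hgr : graphPt (fun r => v (0, r)) (Φ.newPt u q) = Φ.toFun (graphPt u q) :=
    toFun_graphPt hcf.2.2.2.self_of_nhds
  have hc'd : HasDerivAt c' (along V' 0 (fun r => v (0, r)) (Φ.newPt u q),
      along V' 1 (fun r => v (0, r)) (Φ.newPt u q)) 0 := by
    have hT : HasDerivAt Φ.T (deriv Φ.T (graphPt u q 0)) (c 0).1 := by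
      have := Φ.hasDerivAt_T hmem
      rw [hc0]; exact this
    have h1 : HasDerivAt (fun ε => Φ.T (c ε).1) _ 0 := hT.comp (0 : ℝ) hcd.fst
    have hX : HasFDerivAt Φ.X (fderiv ℝ Φ.X (graphPt u q)) (famPt w (0, c 0)) := by
      rw [hpt0]; exact ((Φ.contDiffAt_X hmem).differentiableAt (by simp)).hasFDerivAt
    have h2 : HasDerivAt (fun ε => Φ.X (famPt w (ε, c ε))) _ 0 := hX.comp_hasDerivAt (0 : ℝ) hptd
    refine (h1.prodMk h2).congr_deriv ?_
    simp only [along]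
    rw [hgr, ← hchar]
    rfl
  have hjv : jet3 (fun r => v (0, r)) (Φ.newPt u q) ∈ E'.dom := by
    rw [hcf.jet3_eq]; exact (hE _ hq).2.1
  have hD' := hvar'.hasDerivAt_defect hc'0 hc'd hjv
  have hD := hvar.hasDerivAt_defect hc0 hcd hq
  have hct : ContinuousAt (fun ε => ((ε, c ε) : ℝ × (ℝ × ℝ))) 0 :=
    continuousAt_id.prodMk hcd.continuousAt
  have hev : ∀ {P : ℝ × (ℝ × ℝ) → Prop}, (∀ᶠ p in 𝓝 ((0 : ℝ), q), P p) →
      ∀ᶠ ε in 𝓝 (0 : ℝ), P (ε, c ε) := fun hP => by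
    refine hct.eventually ?_
    change ∀ᶠ y in 𝓝 ((0 : ℝ), c 0), _
    rwa [hc0]
  have hjc : ContinuousAt (famJet w) (0, q) := (contDiffAt_famJet hw).continuousAt
  have hdom : ∀ᶠ p in 𝓝 ((0 : ℝ), q), famJet w p ∈ E.dom :=
    hjc.eventually (E.isOpen_dom.mem_nhds (by rw [hj]; exact hq))
  have heq := hev (((hv.famJet_eq.and hv.pd_dirT).and hv.iterate_pd_four).and hdom)
  have hA : ContinuousAt (fun ε => Φ.prVert (famJet w (ε, c ε))
      / deriv Φ.T (famJet w (ε, c ε) 0)) 0 := by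
    have h1 : ContinuousAt (fun ε => famJet w (ε, c ε)) 0 := by
      refine ContinuousAt.comp (g := famJet w) (f := fun ε => ((ε, c ε) : ℝ × (ℝ × ℝ))) ?_ hct
      rw [hc0]; exact hjc
    refine ContinuousAt.comp (g := fun z => Φ.prVert z / deriv Φ.T (z 0))
      (f := fun ε => famJet w (ε, c ε)) ?_ h1
    rw [hc0, hj]
    exact continuousAt_prVert_div (hE _ hq).1
  have hjet : famJet w (0, c 0) = jet3 u q := by rw [hc0, hj]
  have hx4 : (pd dirX)^[4] w (0, c 0) = Dx^[4] u q := by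
    rw [hc0, ← (iterate_Dx_slice hw 4).self_of_nhds]
    simp only [hwu]
  have ht1 : pd dirT w (0, c 0) = Dt u q := by
    rw [hc0, ← (Dt_slice hw).self_of_nhds]
    simp only [hwu]
  -- The defect vanishes at ε = 0 because `u` satisfies the equation at `q`.
  have hprod := hasDerivAt_mul_of_continuousAt hA hD (by
    rw [hjet, hx4, ht1]
    have := hhold
    rw [EvolEq.HoldsAt] at this
    rw [this]; ring)
  rw [hjet] at hprod
  refine hD'.unique (hprod.congr_of_eventuallyEq ?_)
  filter_upwards [heq] with ε hε
  obtain ⟨⟨⟨e1, e2⟩, e3⟩, e4⟩ := hε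
  rw [hnew] at e1 e2 e3
  rw [e1, e2, e3, (hE _ e4).2.2]

/-! ### Inequivalence -/

theorem contDiffAt_toFun {b : Base} (hb : b ∈ Φ.source) : ContDiffAt ℝ ∞ Φ.toFun b := by
  refine contDiffAt_pi.2 fun i => ?_
  fin_cases i
  · exact (Φ.contDiffAt_T hb).comp (f := fun b : Base => b 0) b
      (ContinuousLinearMap.proj 0 : Base →L[ℝ] ℝ).contDiff.contDiffAt
  · exact Φ.contDiffAt_X hb
  · exact Φ.contDiffAt_U hb

theorem eq_zero_of_fderiv_toFun {b : Base} (hb : b ∈ Φ.source) {v : Base}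
    (hv : fderiv ℝ Φ.toFun b v = 0) : v = 0 := by
  rw [Φ.fderiv_toFun hb] at hv
  exact eq_zero_of_triangular (Φ.deriv_T_ne_zero _ hb) (Φ.jacobian_ne_zero _ hb) hv

theorem exists_equiv_fderiv_toFun {b : Base} (hb : b ∈ Φ.source) :
    ∃ e : Base ≃L[ℝ] Base, (e : Base →L[ℝ] Base) = fderiv ℝ Φ.toFun b :=
  exists_equiv_of_injective _ fun _ hv => eq_zero_of_fderiv_toFun hb hv

/-- The field that is carried into the constant field `c`. -/
def pullConst (Φ : EquivTransf) (c : Base) (b : Base) : Base := (fderiv ℝ Φ.toFun b).inverse c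

theorem fderiv_pullConst (c : Base) {b : Base} (hb : b ∈ Φ.source) :
    fderiv ℝ Φ.toFun b (Φ.pullConst c b) = c := by
  obtain ⟨e, he⟩ := exists_equiv_fderiv_toFun hb
  rw [pullConst, ← he, ContinuousLinearMap.inverse_equiv]
  simp

theorem contDiffOn_pullConst (c : Base) : ContDiffOn ℝ ∞ (Φ.pullConst c) Φ.source := by
  intro b hb
  obtain ⟨e, he⟩ := exists_equiv_fderiv_toFun hb
  have h1 : ContDiffAt ℝ ∞ (fderiv ℝ Φ.toFun) b := (contDiffAt_toFun hb).fderiv_right (by simp)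
  have h2 : ContDiffAt ℝ ∞ (ContinuousLinearMap.inverse : (Base →L[ℝ] Base) → _)
      (fderiv ℝ Φ.toFun b) := he ▸ contDiffAt_map_inverse e
  exact ((h2.comp b h1).clm_apply contDiffAt_const).contDiffWithinAt

/-- The t-component of the image of ∂_t is T' ≠ 0. -/
theorem not_carries_fieldT (hne : Φ.source.Nonempty) (c : ℝ) :
    ¬ Φ.Carries fieldT (fun p => c • fieldX p) := by
  intro h
  obtain ⟨p, hp⟩ := hne
  have h1 := h p hp
  rw [Φ.fderiv_toFun hp] at h1
  have h2 := congrFun h1 0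
  simp [fieldT, fieldX] at h2
  exact Φ.deriv_T_ne_zero p hp h2

/-- The x'- and u'-components would give X_x = U_x = 0, contrary to the Jacobian condition. -/
theorem not_carries_fieldX (hne : Φ.source.Nonempty) (c : ℝ) :
    ¬ Φ.Carries fieldX (fun p => c • fieldT p) := by
  intro h
  obtain ⟨p, hp⟩ := hne
  have h1 := h p hp
  rw [Φ.fderiv_toFun hp, fieldX_eq] at h1
  have h2 := congrFun h1 1
  have h3 := congrFun h1 2
  simp [fieldT] at h2 h3
  exact Φ.jacobian_ne_zero p hp (by rw [h2, h3]; ring)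

/-- If an open part of an equation with maximal invariance algebra `⟨V₀⟩` is carried into an
equation with coefficients independent of the `i`-th argument, then the field that is carried
into the `i`-th translation is a multiple of `V₀` near some point. -/
theorem exists_pullConst_eq {E E' : EvolEq} {N : Set Jet3} {hN : IsOpen N}
    (hne : (E.restrict N hN).dom.Nonempty) (hEE : Φ.CarriesEq (E.restrict N hN) E')
    {V₀ : Base → Base} (hmax : E.MaximalAlgebra V₀) {i : Fin 3} (hi : i ≠ 2)
    (hind : E'.IndepOf (i.castLE (by omega))) :
    ∃ b ∈ Φ.source, ∃ c : ℝ, Φ.pullConst (Pi.single i 1) b = c • V₀ b := by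
  obtain ⟨z, hz⟩ := hne
  have hrel := hEE.relates
  have hzs : z.base ∈ Φ.source := (hrel z hz).1.1
  -- The part is shrunk to lie over the source. Its projection is open, hence contains a ball, which
  -- is a connected domain for the pulled back field.
  set N' : Set Jet3 := N ∩ Jet3.base ⁻¹' Φ.source
  have hN' : IsOpen N' := hN.inter (Φ.isOpen_source.preimage continuous_base)
  have himg : IsOpen (Jet3.base '' (E.restrict N' hN').dom) :=
    isOpenMap_base _ (E.restrict N' hN').isOpen_dom
  have hzimg : z.base ∈ Jet3.base '' (E.restrict N' hN').dom := ⟨z, ⟨hz.1, hz.2, hzs⟩, rfl⟩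
  obtain ⟨δ, hδ, hball⟩ := Metric.isOpen_iff.1 himg _ hzimg
  have hsub : Metric.ball z.base δ ⊆ Φ.source := fun p hp => by
    obtain ⟨y, hy, rfl⟩ := hball hp
    exact hy.2.2
  obtain ⟨c, hc⟩ := hmax.2 N' hN' (Metric.ball z.base δ) Metric.isOpen_ball
    (convex_ball _ _).isPreconnected hball (Φ.pullConst (Pi.single i 1))
    ((contDiffOn_pullConst _).mono hsub) (by
      intro u q hu hq hj hh
      have hgs : graphPt u q ∈ Φ.source := hsub hq
      have hdom : jet3 u q ∈ (E.restrict N hN).dom := ⟨hj.1, hj.2.1⟩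
      obtain ⟨v, hv, hL⟩ := hrel.lieExpr_eq (V := Φ.pullConst (Pi.single i 1))
        (V' := fun _ => Pi.single i 1) hu hdom
        ((contDiffOn_pullConst _).contDiffAt (Φ.isOpen_source.mem_nhds hgs)) contDiffAt_const
        (by filter_upwards [Φ.isOpen_source.mem_nhds hgs] with b hb using fderiv_pullConst _ hb)
        hh
      have hjv : jet3 v (Φ.newPt u q) ∈ E'.dom := by
        rw [hv.jet3_eq]; exact (hrel _ hdom).2.1
      rw [lieExpr_translation E' hi, (hind.fderiv_eq_zero hjv).1, (hind.fderiv_eq_zero hjv).2] at hL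
      have hA : Φ.prVert (jet3 u q) / deriv Φ.T (jet3 u q 0) ≠ 0 :=
        div_ne_zero (Φ.prVert_ne_zero (hrel _ hdom).1) (Φ.deriv_T_ne_zero _ hgs)
      have h0 : lieExpr (E.restrict N hN) (Φ.pullConst (Pi.single i 1)) u q = 0 := by
        simpa [hA] using hL.symm
      exact h0)
  exact ⟨z.base, hzs, c, hc _ (Metric.mem_ball_self hδ)⟩

/-- The pullback of ∂_x would be c ∂_t. Its image has t-component c T', so c = 0, although the image
does not vanish. -/
theorem not_indepOf_one_of_maximal {E E' : EvolEq} {N : Set Jet3} {hN : IsOpen N}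
    (hne : (E.restrict N hN).dom.Nonempty) (hEE : Φ.CarriesEq (E.restrict N hN) E')
    (hmax : E.MaximalAlgebra fieldT) : ¬ E'.IndepOf 1 := by
  intro hind
  obtain ⟨b, hb, c, hc⟩ := exists_pullConst_eq hne hEE hmax (i := 1) (by decide) hind
  have h := fderiv_pullConst (Pi.single 1 1) hb
  rw [hc, Φ.fderiv_toFun hb] at h
  have h0 : c = 0 := by
    have := congrFun h 0
    simpa [fieldT, Φ.deriv_T_ne_zero b hb] using this
  have h1 := congrFun h 1
  simp [h0] at h1

/-- The pullback of ∂_t would be c ∂_x, whose image has no t-component. -/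
theorem not_indepOf_zero_of_maximal {E E' : EvolEq} {N : Set Jet3} {hN : IsOpen N}
    (hne : (E.restrict N hN).dom.Nonempty) (hEE : Φ.CarriesEq (E.restrict N hN) E')
    (hmax : E.MaximalAlgebra fieldX) : ¬ E'.IndepOf 0 := by
  intro hind
  obtain ⟨b, hb, c, hc⟩ := exists_pullConst_eq hne hEE hmax (i := 0) (by decide) hind
  have h := fderiv_pullConst (Pi.single 0 1) hb
  rw [hc, Φ.fderiv_toFun hb] at h
  have h0 := congrFun h 0
  simp [fieldX] at h0

end EquivTransf

/-! ### Smooth dependence of the flow on the initial value -/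

section Superposition

variable {K : Type} [TopologicalSpace K] [CompactSpace K]
variable {E F : Type} [NormedAddCommGroup E] [NormedSpace ℝ E] [NormedAddCommGroup F]
  [NormedSpace ℝ F]

/-- The pointwise application of operators to vectors. -/
def pointwiseApply : C(K, E →L[ℝ] F) →L[ℝ] C(K, E) →L[ℝ] C(K, F) :=
  LinearMap.mkContinuous₂
    (LinearMap.mk₂ ℝ (fun (A : C(K, E →L[ℝ] F)) (h : C(K, E)) => (⟨fun s => A s (h s), A.continuous.clm_apply h.continuous⟩ :
      C(K, F))) (fun _ _ _ => rfl) (fun _ _ _ => rfl)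
      (fun A h h' => by ext s; exact map_add (A s) _ _)
      (fun c A h => by ext s; exact map_smul (A s) c _)) 1 fun A h => by
    rw [one_mul]
    refine (ContinuousMap.norm_le _ (mul_nonneg (norm_nonneg A) (norm_nonneg h))).2 fun s => ?_
    exact ((A s).le_opNorm _).trans (mul_le_mul (A.norm_coe_le_norm s) (h.norm_coe_le_norm s)
      (norm_nonneg _) (norm_nonneg _))

/-- The image of a path is compact, so the derivative of `f` varies by less than c on balls of one
radius around all its points. The mean value inequality then gives a remainder estimate that is
uniform along the path. -/
theorem hasFDerivAt_comp_continuousMap (f : C(E, F)) (f' : C(E, E →L[ℝ] F))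
    (hf : ∀ x, HasFDerivAt f (f' x) x) (γ : C(K, E)) :
    HasFDerivAt (fun γ : C(K, E) => f.comp γ) (pointwiseApply (f'.comp γ)) γ := by
  rw [hasFDerivAt_iff_isLittleO, Asymptotics.isLittleO_iff]
  intro c hc
  have hK : IsCompact (Set.range γ) := isCompact_range γ.continuous
  obtain ⟨δ, hδ, hu⟩ := Metric.mem_uniformity_dist.1
    (hK.uniformContinuousAt_of_continuousAt f' (fun x _ => f'.continuous.continuousAt)
      (Metric.dist_mem_uniformity hc))
  filter_upwards [Metric.ball_mem_nhds γ hδ] with β hβ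
  refine (ContinuousMap.norm_le _ (by positivity)).2 fun s => ?_
  have hd : ∀ t, dist (β t) (γ t) ≤ dist β γ := fun t => ContinuousMap.dist_apply_le_dist t
  have hb : ∀ x ∈ Metric.ball (γ s) δ, ‖f' x - f' (γ s)‖ ≤ c := fun x hx => by
    have := hu (a := γ s) (b := x) (by rwa [dist_comm]) ⟨s, rfl⟩
    rw [← dist_eq_norm, dist_comm]
    exact (show dist (f' (γ s)) (f' x) < c from this).le
  have h1 := (convex_ball (γ s) δ).norm_image_sub_le_of_norm_hasFDerivWithin_le'
    (f := f) (f' := f') (φ := f' (γ s)) (C := c) (fun x _ => (hf x).hasFDerivWithinAt) hb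
    (Metric.mem_ball_self hδ) (y := β s) ((hd s).trans_lt hβ)
  have h2 : ‖β s - γ s‖ ≤ ‖β - γ‖ := by
    rw [← dist_eq_norm, ← dist_eq_norm]
    exact hd s
  exact h1.trans (mul_le_mul_of_nonneg_left h2 hc.le)

/-- The derivative of a superposition operator is the superposition operator of the derivative,
followed by a bounded linear map. The induction therefore has to allow the target space to change.
-/
theorem contDiff_comp_continuousMap {f : E → F} (hf : ContDiff ℝ ∞ f) (n : ℕ) :
    ContDiff ℝ n (fun γ : C(K, E) => (⟨f, hf.continuous⟩ : C(E, F)).comp γ) := by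
  induction n generalizing F with
  | zero => exact contDiff_zero.2 (ContinuousMap.continuous_postcomp _)
  | succ n ih =>
    have hf' : ContDiff ℝ ∞ (fderiv ℝ f) := hf.fderiv_right (by simp)
    have hd := hasFDerivAt_comp_continuousMap (K := K) ⟨f, hf.continuous⟩
      ⟨fderiv ℝ f, hf'.continuous⟩
      (fun x => (hf.differentiable (by simp)).differentiableAt.hasFDerivAt)
    rw [Nat.cast_add, Nat.cast_one, contDiff_succ_iff_hasFDerivAt]
    refine ⟨_, ?_, hd⟩
    exact (pointwiseApply (K := K) (E := E) (F := F)).contDiff.comp (ih hf')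

end Superposition

/-! ### The local flow from the inverse function theorem on paths. -/

section Flow

variable {E : Type} [NormedAddCommGroup E]

/-- The interval `[-1, 1]`. -/
abbrev SymmInterval : Type := Set.Icc (-1 : ℝ) 1

theorem neg_one_le_one_real : (-1 : ℝ) ≤ 1 := by norm_num

/-- The extension of a path by constants. -/
def extend (γ : C(SymmInterval, E)) (σ : ℝ) : E := γ (Set.projIcc (-1) 1 neg_one_le_one_real σ)

theorem continuous_extend (γ : C(SymmInterval, E)) : Continuous (extend γ) :=
  γ.continuous.comp continuous_projIcc

theorem extend_coe (γ : C(SymmInterval, E)) (s : SymmInterval) : extend γ s = γ s := by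
  rw [extend, Set.projIcc_val]

theorem norm_extend_le (γ : C(SymmInterval, E)) (σ : ℝ) : ‖extend γ σ‖ ≤ ‖γ‖ := γ.norm_coe_le_norm _

/-- The path run through at `s` times the speed. -/
def slowDown (γ : C(SymmInterval, E)) (s : ℝ) : C(SymmInterval, E) :=
  ⟨fun σ => extend γ (s * σ), (continuous_extend γ).comp (continuous_const.mul
    continuous_subtype_val)⟩

theorem extend_slowDown (γ : C(SymmInterval, E)) {s σ : ℝ} (hσ : |σ| ≤ 1) :
    extend (slowDown γ s) σ = extend γ (s * σ) := by
  rw [extend, Set.projIcc_of_mem _ (abs_le.1 hσ)]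
  rfl

variable [NormedSpace ℝ E]

/-- The primitive of a path that vanishes at `0`. -/
def primitive [CompleteSpace E] : C(SymmInterval, E) →L[ℝ] C(SymmInterval, E) :=
  LinearMap.mkContinuous
    { toFun := fun γ => ⟨fun s => ∫ σ in (0 : ℝ)..s, extend γ σ,
        (intervalIntegral.continuous_primitive
          (fun a b => (continuous_extend γ).intervalIntegrable a b) 0).comp continuous_subtype_val⟩
      map_add' := fun γ β => by
        ext s
        exact intervalIntegral.integral_add ((continuous_extend γ).intervalIntegrable _ _)
          ((continuous_extend β).intervalIntegrable _ _)
      map_smul' := fun c γ => by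
        ext s
        exact intervalIntegral.integral_smul c _ } 1 fun γ => by
    refine (ContinuousMap.norm_le _ (mul_nonneg zero_le_one (norm_nonneg _))).2 fun s => ?_
    have h := intervalIntegral.norm_integral_le_of_norm_le_const (a := 0) (b := (s : ℝ))
      (f := extend γ) (C := ‖γ‖) fun σ _ => norm_extend_le γ σ
    have hs : |(s : ℝ)| ≤ 1 := abs_le.2 s.2
    rw [sub_zero] at h
    rw [one_mul]
    exact h.trans (mul_le_of_le_one_right (norm_nonneg _) hs)

/-- Constant paths. -/
def constPath : E →L[ℝ] C(SymmInterval, E) :=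
  LinearMap.mkContinuous
    { toFun := ContinuousMap.const SymmInterval
      map_add' := fun _ _ => rfl
      map_smul' := fun _ _ => rfl } 1 fun x => by
    refine (ContinuousMap.norm_le _ (mul_nonneg zero_le_one (norm_nonneg _))).2 fun s => ?_
    rw [one_mul]; rfl

variable [CompleteSpace E] {f : E → E} (hf : ContDiff ℝ ∞ f)

/-- The map whose zeros are the integral curves of `c • f` through `x`. -/
def integralDefect (hf : ContDiff ℝ ∞ f) (y : ℝ × E × C(SymmInterval, E)) : C(SymmInterval, E) :=
  y.2.2 - constPath y.2.1 - y.1 • primitive ((⟨f, hf.continuous⟩ : C(E, E)).comp y.2.2)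

theorem contDiff_integralDefect : ContDiff ℝ ∞ (integralDefect hf) := by
  refine contDiff_infty.2 fun n => ?_
  have h : ContDiff ℝ n fun y : ℝ × E × C(SymmInterval, E) =>
      (⟨f, hf.continuous⟩ : C(E, E)).comp y.2.2 :=
    (contDiff_comp_continuousMap hf n).comp (contDiff_snd.comp contDiff_snd)
  exact ((contDiff_snd.comp contDiff_snd).sub
    ((constPath (E := E)).contDiff.comp (contDiff_fst.comp contDiff_snd))).sub
      (contDiff_fst.smul ((primitive (E := E)).contDiff.comp h))

theorem integralDefect_apply (y : ℝ × E × C(SymmInterval, E)) (s : SymmInterval) :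
    integralDefect hf y s
      = y.2.2 s - y.2.1 - y.1 • ∫ σ in (0 : ℝ)..s, f (extend y.2.2 σ) := rfl

theorem fderiv_integralDefect (p : E) (a : ℝ × E × C(SymmInterval, E)) :
    fderiv ℝ (integralDefect hf) (0, p, constPath p) a
      = a.2.2 - constPath a.2.1 - a.1 • primitive (constPath (f p)) := by
  have h := (contDiff_comp_continuousMap (K := SymmInterval) hf 1).differentiable (by simp)
    (constPath p)
  have h1 : HasFDerivAt (fun y : ℝ × E × C(SymmInterval, E) =>
      primitive ((⟨f, hf.continuous⟩ : C(E, E)).comp y.2.2)) _ (0, p, constPath p) :=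
    (primitive (E := E)).hasFDerivAt.comp _ (HasFDerivAt.comp
      (f := fun y : ℝ × E × C(SymmInterval, E) => y.2.2) (0, p, constPath p) h.hasFDerivAt
      (hasFDerivAt_snd.comp _ hasFDerivAt_snd))
  have h2 : HasFDerivAt (integralDefect hf) _ (0, p, constPath p) :=
    ((hasFDerivAt_snd.comp _ hasFDerivAt_snd).sub
      ((constPath (E := E)).hasFDerivAt.comp _ (hasFDerivAt_fst.comp _ hasFDerivAt_snd))).sub
      (hasFDerivAt_fst.smul h1)
  rw [h2.fderiv]
  simp
  rfl

/-- The map whose local inverse yields the flow of `f`. -/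
def integralMap (hf : ContDiff ℝ ∞ f) (y : ℝ × E × C(SymmInterval, E)) :
    ℝ × E × C(SymmInterval, E) := (y.1, y.2.1, integralDefect hf y)

theorem contDiff_integralMap : ContDiff ℝ ∞ (integralMap hf) :=
  contDiff_fst.prodMk ((contDiff_fst.comp contDiff_snd).prodMk (contDiff_integralDefect hf))

theorem integralMap_const (p : E) : integralMap hf (0, p, constPath p) = (0, p, 0) := by
  simp [integralMap, integralDefect]

/-- At speed 0 the derivative in the path is the identity, because the integral term carries the
factor c = 0. The whole derivative is a shear, inverted by changing signs. -/
theorem exists_fderiv_integralMap (p : E) :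
    ∃ e : (ℝ × E × C(SymmInterval, E)) ≃L[ℝ] (ℝ × E × C(SymmInterval, E)),
      fderiv ℝ (integralMap hf) (0, p, constPath p) = e := by
  set c := primitive (constPath (f p)) with hc
  set A : (ℝ × E × C(SymmInterval, E)) →L[ℝ] (ℝ × E × C(SymmInterval, E)) :=
    (ContinuousLinearMap.fst ℝ _ _).prod (((ContinuousLinearMap.fst ℝ _ _).comp
      (ContinuousLinearMap.snd ℝ _ _)).prod (((ContinuousLinearMap.snd ℝ _ _).comp
      (ContinuousLinearMap.snd ℝ _ _)) - constPath.comp ((ContinuousLinearMap.fst ℝ _ _).comp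
      (ContinuousLinearMap.snd ℝ _ _)) - (ContinuousLinearMap.fst ℝ _ _).smulRight c))
  set B : (ℝ × E × C(SymmInterval, E)) →L[ℝ] (ℝ × E × C(SymmInterval, E)) :=
    (ContinuousLinearMap.fst ℝ _ _).prod (((ContinuousLinearMap.fst ℝ _ _).comp
      (ContinuousLinearMap.snd ℝ _ _)).prod (((ContinuousLinearMap.snd ℝ _ _).comp
      (ContinuousLinearMap.snd ℝ _ _)) + constPath.comp ((ContinuousLinearMap.fst ℝ _ _).comp
      (ContinuousLinearMap.snd ℝ _ _)) + (ContinuousLinearMap.fst ℝ _ _).smulRight c))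
  refine ⟨ContinuousLinearEquiv.equivOfInverse A B (fun y => ?_) (fun y => ?_), ?_⟩
  · refine Prod.ext rfl (Prod.ext rfl ?_)
    change (y.2.2 - constPath y.2.1 - y.1 • c) + constPath y.2.1 + y.1 • c = y.2.2
    abel
  · refine Prod.ext rfl (Prod.ext rfl ?_)
    change (y.2.2 + constPath y.2.1 + y.1 • c) - constPath y.2.1 - y.1 • c = y.2.2
    abel
  · have h : HasFDerivAt (integralMap hf) _ (0, p, constPath p) :=
      hasFDerivAt_fst.prodMk ((hasFDerivAt_fst.comp _ hasFDerivAt_snd).prodMk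
        (((contDiff_integralDefect hf).differentiable (by simp)) _).hasFDerivAt)
    rw [h.fderiv]
    refine ContinuousLinearMap.ext fun a => Prod.ext rfl (Prod.ext rfl ?_)
    exact fderiv_integralDefect hf p a

/-- A path with speed c, run through at s times the speed, solves the integral equation with speed
cs. This is the substitution τ ↦ sτ in the integral. -/
theorem integralMap_slowDown {c : ℝ} {x : E} {γ : C(SymmInterval, E)}
    (h : integralMap hf (c, x, γ) = (c, x, 0)) {s : ℝ} (hs : |s| ≤ 1) :
    integralMap hf (c * s, x, slowDown γ s) = (c * s, x, 0) := by
  refine Prod.ext rfl (Prod.ext rfl ?_)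
  have h' : integralDefect hf (c, x, γ) = 0 := congrArg (fun y => y.2.2) h
  change integralDefect hf (c * s, x, slowDown γ s) = 0
  ext σ
  have hσ : |(σ : ℝ)| ≤ 1 := abs_le.2 σ.2
  have hsσ : |s * σ| ≤ 1 := by
    rw [abs_mul]; exact mul_le_one₀ hs (abs_nonneg _) hσ
  have h1 := congrArg (fun β : C(SymmInterval, E) => β ⟨s * σ, abs_le.1 hsσ⟩) h'
  simp only [integralDefect_apply, ContinuousMap.zero_apply] at h1 ⊢
  have h2 : ∫ τ in (0 : ℝ)..σ, f (extend (slowDown γ s) τ)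
      = ∫ τ in (0 : ℝ)..σ, f (extend γ (s * τ)) := by
    refine intervalIntegral.integral_congr fun τ hτ => ?_
    have : |τ| ≤ 1 := by
      have := Set.abs_sub_left_of_mem_uIcc hτ
      simp only [sub_zero] at this
      exact this.trans hσ
    simp only [extend_slowDown γ this]
  have h3 : s • ∫ τ in (0 : ℝ)..σ, f (extend γ (s * τ))
      = ∫ τ in (0 : ℝ)..(s * σ), f (extend γ τ) := by
    have := intervalIntegral.smul_integral_comp_mul_left (a := 0) (b := (σ : ℝ))
      (fun τ => f (extend γ τ)) s
    rwa [mul_zero] at this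
  rw [h2, mul_smul, h3, ← h1]
  congr 2
  exact extend_coe γ ⟨s * σ, abs_le.1 hsσ⟩

/-- A smooth vector field has a smooth local flow. -/
theorem exists_local_flow (hf : ContDiff ℝ ∞ f) (p : E) : ∃ r > 0, ∃ φ : ℝ × E → E,
    ContDiffOn ℝ ∞ φ (Metric.ball (0, p) r) ∧ (∀ x ∈ Metric.ball p r, φ (0, x) = x) ∧
    ∀ y ∈ Metric.ball ((0 : ℝ), p) r, HasDerivAt (fun c => φ (c, y.2)) (f (φ y)) y.1 := by
  obtain ⟨e, he⟩ := exists_fderiv_integralMap hf p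
  obtain ⟨Ψ, hs, -, hΨ, hsymm⟩ := exists_smooth_local_inverse isOpen_univ
    (contDiff_integralMap hf).contDiffOn (Set.mem_univ (0, p, constPath p)) he
  obtain ⟨δ, hδ, hball⟩ := Metric.isOpen_iff.1 Ψ.open_source _ hs
  have htarget : ((0 : ℝ), p, (0 : C(SymmInterval, E))) ∈ Ψ.target := by
    have := Ψ.map_source hs
    rwa [hΨ, integralMap_const] at this
  have hsymm0 : Ψ.symm ((0 : ℝ), p, (0 : C(SymmInterval, E))) = (0, p, constPath p) := by
    rw [← integralMap_const hf, ← hΨ, Ψ.left_inv hs]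
  set ι : ℝ × E → ℝ × E × C(SymmInterval, E) := fun y => (y.1, y.2, 0) with hι
  have hιc : ContDiff ℝ ∞ ι := contDiff_fst.prodMk (contDiff_snd.prodMk contDiff_const)
  have hev : ∀ᶠ y in 𝓝 ((0 : ℝ), p), ι y ∈ Ψ.target ∧
      Ψ.symm (ι y) ∈ Metric.ball ((0 : ℝ), p, constPath p) δ := by
    have h1 : ContinuousAt ι (0, p) := hιc.continuous.continuousAt
    have h2 : ContinuousAt (fun y => Ψ.symm (ι y)) (0, p) :=
      ContinuousAt.comp (g := Ψ.symm) (f := ι) (hsymm _ htarget).continuousAt h1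
    exact (h1.eventually (Ψ.open_target.mem_nhds htarget)).and
      (h2.eventually (Metric.isOpen_ball.mem_nhds (by
        change Ψ.symm ((0 : ℝ), p, (0 : C(SymmInterval, E))) ∈ _
        rw [hsymm0]; exact Metric.mem_ball_self hδ)))
  obtain ⟨r, hr, hrb⟩ := Metric.eventually_nhds_iff_ball.1 hev
  set Γ : ℝ × E → C(SymmInterval, E) := fun y => (Ψ.symm (ι y)).2.2 with hΓ
  have hmap : ∀ y ∈ Metric.ball ((0 : ℝ), p) r, Ψ.symm (ι y) = (y.1, y.2, Γ y) ∧
      integralMap hf (y.1, y.2, Γ y) = (y.1, y.2, 0) := fun y hy => by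
    have h := Ψ.right_inv (hrb y hy).1
    rw [hΨ] at h
    have h1 : (Ψ.symm (ι y)).1 = y.1 := congrArg (fun z => z.1) h
    have h2 : (Ψ.symm (ι y)).2.1 = y.2 := congrArg (fun z => z.2.1) h
    have h3 : Ψ.symm (ι y) = (y.1, y.2, Γ y) := Prod.ext h1 (Prod.ext h2 rfl)
    exact ⟨h3, by rw [← h3]; exact h⟩
  have hone : (1 : ℝ) ∈ Set.Icc (-1 : ℝ) 1 := by norm_num
  -- Both paths solve the same integral equation. The slowed path takes only values of the original
  -- one, so it stays in the ball where the local inverse gives uniqueness.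
  have hslow : ∀ c x, (c, x) ∈ Metric.ball ((0 : ℝ), p) r → ∀ s, |s| ≤ 1 →
      Γ (c * s, x) = slowDown (Γ (c, x)) s := by
    intro c x hy s hs1
    have hcs : |c * s| ≤ |c| := by
      rw [abs_mul]; exact mul_le_of_le_one_right (abs_nonneg _) hs1
    have hy' : (c * s, x) ∈ Metric.ball ((0 : ℝ), p) r := by
      rw [Metric.mem_ball, Prod.dist_eq, max_lt_iff, Real.dist_0_eq_abs] at hy ⊢
      exact ⟨hcs.trans_lt hy.1, hy.2⟩
    obtain ⟨h1, h2⟩ := hmap _ hy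
    have h3 := integralMap_slowDown hf h2 hs1
    have h4 : (c * s, x, slowDown (Γ (c, x)) s) ∈ Ψ.source := by
      refine hball ?_
      have h5 := (hrb _ hy).2
      rw [h1] at h5
      rw [Metric.mem_ball, Prod.dist_eq, Prod.dist_eq, max_lt_iff, max_lt_iff,
        Real.dist_0_eq_abs] at h5 ⊢
      refine ⟨hcs.trans_lt h5.1, h5.2.1, lt_of_le_of_lt ?_ h5.2.2⟩
      refine (ContinuousMap.dist_le dist_nonneg).2 fun σ => ?_
      exact ContinuousMap.dist_apply_le_dist (f := Γ (c, x)) (g := constPath p) _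
    have h6 := Ψ.left_inv h4
    rw [hΨ, h3] at h6
    exact congrArg (fun z => z.2.2) h6
  refine ⟨r / 2, half_pos hr, fun y => Γ y ⟨1, hone⟩, ?_, ?_, ?_⟩
  · intro y hy
    have hy' := Metric.ball_subset_ball (half_le_self hr.le) hy
    have h1 : ContDiffAt ℝ ∞ (fun y => Ψ.symm (ι y)) y :=
      ContDiffAt.comp (g := Ψ.symm) y (hsymm _ (hrb y hy').1) hιc.contDiffAt
    exact ((ContinuousMap.evalCLM ℝ (⟨1, hone⟩ : SymmInterval)).contDiff.contDiffAt.comp y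
      (contDiffAt_snd.comp y (contDiffAt_snd.comp y h1))).contDiffWithinAt
  · intro x hx
    have hy : ((0 : ℝ), x) ∈ Metric.ball ((0 : ℝ), p) r := by
      rw [Metric.mem_ball, Prod.dist_eq, max_lt_iff, dist_self]
      exact ⟨hr, (Metric.mem_ball.1 hx).trans (half_lt_self hr)⟩
    have h := congrArg (fun z => z.2.2) (hmap _ hy).2
    have h' := congrArg (fun β : C(SymmInterval, E) => β ⟨1, hone⟩) h
    simp only [integralMap, integralDefect_apply, zero_smul, sub_zero] at h'
    exact sub_eq_zero.1 h'
  · rintro ⟨c, x⟩ hy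
    rw [Metric.mem_ball, Prod.dist_eq, max_lt_iff, Real.dist_0_eq_abs] at hy
    obtain ⟨hc, hx⟩ := hy
    simp only at hc hx ⊢
    -- All endpoints for |b| < ρ lie on the single path with speed ρ, at parameter b/ρ.
    -- Differentiation in the speed becomes differentiation of an integral in its upper limit.
    set ρ := r / 2 with hρ
    have hρ0 : 0 < ρ := half_pos hr
    have hyρ : (ρ, x) ∈ Metric.ball ((0 : ℝ), p) r := by
      rw [Metric.mem_ball, Prod.dist_eq, max_lt_iff, Real.dist_0_eq_abs, abs_of_pos hρ0]
      exact ⟨half_lt_self hr, hx.trans (half_lt_self hr)⟩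
    have hval : ∀ b : ℝ, |b| < ρ → Γ (b, x) ⟨1, hone⟩
        = x + ρ • ∫ τ in (0 : ℝ)..(b / ρ), f (extend (Γ (ρ, x)) τ) ∧
        Γ (b, x) ⟨1, hone⟩ = extend (Γ (ρ, x)) (b / ρ) := fun b hb => by
      have hb1 : |b / ρ| ≤ 1 := by
        rw [abs_div, abs_of_pos hρ0]; exact (div_lt_one hρ0).2 hb |>.le
      have h1 := hslow ρ x hyρ (b / ρ) hb1
      rw [mul_div_cancel₀ _ hρ0.ne'] at h1
      have h2 : Γ (b, x) ⟨1, hone⟩ = extend (Γ (ρ, x)) (b / ρ) := by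
        rw [h1]
        change extend (Γ (ρ, x)) (b / ρ * 1) = _
        rw [mul_one]
      refine ⟨?_, h2⟩
      have h := congrArg (fun z => z.2.2) (hmap _ hyρ).2
      have h' := congrArg (fun β : C(SymmInterval, E) => β ⟨b / ρ, abs_le.1 hb1⟩) h
      simp only [integralMap, integralDefect_apply, ContinuousMap.zero_apply] at h'
      rw [h2, ← sub_eq_zero, ← h', ← extend_coe]
      abel
    have hcont : Continuous fun τ => f (extend (Γ (ρ, x)) τ) :=
      hf.continuous.comp (continuous_extend _)
    have hd := ((hcont.integral_hasStrictDerivAt 0 (c / ρ)).hasDerivAt.scomp c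
      ((hasDerivAt_id c).div_const ρ)).const_smul ρ |>.const_add x
    rw [(hval c hc).2]
    refine (hd.congr_of_eventuallyEq ?_).congr_deriv ?_
    · have : ∀ᶠ b in 𝓝 c, |b| < ρ := continuous_abs.continuousAt.eventually (gt_mem_nhds hc)
      exact this.mono fun b hb => (hval b hb).1
    · rw [smul_smul, mul_one_div_cancel hρ0.ne', one_smul]

end Flow

/-- Multiplication by a bump function supported in `D` extends the local datum by zero. It makes
locally defined fields accessible to results for globally smooth ones. -/
theorem exists_contDiff_eventuallyEq {E F : Type*} [NormedAddCommGroup E] [NormedSpace ℝ E]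
    [FiniteDimensional ℝ E] [NormedAddCommGroup F] [NormedSpace ℝ F] {V : E → F} {D : Set E}
    (hD : IsOpen D) (hV : ContDiffOn ℝ ∞ V D) {p : E} (hp : p ∈ D) :
    ∃ f : E → F, ContDiff ℝ ∞ f ∧ f =ᶠ[𝓝 p] V := by
  obtain ⟨δ, hδ, hball⟩ := Metric.isOpen_iff.1 hD p hp
  let χ : ContDiffBump p := ⟨δ / 4, δ / 2, by linarith, by linarith⟩
  refine ⟨fun x => χ x • V x, contDiff_iff_contDiffAt.2 fun x => ?_, ?_⟩
  · by_cases hx : x ∈ tsupport χ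
    · have hxD : x ∈ D := by
        rw [χ.tsupport_eq] at hx
        exact hball (Metric.closedBall_subset_ball (half_lt_self hδ) hx)
      exact χ.contDiffAt.smul (hV.contDiffAt (hD.mem_nhds hxD))
    · have h0 : (fun x => χ x • V x) =ᶠ[𝓝 x] fun _ => 0 := by
        filter_upwards [notMem_tsupport_iff_eventuallyEq.1 hx] with y hy
        rw [hy]; exact zero_smul _ _
      exact contDiffAt_const.congr_of_eventuallyEq h0
  · filter_upwards [χ.eventuallyEq_one] with x hx
    rw [hx]; exact one_smul _ _

/-- A smooth vector field can be straightened near a point at which it does not vanish, with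
prescribed derivative of the straightening coordinates at that point. -/
theorem exists_flow_box {V : Base → Base} {D : Set Base} (hD : IsOpen D)
    (hV : ContDiffOn ℝ ∞ V D) {p : Base} (hp : p ∈ D) (L : Base ≃L[ℝ] Base)
    (hL : L (Pi.single 0 1) = V p) : ∃ (Θ : Base → Base) (S : Set Base), IsOpen S ∧ p ∈ S ∧ S ⊆ D ∧
      ContDiffOn ℝ ∞ Θ S ∧ fderiv ℝ Θ p = (L.symm : Base →L[ℝ] Base) ∧
      ∀ b ∈ S, fderiv ℝ Θ b (V b) = Pi.single 0 1 := by
  obtain ⟨f, hf, hfV⟩ := exists_contDiff_eventuallyEq hD hV hp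
  obtain ⟨r, hr, φ, hφ, hφ0, hφd⟩ := exists_local_flow hf p
  set e₀ : Base := Pi.single 0 1 with he₀
  -- The projection onto v₀ = 0 along the first basis vector.
  set P : Base →L[ℝ] Base := ContinuousLinearMap.id ℝ Base
    - (ContinuousLinearMap.proj 0 : Base →L[ℝ] ℝ).smulRight e₀ with hP
  have hPv : ∀ v, v = v 0 • e₀ + P v := fun v => by simp [hP]
  have hPe : P e₀ = 0 := by simp [hP, he₀]
  have hP0 : ∀ v, P v 0 = 0 := fun v => by simp [hP, he₀]
  set κ : Base → ℝ × Base := fun v => (v 0, p + L (P v)) with hκ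
  have hκc : ContDiff ℝ ∞ κ := (ContinuousLinearMap.proj 0 : Base →L[ℝ] ℝ).contDiff.prodMk
    (contDiff_const.add (L.contDiff.comp P.contDiff))
  have hκ0 : κ 0 = (0, p) := by simp [hκ]
  set S₀ := κ ⁻¹' Metric.ball (0, p) r
  have hS₀ : IsOpen S₀ := Metric.isOpen_ball.preimage hκc.continuous
  have h0S : (0 : Base) ∈ S₀ := by
    change κ 0 ∈ Metric.ball ((0 : ℝ), p) r
    rw [hκ0]; exact Metric.mem_ball_self hr
  -- The inverse chart: start on the transversal p + L(Pv) and follow the flow for time v₀. Its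
  -- derivative at 0 is L, along the first vector by the flow equation and on the transversal
  -- because the flow at time 0 is the identity.
  set B : Base → Base := fun v => φ (κ v) with hB
  have hBs : ContDiffOn ℝ ∞ B S₀ := hφ.comp hκc.contDiffOn fun v hv => hv
  have hBd : ∀ v ∈ S₀, HasFDerivAt B (fderiv ℝ B v) v := fun v hv =>
    ((hBs.contDiffAt (hS₀.mem_nhds hv)).differentiableAt (by simp)).hasFDerivAt
  have hB0 : B 0 = p := by
    simp only [hB]; rw [hκ0]; exact hφ0 p (Metric.mem_ball_self hr)
  have hline : ∀ v w : Base, HasDerivAt (fun t : ℝ => v + t • w) w 0 := fun v w =>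
    (((hasDerivAt_id (0 : ℝ)).smul_const w).const_add v).congr_deriv (by simp)
  have hBe : ∀ v ∈ S₀, fderiv ℝ B v e₀ = f (B v) := fun v hv => by
    have h1 : HasDerivAt (fun t : ℝ => B (v + t • e₀)) (fderiv ℝ B v e₀) 0 := by
      refine HasFDerivAt.comp_hasDerivAt (l := B) (f := fun t : ℝ => v + t • e₀) 0 ?_ (hline v e₀)
      simpa using hBd v hv
    have h2 : HasDerivAt (fun t : ℝ => φ (v 0 + t, p + L (P v))) (f (B v)) 0 :=
      HasDerivAt.comp_const_add (v 0) 0 (by simpa using hφd (κ v) hv)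
    have h3 : (fun t : ℝ => B (v + t • e₀)) = fun t : ℝ => φ (v 0 + t, p + L (P v)) := by
      funext t
      simp only [hB, hκ, map_add, map_smul, hPe, smul_zero, add_zero]
      congr 2
      simp [he₀]
    rw [h3] at h1
    exact h1.unique h2
  have hBP : ∀ w, fderiv ℝ B 0 (P w) = L (P w) := fun w => by
    have h1 : HasDerivAt (fun t : ℝ => B (0 + t • P w)) (fderiv ℝ B 0 (P w)) 0 := by
      refine HasFDerivAt.comp_hasDerivAt (l := B) (f := fun t : ℝ => 0 + t • P w) 0 ?_
        (hline 0 (P w))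
      simpa using hBd 0 h0S
    have hPP : P (P w) = P w := by
      have := hPv (P w)
      rw [hP0, zero_smul, zero_add] at this
      exact this.symm
    have h2 : HasDerivAt (fun t : ℝ => p + t • L (P w)) (L (P w)) 0 := hline p _
    refine h1.unique (h2.congr_of_eventuallyEq ?_)
    filter_upwards [h2.continuousAt.eventually (Metric.isOpen_ball.mem_nhds
      (show p + (0 : ℝ) • L (P w) ∈ Metric.ball p r by simpa using hr))] with t ht
    have := hφ0 _ ht
    simp only [hB, hκ, zero_add, map_smul, hPP]
    rw [← this]
    congr 2
    simp [hP0]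
  have hBL : fderiv ℝ B 0 = (L : Base →L[ℝ] Base) := by
    ext1 w
    conv_lhs => rw [hPv w]
    conv_rhs => rw [hPv w]
    rw [map_add, map_smul, hBP, hBe 0 h0S, hB0, hfV.self_of_nhds, ← hL]
    simp
  obtain ⟨Ψ, hs, hsub, hΨ, hsymm⟩ := exists_smooth_local_inverse hS₀ hBs h0S hBL
  have hptar : p ∈ Ψ.target := by
    have := Ψ.map_source hs
    rwa [hΨ, hB0] at this
  have hcomp : ∀ v ∈ Ψ.source, ∀ w, fderiv ℝ Ψ.symm (B v) (fderiv ℝ B v w) = w := fun v hv w => by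
    have h1 := (hsymm (B v) (by rw [← hΨ]; exact Ψ.map_source hv)).differentiableAt (by simp)
    have h2 := h1.hasFDerivAt.comp v (hBd v (hsub hv))
    have h3 : HasFDerivAt (Ψ.symm ∘ B) (ContinuousLinearMap.id ℝ Base) v := by
      refine (hasFDerivAt_id v).congr_of_eventuallyEq ?_
      filter_upwards [Ψ.open_source.mem_nhds hv] with y hy
      rw [Function.comp_apply, ← hΨ, Ψ.left_inv hy]; rfl
    exact congrArg (fun A : Base →L[ℝ] Base => A w) (h2.unique h3)
  refine ⟨Ψ.symm, Ψ.target ∩ D ∩ interior {x | f x = V x},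
    (Ψ.open_target.inter hD).inter isOpen_interior, ⟨⟨hptar, hp⟩, mem_interior_iff_mem_nhds.2 hfV⟩,
    fun b hb => hb.1.2, fun b hb => (hsymm b hb.1.1).contDiffWithinAt, ?_, fun b hb => ?_⟩
  · ext1 w
    have h := hcomp 0 hs (L.symm w)
    rw [hB0, hBL] at h
    simpa using h
  · have hv := Ψ.map_target hb.1.1
    have hBv : B (Ψ.symm b) = b := by rw [← hΨ, Ψ.right_inv hb.1.1]
    have h := hcomp _ hv e₀
    have hfb : f b = V b := (interior_subset hb.2 : b ∈ {x | f x = V x})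
    rw [hBe _ (hsub hv), hBv, hfb] at h
    exact h

/-! ### The image of an equation under an equivalence transformation -/

namespace EquivTransf

variable {Φ : EquivTransf}

theorem pd_two_comp_base {f : Base → ℝ} {z : Jet3} (hf : DifferentiableAt ℝ f z.base) :
    pd (Pi.single 2 1) (fun z => f (Jet3.base z)) z = fderiv ℝ f z.base (Pi.single 2 1) := by
  rw [pd, fderiv_fun_comp z hf (hasFDerivAt_base z).differentiableAt, (hasFDerivAt_base z).fderiv,
    ContinuousLinearMap.comp_apply]
  congr 1
  funext i
  fin_cases i <;> simp [baseL]

theorem pd_prJet_one {z : Jet3} (hz : z ∈ Φ.prDom) :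
    pd (Pi.single 3 1) (Φ.prJet 1) z = Φ.prVert z / totD Φ.XJet z := by
  have hU := (Φ.hasOrder_prJet (k := 0) (by omega))
  have hX := Φ.hasOrder_XJet.mono Φ.prDom_subset
  have hpU : pd (Pi.single 2 1) (Φ.prJet 0) z = fderiv ℝ Φ.U z.base (Pi.single 2 1) :=
    pd_two_comp_base ((Φ.contDiffAt_U hz.1).differentiableAt (by simp))
  have hpX : pd (Pi.single 2 1) Φ.XJet z = fderiv ℝ Φ.X z.base (Pi.single 2 1) :=
    pd_two_comp_base ((Φ.contDiffAt_X hz.1).differentiableAt (by simp))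
  have h1 := hU.pd_totD_top Φ.isOpen_prDom hz (j := 3) rfl
  have h2 := hX.pd_totD_top Φ.isOpen_prDom hz (j := 3) rfl
  have h3 : pd (Pi.single 3 1) (Φ.prJet 1) z = _ :=
    pd_div ((hU.totD Φ.isOpen_prDom (by omega)).differentiableAt Φ.isOpen_prDom hz)
    ((hX.totD Φ.isOpen_prDom (by omega)).differentiableAt Φ.isOpen_prDom hz) hz.2
  rw [h3, h1, h2]
  have h4 : Φ.prJet 1 z = totD (Φ.prJet 0) z / totD Φ.XJet z := rfl
  rw [show (3 - 1 : Fin 6) = 2 from rfl, hpU, hpX, prVert, h4]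
  have := hz.2
  field_simp

/-- The denominator D_x X has order 1 and does not contain the highest derivative here. Every
prolongation step just divides the leading coefficient by D_x X once more. -/
theorem pd_prJet_succ {k : ℕ} (hk : 1 ≤ k) (hk2 : k ≤ 2) {z : Jet3} (hz : z ∈ Φ.prDom) {j : Fin 6}
    (hj : j.val = k + 3) : pd (Pi.single j 1) (Φ.prJet (k + 1)) z
      = pd (Pi.single (j - 1) 1) (Φ.prJet k) z / totD Φ.XJet z := by
  have hA := (Φ.hasOrder_prJet (k := k) (by omega))
  have hX := Φ.hasOrder_totD_XJet.mono Φ.prDom_subset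
  have h1 := hA.pd_totD_top Φ.isOpen_prDom hz hj
  have h3 : pd (Pi.single j 1) (Φ.prJet (k + 1)) z = _ :=
    pd_div ((hA.totD Φ.isOpen_prDom (by omega)).differentiableAt Φ.isOpen_prDom hz)
    (hX.differentiableAt Φ.isOpen_prDom hz) hz.2
  rw [h3, h1, hX.2 z hz j (by omega)]
  have := hz.2
  field_simp
  simp

theorem pd_prJet_two {z : Jet3} (hz : z ∈ Φ.prDom) :
    pd (Pi.single 4 1) (Φ.prJet 2) z = Φ.prVert z / totD Φ.XJet z ^ 2 := by
  rw [pd_prJet_succ le_rfl (by omega) hz rfl, show (4 - 1 : Fin 6) = 3 from rfl, pd_prJet_one hz,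
    div_div, sq]

theorem pd_prJet_three {z : Jet3} (hz : z ∈ Φ.prDom) :
    pd (Pi.single 5 1) (Φ.prJet 3) z = Φ.prVert z / totD Φ.XJet z ^ 3 := by
  rw [pd_prJet_succ (by omega) le_rfl hz rfl, show (5 - 1 : Fin 6) = 4 from rfl, pd_prJet_two hz,
    div_div, ← pow_succ]

theorem pd_prJet_three_ne_zero {z : Jet3} (hz : z ∈ Φ.prDom) :
    pd (Pi.single 5 1) (Φ.prJet 3) z ≠ 0 := by
  rw [pd_prJet_three hz]
  exact div_ne_zero (Φ.prVert_ne_zero hz) (pow_ne_zero _ hz.2)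

theorem contDiffOn_prMap : ContDiffOn ℝ ∞ Φ.prMap Φ.prDom := by
  intro z hz
  refine (contDiffAt_pi.2 fun i => ?_).contDiffWithinAt
  have h : ∀ k ≤ 3, ContDiffAt ℝ ∞ (Φ.prJet k) z := fun k hk =>
    (Φ.hasOrder_prJet hk).contDiffAt Φ.isOpen_prDom hz
  fin_cases i
  · exact (Φ.contDiffAt_T hz.1).comp (f := fun z : Jet3 => z 0) z
      (ContinuousLinearMap.proj 0 : Jet3 →L[ℝ] ℝ).contDiff.contDiffAt
  · exact Φ.hasOrder_XJet.contDiffAt Φ.isOpen_over hz.1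
  · exact h 0 (by omega)
  · exact h 1 (by omega)
  · exact h 2 (by omega)
  · exact h 3 (by omega)

theorem fderiv_prMap_apply {z : Jet3} (hz : z ∈ Φ.prDom) (v : Jet3) (i : Fin 6) :
    fderiv ℝ Φ.prMap z v i = fderiv ℝ (fun z => Φ.prMap z i) z v := by
  have h : HasFDerivAt Φ.prMap (fderiv ℝ Φ.prMap z) z :=
    ((contDiffOn_prMap.contDiffAt (Φ.isOpen_prDom.mem_nhds hz)).differentiableAt
      (by simp)).hasFDerivAt
  rw [(hasFDerivAt_pi'.1 h i).fderiv]
  rfl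

/-- The derivative is block triangular: the base block is the derivative of the transformation
itself, and each higher coordinate has a nonzero coefficient at the derivative of the same order. A
kernel vector is eliminated from the lowest order upwards. -/
theorem exists_equiv_fderiv_prMap {z : Jet3} (hz : z ∈ Φ.prDom) :
    ∃ e : Jet3 ≃L[ℝ] Jet3, (e : Jet3 →L[ℝ] Jet3) = fderiv ℝ Φ.prMap z := by
  refine exists_equiv_of_injective _ fun v hv => ?_
  have hcomp : ∀ i, fderiv ℝ (fun z => Φ.prMap z i) z v = 0 := fun i => by
    rw [← fderiv_prMap_apply hz, hv]; rfl
  have hbase : baseL v = 0 := by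
    refine eq_zero_of_fderiv_toFun hz.1 ?_
    have h1 : fderiv ℝ (fun z => Φ.toFun (Jet3.base z)) z v = fderiv ℝ Φ.toFun z.base (baseL v) := by
      rw [fderiv_fun_comp z ((contDiffAt_toFun hz.1).differentiableAt (by simp))
        (hasFDerivAt_base z).differentiableAt, (hasFDerivAt_base z).fderiv]
      rfl
    rw [← h1]
    have h2 : DifferentiableAt ℝ (fun z => Φ.toFun (Jet3.base z)) z :=
      ((contDiffAt_toFun hz.1).differentiableAt (by simp)).comp z
        (hasFDerivAt_base z).differentiableAt
    funext i
    have h3 : fderiv ℝ (fun z => Φ.toFun (Jet3.base z)) z v i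
        = fderiv ℝ (fun z => Φ.toFun (Jet3.base z) i) z v := by
      rw [(hasFDerivAt_pi'.1 h2.hasFDerivAt i).fderiv]; rfl
    rw [h3]
    fin_cases i
    · exact hcomp 0
    · exact hcomp 1
    · exact hcomp 2
  rw [coe_baseL] at hbase
  have hv0 : v 0 = 0 := congrFun hbase 0
  have hv1 : v 1 = 0 := congrFun hbase 1
  have hv2 : v 2 = 0 := congrFun hbase 2
  have htop : ∀ k j, 1 ≤ k → k ≤ 3 → j.val = k + 2 → pd (Pi.single j 1) (Φ.prJet k) z ≠ 0 →
      fderiv ℝ (Φ.prJet k) z v = 0 → (∀ i < j, v i = 0) → v j = 0 := by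
    intro k j hk1 hk3 hj hne h0 hlt
    rw [fderiv_eq_sum, Finset.sum_eq_single j] at h0
    · exact (mul_eq_zero.1 h0).resolve_right hne
    · intro i _ hij
      rcases lt_or_gt_of_ne hij with h | h
      · rw [hlt i h, zero_mul]
      · have := (Φ.hasOrder_prJet hk3).2 z hz i (by rw [← hj]; exact h)
        rw [pd] at this
        rw [this, mul_zero]
    · simp
  have hne : Φ.prVert z ≠ 0 := Φ.prVert_ne_zero hz
  have hv3 : v 3 = 0 := htop 1 3 le_rfl (by omega) rfl
    (by rw [pd_prJet_one hz]; exact div_ne_zero hne hz.2) (hcomp 3)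
    (by intro i hi; fin_cases i <;> first | assumption | exact absurd hi (by decide))
  have hv4 : v 4 = 0 := htop 2 4 (by omega) (by omega) rfl
    (by rw [pd_prJet_two hz]; exact div_ne_zero hne (pow_ne_zero _ hz.2)) (hcomp 4)
    (by intro i hi; fin_cases i <;> first | assumption | exact absurd hi (by decide))
  have hv5 : v 5 = 0 := htop 3 5 (by omega) le_rfl rfl (pd_prJet_three_ne_zero hz) (hcomp 5)
    (by intro i hi; fin_cases i <;> first | assumption | exact absurd hi (by decide))
  funext i
  fin_cases i <;> assumption

/-- The factor between the two defects does not vanish, so one is zero exactly when the other is. -/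
theorem Relates.carriesEq {E E' : EvolEq} (h : Φ.Relates E E')
    (hsurj : ∀ z' ∈ E'.dom, ∃ z ∈ E.dom, Φ.prMap z = z') : Φ.CarriesEq E E' := by
  have hjet : ∀ z ∈ E.dom, Φ.CarriesJet z (Φ.prMap z) := fun z hz => by
    obtain ⟨u, hu, hj, -, -⟩ := exists_jet z 0 (fun _ => 0)
    obtain ⟨v, huv⟩ := exists_carriesFun (Φ := Φ) hu.contDiffAt (hj.symm ▸ (h z hz).1)
    exact ⟨u, v, _, huv, hj, by rw [huv.jet3_eq, hj]⟩
  refine ⟨fun z hz => ⟨_, (h z hz).2.1, hjet z hz⟩, fun z' hz' => ?_, ?_⟩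
  · obtain ⟨z, hz, rfl⟩ := hsurj z' hz'
    exact ⟨z, hz, hjet z hz⟩
  · intro u v q huv hz _
    have h1 := (h _ hz).2.2 (Dt u q) (Dx^[4] u q)
    have hne : Φ.prVert (jet3 u q) / deriv Φ.T (jet3 u q 0) ≠ 0 :=
      div_ne_zero (Φ.prVert_ne_zero (h _ hz).1) (Φ.deriv_T_ne_zero _ huv.2.1)
    rw [EvolEq.HoldsAt, EvolEq.HoldsAt, huv.jet3_eq, huv.Dx_four_eq, huv.Dt_eq]
    constructor
    · intro h2
      rw [h2] at h1 ⊢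
      linear_combination h1
    · intro h2
      rw [h2] at h1
      have h3 := (mul_eq_zero.1 (show _ * (Dt u q - E.F (jet3 u q) * Dx^[4] u q
        - E.G (jet3 u q)) = 0 by rw [← h1]; ring)).resolve_left hne
      linear_combination h3

/-- The leading coefficient of the image of `E`, as a function of the original jet. -/
def newF (Φ : EquivTransf) (E : EvolEq) (z : Jet3) : ℝ :=
  Φ.prVert z / deriv Φ.T (z 0) * E.F z * totD Φ.XJet z / pd (Pi.single 5 1) (Φ.prJet 3) z

/-- The lower order terms of the image of `E`, as a function of the original jet. -/
def newG (Φ : EquivTransf) (E : EvolEq) (z : Jet3) : ℝ :=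
  Φ.prTime z (E.G z) - Φ.newF E z * Φ.prFour z 0

theorem newF_ne_zero {E : EvolEq} {z : Jet3} (hz : z ∈ Φ.prDom) (hzE : z ∈ E.dom) :
    Φ.newF E z ≠ 0 :=
  div_ne_zero (mul_ne_zero (mul_ne_zero (div_ne_zero (Φ.prVert_ne_zero hz)
    (Φ.deriv_T_ne_zero _ hz.1)) (E.F_ne_zero z hzE)) hz.2) (pd_prJet_three_ne_zero hz)

theorem newF_newG {E : EvolEq} {z : Jet3} (hz : z ∈ Φ.prDom) (m a : ℝ) :
    Φ.prTime z m - Φ.newF E z * Φ.prFour z a - Φ.newG E z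
      = Φ.prVert z / deriv Φ.T (z 0) * (m - E.F z * a - E.G z) := by
  have h1 := pd_prJet_three_ne_zero hz
  have h2 := hz.2
  have h3 : deriv Φ.T (z 0) ≠ 0 := Φ.deriv_T_ne_zero _ hz.1
  rw [newG, newF, prFour, prFour, prTime, prTime]
  field_simp
  ring

theorem contDiffAt_newF {E : EvolEq} {z : Jet3} (hz : z ∈ Φ.prDom) (hzE : z ∈ E.dom) :
    ContDiffAt ℝ ∞ (Φ.newF E) z ∧ ContDiffAt ℝ ∞ (Φ.newG E) z := by
  have hb : ∀ {f : Base → ℝ} (v : Base), ContDiffAt ℝ ∞ f z.base →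
      ContDiffAt ℝ ∞ (fun z : Jet3 => fderiv ℝ f z.base v) z := fun v hf =>
    ContDiffAt.comp (g := fun b => fderiv ℝ _ b v) (f := Jet3.base) z (contDiffAt_pd hf)
      contDiff_base.contDiffAt
  have hX := Φ.contDiffAt_X hz.1
  have hU := Φ.contDiffAt_U hz.1
  have hT : ContDiffAt ℝ ∞ (fun z : Jet3 => deriv Φ.T (z 0)) z := by
    have h1 : ContDiffAt ℝ ∞ (fun t => fderiv ℝ Φ.T t 1) (z 0) := contDiffAt_pd (Φ.contDiffAt_T hz.1)
    exact ContDiffAt.comp (f := fun z : Jet3 => z 0) z h1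
      (ContinuousLinearMap.proj 0 : Jet3 →L[ℝ] ℝ).contDiff.contDiffAt
  have hT0 : deriv Φ.T (z 0) ≠ 0 := Φ.deriv_T_ne_zero _ hz.1
  have h : ∀ k ≤ 3, ContDiffAt ℝ ∞ (Φ.prJet k) z := fun k hk =>
    (Φ.hasOrder_prJet hk).contDiffAt Φ.isOpen_prDom hz
  have hXJ : ContDiffAt ℝ ∞ (totD Φ.XJet) z := Φ.hasOrder_totD_XJet.contDiffAt Φ.isOpen_over hz.1
  have hV : ContDiffAt ℝ ∞ Φ.prVert z := (hb _ hU).sub ((h 1 (by omega)).mul (hb _ hX))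
  have hF : ContDiffAt ℝ ∞ (Φ.newF E) z :=
    ((((hV.div hT hT0).mul (E.contDiffAt_F hzE)).mul hXJ).div (contDiffAt_pd (h 3 le_rfl))
      (pd_prJet_three_ne_zero hz))
  have h3 : ContDiffAt ℝ ∞ (totD (Φ.prJet 3)) z :=
    (contDiffOn_totD Φ.isOpen_prDom (Φ.hasOrder_prJet le_rfl).1).contDiffAt
      (Φ.isOpen_prDom.mem_nhds hz)
  have h4 : ContDiffAt ℝ ∞ (fun z => Φ.prFour z 0) z :=
    (h3.add (contDiffAt_const.mul (contDiffAt_pd (h 3 le_rfl)))).div hXJ hz.2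
  have h5 : ContDiffAt ℝ ∞ (fun z => Φ.prTime z (E.G z)) z :=
    (((hb _ hU).sub ((h 1 (by omega)).mul (hb _ hX))).add (hV.mul (E.contDiffAt_G hzE))).div hT hT0
  exact ⟨hF, h5.sub (hF.mul h4)⟩

/-- A transformation carries a neighborhood of any jet of its prolongation into a convex open part
of an equation. -/
theorem exists_carriesEq {E : EvolEq} {z : Jet3} (hz : z ∈ Φ.prDom) {O : Set Jet3} (hO : IsOpen O)
    (hzO : z ∈ O) (hOE : O ⊆ E.dom) : ∃ (N : Set Jet3) (hN : IsOpen N) (E' : EvolEq), z ∈ N ∧ N ⊆ O ∧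
      Convex ℝ E'.dom ∧ Φ.Relates (E.restrict N hN) E' ∧
      ∀ z' ∈ E'.dom, ∃ z ∈ (E.restrict N hN).dom, Φ.prMap z = z' := by
  obtain ⟨e, he⟩ := exists_equiv_fderiv_prMap hz
  obtain ⟨Ψ, hs, hsub, hΨ, hsymm⟩ := exists_smooth_local_inverse (Φ.isOpen_prDom.inter hO)
    (contDiffOn_prMap.mono Set.inter_subset_left) ⟨hz, hzO⟩ he.symm
  have ht : Φ.prMap z ∈ Ψ.target := by rw [← hΨ]; exact Ψ.map_source hs
  -- A ball as the new domain is convex, so vanishing partial derivatives of the new coefficients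
  -- will imply independence.
  obtain ⟨δ, hδ, hball⟩ := Metric.isOpen_iff.1 Ψ.open_target _ ht
  have hmem : ∀ z' ∈ Metric.ball (Φ.prMap z) δ, Ψ.symm z' ∈ Φ.prDom ∧ Ψ.symm z' ∈ O ∧
      Φ.prMap (Ψ.symm z') = z' := fun z' hz' => by
    have h1 := hsub (Ψ.map_target (hball hz'))
    exact ⟨h1.1, h1.2, by rw [← hΨ]; exact Ψ.right_inv (hball hz')⟩
  let E' : EvolEq :=
    { dom := Metric.ball (Φ.prMap z) δ
      F := fun z' => Φ.newF E (Ψ.symm z')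
      G := fun z' => Φ.newG E (Ψ.symm z')
      isOpen_dom := Metric.isOpen_ball
      smooth_F := fun z' hz' => ((contDiffAt_newF (hmem z' hz').1 (hOE (hmem z' hz').2.1)).1.comp z'
        (hsymm z' (hball hz'))).contDiffWithinAt
      smooth_G := fun z' hz' => ((contDiffAt_newF (hmem z' hz').1 (hOE (hmem z' hz').2.1)).2.comp z'
        (hsymm z' (hball hz'))).contDiffWithinAt
      F_ne_zero := fun z' hz' => newF_ne_zero (hmem z' hz').1 (hOE (hmem z' hz').2.1) }
  refine ⟨Ψ.source ∩ Ψ ⁻¹' Metric.ball (Φ.prMap z) δ, Ψ.isOpen_inter_preimage Metric.isOpen_ball, E',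
    ⟨hs, ?_⟩, fun y hy => (hsub hy.1).2, convex_ball _ _, fun y hy => ?_, fun z' hz' => ?_⟩
  · rw [Set.mem_preimage, hΨ]; exact Metric.mem_ball_self hδ
  · obtain ⟨-, hys, hyb⟩ := hy
    rw [Set.mem_preimage, hΨ] at hyb
    have hyp := (hsub hys).1
    refine ⟨hyp, hyb, fun m a => ?_⟩
    have hinv : Ψ.symm (Φ.prMap y) = y := by rw [← hΨ]; exact Ψ.left_inv hys
    change Φ.prTime y m - Φ.newF E (Ψ.symm (Φ.prMap y)) * Φ.prFour y a
      - Φ.newG E (Ψ.symm (Φ.prMap y)) = _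
    rw [hinv]
    exact newF_newG hyp m a
  · obtain ⟨h1, h2, h3⟩ := hmem z' hz'
    refine ⟨Ψ.symm z', ⟨hOE h2, Ψ.map_target (hball hz'), ?_⟩, h3⟩
    rw [Set.mem_preimage, hΨ, h3]; exact hz'

/-- If a symmetry is carried into a translation, then the coefficients of the image do not depend on
the respective argument. -/
theorem Relates.indepOf {E E' : EvolEq} (h : Φ.Relates E E')
    (hsurj : ∀ z' ∈ E'.dom, ∃ z ∈ E.dom, Φ.prMap z = z') (hconv : Convex ℝ E'.dom)
    {V : Base → Base} {D : Set Base} (hD : IsOpen D) (hV : ContDiffOn ℝ ∞ V D)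
    (hadm : E.Admits V D) (hED : ∀ z ∈ E.dom, z.base ∈ D) {i : Fin 3} (hi : i ≠ 2)
    (hc : Φ.Carries V fun _ => Pi.single i 1) : E'.IndepOf (i.castLE (by omega)) := by
  refine EvolEq.indepOf_of_fderiv_eq_zero (fun z hz z' hz' _ => hconv.segment_subset hz hz')
    fun z' hz' => ?_
  obtain ⟨z, hz, rfl⟩ := hsurj z' hz'
  have hzp := (h z hz).1
  have key : ∀ a, fderiv ℝ E'.F (Φ.prMap z) (Pi.single (i.castLE (by omega)) 1) * Φ.prFour z a
      + fderiv ℝ E'.G (Φ.prMap z) (Pi.single (i.castLE (by omega)) 1) = 0 := fun a => by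
    obtain ⟨u, hu, hj, h4, hm⟩ := exists_jet z a (fun _ => E.F z * a + E.G z)
    set q : ℝ × ℝ := (z 0, z 1)
    have hm0 : Dt u q = E.F z * a + E.G z := hm 0 (by omega)
    have hub : graphPt u q = z.base := by rw [← base_jet3, hj]
    have hhold : E.HoldsAt u q := by rw [EvolEq.HoldsAt, hj, h4, hm0]
    have hgD : graphPt u q ∈ D := hub ▸ hED z hz
    have hgS : graphPt u q ∈ Φ.source := hub ▸ hzp.1
    have hjE : jet3 u q ∈ E.dom := hj.symm ▸ hz
    obtain ⟨v, huv, hL⟩ := h.lieExpr_eq (V := V) (V' := fun _ => Pi.single i 1) hu.contDiffAt hjE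
      (hV.contDiffAt (hD.mem_nhds hgD)) contDiffAt_const
      (by filter_upwards [Φ.isOpen_source.mem_nhds hgS] with b hb using hc b hb) hhold
    have h0 : lieExpr E V u q = 0 := hadm u q hu.contDiffAt hgD hjE hhold
    rw [h0, mul_zero, lieExpr_translation E' hi, huv.jet3_eq, huv.Dx_four_eq, hj, h4] at hL
    linarith
  -- The new fourth derivative is a nonconstant affine function of the old one, so it takes two
  -- different values and the coefficients in `key` separate.
  have hd : Φ.prFour z 1 - Φ.prFour z 0 ≠ 0 := by
    have : Φ.prFour z 1 - Φ.prFour z 0 = pd (Pi.single 5 1) (Φ.prJet 3) z / totD Φ.XJet z := by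
      rw [prFour, prFour]; ring
    rw [this]
    exact div_ne_zero (pd_prJet_three_ne_zero hzp) hzp.2
  have hF : fderiv ℝ E'.F (Φ.prMap z) (Pi.single (i.castLE (by omega)) 1) = 0 := by
    refine (mul_eq_zero.1 (?_ : _ * (Φ.prFour z 1 - Φ.prFour z 0) = 0)).resolve_right hd
    linear_combination key 1 - key 0
  refine ⟨hF, ?_⟩
  have := key 0
  rwa [hF, zero_mul, zero_add] at this

/-- A transformation that carries a symmetry into a translation reduces the equation. -/
theorem reducesNear {E : EvolEq} {V : Base → Base} {D : Set Base} (hD : IsOpen D)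
    (hV : ContDiffOn ℝ ∞ V D) (hadm : E.Admits V D) {z : Jet3} (hzE : z ∈ E.dom)
    (hzD : z.base ∈ D) (hz : z ∈ Φ.prDom) {i : Fin 3} (hi : i ≠ 2)
    (hc : Φ.Carries V fun _ => Pi.single i 1) :
    ReducesNear E V z (fun _ => Pi.single i 1) (i.castLE (by omega)) := by
  obtain ⟨N, hN, E', hzN, hNO, hconv, hrel, hsurj⟩ := exists_carriesEq hz
    (E.isOpen_dom.inter (hD.preimage continuous_base)) ⟨hzE, hzD⟩ Set.inter_subset_left
  exact ⟨Φ, N, hN, E', hzN, hz.1, hc, hrel.carriesEq hsurj,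
    hrel.indepOf hsurj hconv hD hV (fun u q hu hq hj hh => hadm u q hu hq hj.1 hh)
      (fun y hy => (hNO hy.2).2) hi hc⟩

end EquivTransf

/-! ### Straightening of admitted fields -/

/-- Local coordinates with nondegenerate derivative at a point define an equivalence
transformation near that point. -/
theorem exists_equivTransf {T : ℝ → ℝ} (hT : ContDiff ℝ ∞ T) {X U : Base → ℝ} {S : Set Base}
    (hS : IsOpen S) (hX : ContDiffOn ℝ ∞ X S) (hU : ContDiffOn ℝ ∞ U S) {p : Base} (hp : p ∈ S)
    (hT' : deriv T (p 0) ≠ 0)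
    (hJ : fderiv ℝ X p (Pi.single 1 1) * fderiv ℝ U p (Pi.single 2 1)
      - fderiv ℝ X p (Pi.single 2 1) * fderiv ℝ U p (Pi.single 1 1) ≠ 0) :
    ∃ Φ : EquivTransf, p ∈ Φ.source ∧ Φ.source ⊆ S ∧ Φ.T = T ∧ Φ.X = X ∧ Φ.U = U := by
  set f : Base → Base := fun b => ![T (b 0), X b, U b] with hf
  have hfs : ContDiffOn ℝ ∞ f S := by
    refine contDiffOn_pi.2 fun i => ?_
    fin_cases i
    · exact (hT.comp (ContinuousLinearMap.proj 0 : Base →L[ℝ] ℝ).contDiff).contDiffOn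
    · exact hX
    · exact hU
  have hfd : ∀ v, fderiv ℝ f p v = ![deriv T (p 0) * v 0, fderiv ℝ X p v, fderiv ℝ U p v] :=
    fderiv_triangular ((hT.differentiable (by simp)) _).hasDerivAt
      ((hX.contDiffAt (hS.mem_nhds hp)).differentiableAt (by simp))
      ((hU.contDiffAt (hS.mem_nhds hp)).differentiableAt (by simp))
  obtain ⟨e, he⟩ := exists_equiv_of_injective (fderiv ℝ f p) fun v hv => by
    rw [hfd] at hv
    exact eq_zero_of_triangular hT' hJ hv
  obtain ⟨Ψ, hs, hsub, hΨ, -⟩ := exists_smooth_local_inverse hS hfs hp he.symm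
  have hTd : Continuous fun b : Base => deriv T (b 0) :=
    (hT.continuous_deriv (by simp)).comp (continuous_apply 0)
  have hfd : ∀ {g : Base → ℝ}, ContDiffOn ℝ ∞ g S → ∀ v : Base,
      ContinuousOn (fun b => fderiv ℝ g b v) S := fun hg v =>
    (hg.continuousOn_fderiv_of_isOpen hS (by simp)).clm_apply continuousOn_const
  have hJc : ContinuousOn (fun b => fderiv ℝ X b (Pi.single 1 1) * fderiv ℝ U b (Pi.single 2 1)
      - fderiv ℝ X b (Pi.single 2 1) * fderiv ℝ U b (Pi.single 1 1)) Ψ.source :=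
    (((hfd hX _).mul (hfd hU _)).sub ((hfd hX _).mul (hfd hU _))).mono hsub
  exact ⟨{
    source := (Ψ.source ∩ (fun b => fderiv ℝ X b (Pi.single 1 1) * fderiv ℝ U b (Pi.single 2 1)
      - fderiv ℝ X b (Pi.single 2 1) * fderiv ℝ U b (Pi.single 1 1)) ⁻¹' {0}ᶜ) ∩
        (fun b : Base => deriv T (b 0)) ⁻¹' {0}ᶜ
    T := T
    X := X
    U := U
    isOpen_source := (hJc.isOpen_inter_preimage Ψ.open_source isOpen_compl_singleton).inter
      (isOpen_compl_singleton.preimage hTd)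
    smooth_T := hT.contDiffOn
    smooth_X := hX.mono fun b hb => hsub hb.1.1
    smooth_U := hU.mono fun b hb => hsub hb.1.1
    injOn := fun b hb b' hb' h => Ψ.injOn hb.1.1 hb'.1.1 (by rw [hΨ, hΨ]; exact h)
    deriv_T_ne_zero := fun b hb => hb.2
    jacobian_ne_zero := fun b hb => hb.1.2 }, ⟨⟨hs, hJ⟩, hT'⟩, fun b hb => hsub hb.1.1, rfl, rfl, rfl⟩

theorem fderiv_component {Θ : Base → Base} {b : Base} (h : DifferentiableAt ℝ Θ b) (i : Fin 3)
    (v : Base) : fderiv ℝ (fun b => Θ b i) b v = fderiv ℝ Θ b v i := by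
  rw [(hasFDerivAt_pi'.1 h.hasFDerivAt i).fderiv]; rfl

/-- A function with everywhere vanishing derivative in two coordinate directions depends on the
remaining coordinate only, locally. -/
theorem eventually_eq_update {f : Base → ℝ} {p : Base} (hf : ContDiffAt ℝ ∞ f p)
    (h : ∀ᶠ b in 𝓝 p, fderiv ℝ f b (Pi.single 1 1) = 0 ∧ fderiv ℝ f b (Pi.single 2 1) = 0) :
    ∀ᶠ b in 𝓝 p, f b = f (Function.update p 0 (b 0)) := by
  obtain ⟨δ, hδ, hball⟩ := Metric.eventually_nhds_iff_ball.1 (h.and (eventually_differentiableAt hf))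
  filter_upwards [Metric.ball_mem_nhds p hδ] with b hb
  have hb' : Function.update p 0 (b 0) ∈ Metric.ball p δ := by
    rw [Metric.mem_ball] at hb ⊢
    refine lt_of_le_of_lt ((dist_pi_le_iff dist_nonneg).2 fun i => ?_) hb
    rcases eq_or_ne i 0 with rfl | hi
    · rw [Function.update_self]; exact dist_le_pi_dist b p 0
    · rw [Function.update_of_ne hi, dist_self]; exact dist_nonneg
  set b' := Function.update p 0 (b 0)
  have hseg : ∀ s ∈ Set.Icc (0 : ℝ) 1, b' + s • (b - b') ∈ Metric.ball p δ := fun s hs =>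
    (convex_ball p δ).add_smul_sub_mem hb' hb hs
  have hd : ∀ s ∈ Set.Icc (0 : ℝ) 1,
      HasDerivAt (fun s : ℝ => f (b' + s • (b - b'))) 0 s := fun s hs => by
    have h1 : HasDerivAt (fun s : ℝ => b' + s • (b - b')) (b - b') s :=
      (((hasDerivAt_id s).smul_const (b - b')).const_add b').congr_deriv (by simp)
    obtain ⟨⟨h2, h3⟩, h4⟩ := hball _ (hseg s hs)
    refine (h4.hasFDerivAt.comp_hasDerivAt s h1).congr_deriv ?_
    rw [fderiv_eq_sum, Fin.sum_univ_three, h2, h3]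
    simp [b']
  have h5 := constant_of_derivWithin_zero (f := fun s : ℝ => f (b' + s • (b - b'))) (a := 0) (b := 1)
    (fun s hs => (hd s hs).differentiableAt.differentiableWithinAt)
    (fun s hs => by
      rw [(hd s ⟨hs.1, hs.2.le⟩).hasDerivWithinAt.derivWithin
        (uniqueDiffOn_Icc_zero_one s ⟨hs.1, hs.2.le⟩)]) 1 (by norm_num)
  simpa using h5

/-- If `τ` depends on `t` only and does not vanish, then it can be normalized by a change of `t`. -/
theorem exists_time_coordinate {τ : Base → ℝ} {p : Base} {D : Set Base} (hD : IsOpen D)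
    (hp : p ∈ D) (hτ : ContDiffOn ℝ ∞ τ D) (h0 : τ p ≠ 0)
    (h : ∀ᶠ b in 𝓝 p, fderiv ℝ τ b (Pi.single 1 1) = 0 ∧ fderiv ℝ τ b (Pi.single 2 1) = 0) :
    ∃ T : ℝ → ℝ, ContDiff ℝ ∞ T ∧ ∀ᶠ b in 𝓝 p, deriv T (b 0) * τ b = 1 := by
  have hup : ContDiff ℝ ∞ fun t : ℝ => Function.update p 0 t := by
    refine contDiff_pi.2 fun i => ?_
    rcases eq_or_ne i 0 with rfl | hi
    · simp only [Function.update_self]; exact contDiff_id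
    · simp only [Function.update_of_ne hi]; exact contDiff_const
  have hpp : Function.update p 0 (p 0) = p := Function.update_eq_self 0 p
  set J : Set ℝ := (fun t : ℝ => Function.update p 0 t) ⁻¹' (D ∩ τ ⁻¹' {0}ᶜ)
  have hJ : IsOpen J := (hτ.continuousOn.isOpen_inter_preimage hD isOpen_compl_singleton).preimage
    hup.continuous
  have hpJ : p 0 ∈ J := by
    change Function.update p 0 (p 0) ∈ D ∩ τ ⁻¹' {0}ᶜ
    rw [hpp]; exact ⟨hp, h0⟩
  have hg : ContDiffOn ℝ ∞ (fun t => (τ (Function.update p 0 t))⁻¹) J :=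
    (hτ.comp hup.contDiffOn fun t ht => ht.1).inv fun t ht => ht.2
  -- The function 1/τ of t is known near p₀ only. Replacing it by a smooth function on the whole
  -- line gives a globally smooth primitive T.
  obtain ⟨g, hgs, hgτ⟩ := exists_contDiff_eventuallyEq hJ hg hpJ
  have hder : ∀ t, HasDerivAt (fun t => ∫ s in (0 : ℝ)..t, g s) (g t) t := fun t =>
    (hgs.continuous.integral_hasStrictDerivAt 0 t).hasDerivAt
  have hderiv : deriv (fun t => ∫ s in (0 : ℝ)..t, g s) = g := funext fun t => (hder t).deriv
  refine ⟨fun t => ∫ s in (0 : ℝ)..t, g s, contDiff_infty_iff_deriv.2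
    ⟨fun t => (hder t).differentiableAt, hderiv.symm ▸ hgs⟩, ?_⟩
  have hc : ContinuousAt (fun b : Base => b 0) p := (continuous_apply 0).continuousAt
  filter_upwards [eventually_eq_update (hτ.contDiffAt (hD.mem_nhds hp)) h, hc.eventually hgτ,
    (hτ.continuousOn.isOpen_inter_preimage hD isOpen_compl_singleton).mem_nhds ⟨hp, h0⟩]
    with b h1 h2 h3
  rw [hderiv, h2, ← h1]
  exact inv_mul_cancel₀ h3.2

/-- Near a point at which `τ ≠ 0`, a field with `τ = τ(t)` can be carried into `∂_t`. -/
theorem exists_carries_fieldT {V : Base → Base} {D : Set Base} (hD : IsOpen D)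
    (hV : ContDiffOn ℝ ∞ V D) {z : Jet3} (hz : z.base ∈ D) (h0 : V z.base 0 ≠ 0)
    (hτ : ∀ᶠ b in 𝓝 z.base, fderiv ℝ (fun b => V b 0) b (Pi.single 1 1) = 0 ∧
      fderiv ℝ (fun b => V b 0) b (Pi.single 2 1) = 0) :
    ∃ Φ : EquivTransf, z ∈ Φ.prDom ∧ Φ.Carries V fun _ => Pi.single 0 1 := by
  set p := z.base
  obtain ⟨T, hT, hTV⟩ := exists_time_coordinate hD hz (contDiffOn_component hV 0) h0 hτ
  -- This map sends ∂_t to V(p) and fixes ∂_x and ∂_u, so the flow box agrees with (x, u) to first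
  -- order in these directions. It is injective because τ(p) ≠ 0.
  obtain ⟨L, hL⟩ := exists_equiv_of_injective (ContinuousLinearMap.id ℝ Base
    + (ContinuousLinearMap.proj 0 : Base →L[ℝ] ℝ).smulRight (V p - Pi.single 0 1)) fun v hv => by
    have hv' : v + v 0 • (V p - Pi.single 0 1) = 0 := hv
    have h1 := congrFun hv' 0
    simp at h1
    have h2 : v 0 = 0 := (mul_eq_zero.1 (show v 0 * V p 0 = 0 by linear_combination h1)).resolve_right h0
    rw [h2, zero_smul, add_zero] at hv'
    exact hv'
  have hLv : ∀ v, L v = v + v 0 • (V p - Pi.single 0 1) := fun v =>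
    congrArg (fun A : Base →L[ℝ] Base => A v) hL
  obtain ⟨Θ, S, hS, hpS, hSD, hΘ, hΘp, hΘV⟩ := exists_flow_box hD hV hz L (by rw [hLv]; simp)
  have hd : ∀ b ∈ S, DifferentiableAt ℝ Θ b := fun b hb =>
    (hΘ.contDiffAt (hS.mem_nhds hb)).differentiableAt (by simp)
  have hsymm : ∀ i : Fin 3, i ≠ 0 → fderiv ℝ Θ p (Pi.single i 1) = Pi.single i 1 := fun i hi => by
    rw [hΘp]
    refine L.symm_apply_eq.2 ?_
    rw [hLv]; simp [hi.symm]
  have hX : ∀ j i : Fin 3, i ≠ 0 → fderiv ℝ (fun b => Θ b j) p (Pi.single i 1)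
      = (Pi.single i 1 : Base) j := fun j i hi => by
    rw [fderiv_component (hd p hpS), hsymm i hi]
  obtain ⟨S', hS'sub, hS', hpS'⟩ := eventually_nhds_iff.1 hTV
  -- Only the two invariants are taken from the flow box. Its first coordinate may depend on x and
  -- u, so `T` replaces it.
  obtain ⟨Φ, hpΦ, hΦS, hΦT, hΦX, hΦU⟩ := exists_equivTransf hT (hS.inter hS')
    ((contDiffOn_component hΘ 1).mono Set.inter_subset_left)
    ((contDiffOn_component hΘ 2).mono Set.inter_subset_left) ⟨hpS, hpS'⟩
    (left_ne_zero_of_mul (hTV.self_of_nhds.trans_ne one_ne_zero)) (by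
      rw [hX 1 1 (by decide), hX 2 2 (by decide), hX 1 2 (by decide)]; simp)
  refine ⟨Φ, ⟨hpΦ, ?_⟩, fun b hb => ?_⟩
  · rw [Φ.totD_XJet hpΦ, hΦX, hX 1 1 (by decide), hX 1 2 (by decide)]
    simp
  · obtain ⟨hbS, hbS'⟩ := hΦS hb
    rw [Φ.fderiv_toFun hb, hΦT, hΦX, hΦU, fderiv_component (hd b hbS), fderiv_component (hd b hbS),
      hΘV b hbS, hS'sub b hbS']
    funext i
    fin_cases i <;> simp

/-- Near a point of a non-vanishing field with `τ = 0`, the field can be carried into `∂_x`. -/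
theorem exists_carries_fieldX {V : Base → Base} {D : Set Base} (hD : IsOpen D)
    (hV : ContDiffOn ℝ ∞ V D) {z : Jet3} (hz : z.base ∈ D) (hne : V z.base ≠ 0)
    (hτ : ∀ᶠ b in 𝓝 z.base, V b 0 = 0) :
    ∃ Φ : EquivTransf, z ∈ Φ.prDom ∧ Φ.Carries V fun _ => Pi.single 1 1 := by
  set p := z.base
  have hp0 : V p 0 = 0 := hτ.self_of_nhds
  -- The vector a ∂_x + b ∂_u completes V(p) to a basis of the (x, u)-plane. Up to a nonzero factor
  -- D_x X is b − a u_x at the given jet, so the transversal must also avoid the tangent of the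
  -- graph.
  obtain ⟨a, b, hab, habz⟩ : ∃ a b : ℝ, V p 1 * b - V p 2 * a ≠ 0 ∧ b - a * z 3 ≠ 0 := by
    by_cases h1 : V p 1 = 0
    · have h2 : V p 2 ≠ 0 := fun h2 => hne (by
        funext i
        fin_cases i
        · exact hp0
        · exact h1
        · exact h2)
      exact ⟨1, z 3 + 1, by simpa [h1] using h2, by simp⟩
    · exact ⟨0, 1, by simpa using h1, by simp⟩
  set A : Base →L[ℝ] Base := (ContinuousLinearMap.proj 0 : Base →L[ℝ] ℝ).smulRight (V p)
      + (ContinuousLinearMap.proj 1 : Base →L[ℝ] ℝ).smulRight (![0, a, b] : Base)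
      + (ContinuousLinearMap.proj 2 : Base →L[ℝ] ℝ).smulRight (![1, 0, 0] : Base)
  have hA : ∀ v, A v = ![v 2, v 0 * V p 1 + v 1 * a, v 0 * V p 2 + v 1 * b] := fun v => by
    funext i
    fin_cases i
    · change v 0 * V p 0 + v 1 * 0 + v 2 * 1 = v 2
      rw [hp0]; ring
    · change v 0 * V p 1 + v 1 * a + v 2 * 0 = _
      rw [mul_zero, add_zero]; rfl
    · change v 0 * V p 2 + v 1 * b + v 2 * 0 = _
      rw [mul_zero, add_zero]; rfl
  obtain ⟨L, hL⟩ := exists_equiv_of_injective A fun v hv => by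
    rw [hA] at hv
    have h0 : v 2 = 0 := congrFun hv 0
    have h1 : v 0 * V p 1 + v 1 * a = 0 := congrFun hv 1
    have h2 : v 0 * V p 2 + v 1 * b = 0 := congrFun hv 2
    have hv0 : v 0 = 0 := (mul_eq_zero.1 (show v 0 * (V p 1 * b - V p 2 * a) = 0 by
      linear_combination b * h1 - a * h2)).resolve_right hab
    have hv1 : v 1 = 0 := (mul_eq_zero.1 (show v 1 * (V p 1 * b - V p 2 * a) = 0 by
      linear_combination V p 1 * h2 - V p 2 * h1)).resolve_right hab
    funext i
    fin_cases i
    · exact hv0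
    · exact hv1
    · exact h0
  have hLv : ∀ v, L v = ![v 2, v 0 * V p 1 + v 1 * a, v 0 * V p 2 + v 1 * b] :=
    fun v => (congrArg (fun A : Base →L[ℝ] Base => A v) hL).trans (hA v)
  obtain ⟨Θ, S, hS, hpS, hSD, hΘ, hΘp, hΘV⟩ := exists_flow_box hD hV hz L (by
    rw [hLv]
    funext i
    fin_cases i
    · simp [hp0]
    · simp
    · simp)
  have hd : ∀ b ∈ S, DifferentiableAt ℝ Θ b := fun b hb =>
    (hΘ.contDiffAt (hS.mem_nhds hb)).differentiableAt (by simp)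
  set d := V p 1 * b - V p 2 * a with hd_def
  have hs1 : fderiv ℝ Θ p (Pi.single 1 1) = ![b / d, -V p 2 / d, 0] := by
    rw [hΘp]
    refine L.symm_apply_eq.2 ?_
    rw [hLv]
    funext i
    fin_cases i
    · simp
    · simp; field_simp; rw [hd_def]; ring
    · simp; field_simp; ring
  have hs2 : fderiv ℝ Θ p (Pi.single 2 1) = ![-a / d, V p 1 / d, 0] := by
    rw [hΘp]
    refine L.symm_apply_eq.2 ?_
    rw [hLv]
    funext i
    fin_cases i
    · simp
    · simp; field_simp; ring
    · simp; field_simp; rw [hd_def]; ring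
  have hX : ∀ (j : Fin 3) (v : Base), fderiv ℝ (fun b => Θ b j) p v = fderiv ℝ Θ p v j :=
    fun j v => fderiv_component (hd p hpS) j v
  obtain ⟨S', hS'sub, hS', hpS'⟩ := eventually_nhds_iff.1 hτ
  -- The parameter along the orbits becomes X and one invariant becomes U. Time is unchanged, which
  -- is consistent because τ = 0.
  obtain ⟨Φ, hpΦ, hΦS, hΦT, hΦX, hΦU⟩ := exists_equivTransf (T := id) contDiff_id (hS.inter hS')
    ((contDiffOn_component hΘ 0).mono Set.inter_subset_left)
    ((contDiffOn_component hΘ 1).mono Set.inter_subset_left) ⟨hpS, hpS'⟩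
    (by simp) (by
      rw [hX, hX, hX, hX, hs1, hs2]
      have : b / d * (V p 1 / d) - -a / d * (-V p 2 / d) = 1 / d := by
        field_simp; rw [hd_def]; ring
      exact this.trans_ne (one_div_ne_zero hab))
  refine ⟨Φ, ⟨hpΦ, ?_⟩, fun b' hb => ?_⟩
  · rw [Φ.totD_XJet hpΦ, hΦX, hX, hX, hs1, hs2]
    have : b / d + z 3 * (-a / d) = (b - a * z 3) / d := by ring
    exact this.trans_ne (div_ne_zero habz hab)
  · obtain ⟨hbS, hbS'⟩ := hΦS hb
    rw [Φ.fderiv_toFun hb, hΦT, hΦX, hΦU, fderiv_component (hd b' hbS),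
      fderiv_component (hd b' hbS), hΘV b' hbS, hS'sub b' hbS']
    funext i
    fin_cases i <;> simp

/-! ### The regular set -/

theorem isOpen_regularSet {V : Base → Base} {D : Set Base} (hD : IsOpen D)
    (hV : ContinuousOn V D) : IsOpen (regularSet V D) := by
  have h0 : ContinuousOn (fun p => V p 0) D := (continuous_apply 0).comp_continuousOn hV
  have h : regularSet V D = (D ∩ (fun p => V p 0) ⁻¹' {0}ᶜ) ∪
      ((D ∩ V ⁻¹' {0}ᶜ) ∩ {p | ∀ᶠ p' in 𝓝 p, V p' 0 = 0}) := by
    ext p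
    constructor
    · rintro ⟨h1, h2, h3 | h3⟩
      · exact Or.inl ⟨h1, h3⟩
      · exact Or.inr ⟨⟨h1, h2⟩, h3⟩
    · rintro (⟨h1, h2⟩ | ⟨⟨h1, h2⟩, h3⟩)
      · exact ⟨h1, fun h => h2 (congrFun h 0), Or.inl h2⟩
      · exact ⟨h1, h2, Or.inr h3⟩
  rw [h]
  exact (h0.isOpen_inter_preimage hD isOpen_compl_singleton).union
    ((hV.isOpen_inter_preimage hD isOpen_compl_singleton).inter isOpen_setOfPred_eventually_nhds)

/-- If a neighbourhood of `p` missed the regular set, τ would vanish at all nearby points, which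
would make `p` itself regular. -/
theorem subset_closure_regularSet {V : Base → Base} {D : Set Base} (hD : IsOpen D)
    (hV : ContinuousOn V D) : {p | p ∈ D ∧ V p ≠ 0} ⊆ closure (regularSet V D) := by
  rintro p ⟨hp, hne⟩
  by_contra hcl
  have h1 : ∀ᶠ p' in 𝓝 p, p' ∉ regularSet V D :=
    Filter.mem_of_superset (isClosed_closure.isOpen_compl.mem_nhds hcl) fun _ h h' =>
      h (subset_closure h')
  have h2 : ∀ᶠ p' in 𝓝 p, p' ∈ D ∩ V ⁻¹' {0}ᶜ :=
    (hV.isOpen_inter_preimage hD isOpen_compl_singleton).mem_nhds ⟨hp, hne⟩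
  refine h1.self_of_nhds ⟨hp, hne, Or.inr ?_⟩
  filter_upwards [h1, h2] with p' h3 h4
  by_contra h5
  exact h3 ⟨h4.1, h4.2, Or.inl h5⟩

/-- Every admitted field can be reduced to a translation at the points of the regular set. -/
theorem reducesNear_of_mem_regularSet {E : EvolEq} {V : Base → Base} {D : Set Base}
    (hD : IsOpen D) (hV : ContDiffOn ℝ ∞ V D) (hadm : E.Admits V D) {z : Jet3} (hz : z ∈ E.dom)
    (hr : z.base ∈ regularSet V D) :
    (V z.base 0 ≠ 0 → ReducesNear E V z fieldT 0) ∧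
      (V z.base 0 = 0 → ReducesNear E V z fieldX 1) := by
  obtain ⟨hzD, hne, hor⟩ := hr
  constructor
  · intro h0
    have hopen : IsOpen (D ∩ Jet3.base '' E.dom) := hD.inter (isOpenMap_base _ E.isOpen_dom)
    obtain ⟨Φ, hΦ, hc⟩ := exists_carries_fieldT hD hV hzD h0 (by
      filter_upwards [hopen.mem_nhds ⟨hzD, z, hz, rfl⟩] with b hb
      exact fderiv_time_eq_zero hD hV hadm hb.1 hb.2)
    rw [fieldT_eq]
    exact EquivTransf.reducesNear hD hV hadm hz hzD hΦ (i := 0) (by decide) hc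
  · intro h0
    obtain ⟨Φ, hΦ, hc⟩ := exists_carries_fieldX hD hV hzD hne (hor.resolve_left fun h => h h0)
    rw [fieldX_eq]
    exact EquivTransf.reducesNear hD hV hadm hz hzD hΦ (i := 1) (by decide) hc

end

/-- Classification of the equations `u_t = F u_xxxx + G` that admit a one-parameter group:
(1) reduction of every admitted field to `∂_t` or `∂_x` at generic points;
(2) the equations that admit `∂_t`, respectively `∂_x`;
(3) inequivalence of the two algebras and of the two kinds of equations;
(4) maximality of the two algebras for arbitrary coefficients. -/
theorem theorem1 :
    (∀ (E : EvolEq) (D : Set Base) (V : Base → Base), IsOpen D → ContDiffOn ℝ ∞ V D →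
      E.Admits V D →
        IsOpen (regularSet V D) ∧ {p | p ∈ D ∧ V p ≠ 0} ⊆ closure (regularSet V D) ∧
        ∀ z ∈ E.dom, z.base ∈ regularSet V D →
          (V z.base 0 ≠ 0 → ReducesNear E V z fieldT 0) ∧
          (V z.base 0 = 0 → ReducesNear E V z fieldX 1)) ∧
    (∀ E : EvolEq,
      (E.IndepOf 0 → E.Admits fieldT Set.univ) ∧
      (E.IndepOf 1 → E.Admits fieldX Set.univ) ∧
      (E.LineConvex 0 → E.Admits fieldT Set.univ → E.IndepOf 0) ∧
      (E.LineConvex 1 → E.Admits fieldX Set.univ → E.IndepOf 1)) ∧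
    ((∀ Φ : EquivTransf, Φ.source.Nonempty → ∀ c : ℝ,
        ¬ Φ.Carries fieldT (fun p => c • fieldX p) ∧
        ¬ Φ.Carries fieldX (fun p => c • fieldT p)) ∧
      (∀ (E E' : EvolEq) (Φ : EquivTransf) (N : Set Jet3) (hN : IsOpen N),
        (E.restrict N hN).dom.Nonempty → Φ.CarriesEq (E.restrict N hN) E' →
          (E.MaximalAlgebra fieldT → ¬ E'.IndepOf 1) ∧
          (E.MaximalAlgebra fieldX → ¬ E'.IndepOf 0))) ∧
    (GenericallyMaximal 0 fieldT ∧ GenericallyMaximal 1 fieldX) := by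
  refine ⟨fun E D V hD hV hadm => ⟨isOpen_regularSet hD hV.continuousOn,
    subset_closure_regularSet hD hV.continuousOn, fun z hz hr =>
      reducesNear_of_mem_regularSet hD hV hadm hz hr⟩, fun E => ⟨fun h => ?_, fun h => ?_,
    fun hc h => ?_, fun hc h => ?_⟩, ⟨fun Φ hne c => ⟨Φ.not_carries_fieldT hne c,
      Φ.not_carries_fieldX hne c⟩, fun E E' Φ N hN hne hEE =>
      ⟨EquivTransf.not_indepOf_one_of_maximal hne hEE,
        EquivTransf.not_indepOf_zero_of_maximal hne hEE⟩⟩,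
    genericallyMaximal_fieldT, genericallyMaximal_fieldX⟩
  · rw [fieldT_eq]
    exact EvolEq.IndepOf.admits (i := 0) (by decide) h _
  · rw [fieldX_eq]
    exact EvolEq.IndepOf.admits (i := 1) (by decide) h _
  · rw [fieldT_eq] at h
    exact EvolEq.indepOf_of_fderiv_eq_zero hc fun z hz =>
      EvolEq.fderiv_eq_zero_of_admits (i := 0) (by decide) h hz
  · rw [fieldX_eq] at h
    exact EvolEq.indepOf_of_fderiv_eq_zero hc fun z hz =>
      EvolEq.fderiv_eq_zero_of_admits (i := 1) (by decide) h hz
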